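/- Let $S_{10}\subset\mathbb{P}^{15}$ be the ten-dimensional spinor variety over $\mathbb{C}$, that is, the orthogonal Grassmannian $SO(5,10)$ of one family of four-dimensional linear spaces in a smooth quadric in $\mathbb{P}^9$, in its spinor embedding. Let $\Lambda\subset\mathbb{P}^{15}$ be a linear subspace of dimension $10$ such that the linear section $L=S_{10}\cap\Lambda$ has dimension $5$ and has a node at a point $p$ (the tangent cone of $L$ at $p$ is a cone over a nonsingular quadric in a tangent space of dimension $6$); this covers in particular the general nodal $5$-dimensional linear section of $S_{10}$. Let $L'\subset\mathbb{P}^9$ be the projection of $L$ from the node $p$, that is, the closure of the image of $L\setminus\{p\}$ under the linear projection $\Lambda\dashrightarrow\mathbb{P}^9$ from $p$. Then there is a quadric $Q\subset\mathbb{P}^9$ not containing the Grassmannian $G(2,5)\subset\mathbb{P}^9$ (in its Plücker embedding) such that $L'$ is isomorphic to $G(2,5)\cap Q$, through a linear isomorphism of the ambient spaces $\mathbb{P}^9$. This holds for the underlying closed sets, and also scheme-theoretically: the isomorphism identifies the ideal of the scheme-theoretic image of $L$ under the projection with the sum of the homogeneous ideal of $G(2,5)$ and the ideal generated by the equation of $Q$.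 -/

import Mathlib

open MvPolynomial

noncomputable section

/-- Even subsets of a five-element set: they index the sixteen coordinates
`x_0, x_{ij}, x_{ijkl}` of the half-spin space, so that `ℙ¹⁵ = ℙ(EvenSubset → ℂ)`. -/
abbrev EvenSubset : Type := {T : Finset (Fin 5) // Even T.card}

/-- The sixteen-dimensional half-spin space, the even part of the exterior algebra of `ℂ⁵`
written in the basis `e_T = e_{i₁} ∧ e_{i₂} ∧ ⋯` with `i₁ < i₂ < ⋯` the elements of `T`. -/
abbrev HalfSpin : Type := EvenSubset → ℂ

/-- The coefficient of `e_T` in a half-spinor; it is zero when `T` has odd cardinality. -/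
def HalfSpin.coeff (ψ : HalfSpin) (T : Finset (Fin 5)) : ℂ :=
  if h : Even T.card then ψ ⟨T, h⟩ else 0

/-- The Clifford action of a vector `u = (v, ξ)` of `ℂ⁵ ⊕ (ℂ⁵)*` on a half-spinor `ψ`:
the coefficient of `e_T` in `v ∧ ψ + ξ ⌟ ψ`. The quadratic form on `ℂ⁵ ⊕ (ℂ⁵)*` is
`(v, ξ) ↦ ∑ i, v i * ξ i`. -/
def cliffordAction (u : (Fin 5 → ℂ) × (Fin 5 → ℂ)) (ψ : HalfSpin) (T : Finset (Fin 5)) : ℂ :=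
  ∑ i : Fin 5, (-1) ^ (T.filter (fun j => j < i)).card *
    (if i ∈ T then u.1 i * ψ.coeff (T.erase i) else u.2 i * ψ.coeff (insert i T))

/-- The affine cone over the ten-dimensional spinor variety `S₁₀ = SO(5,10) ⊆ ℙ¹⁵`, the
orthogonal Grassmannian in its spinor embedding: `ψ` lies in the cone iff it is annihilated by a
five-dimensional subspace `U` of `ℂ¹⁰` that is isotropic, that is, iff `ψ` is zero or a pure
spinor (and then `U` is the corresponding four-dimensional linear space in the smooth quadric
in `ℙ⁹`). -/
def spinorCone : Set HalfSpin :=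
  {ψ | ∃ U : Submodule ℂ ((Fin 5 → ℂ) × (Fin 5 → ℂ)),
    Module.finrank ℂ U = 5 ∧ (∀ u ∈ U, ∑ i, u.1 i * u.2 i = 0) ∧
    ∀ u ∈ U, ∀ T, cliffordAction u ψ T = 0}

/-- Pairs `i < j`: they index the ten Plücker coordinates on `⋀² ℂ⁵`. -/
abbrev PluckerIndex : Type := {ij : Fin 5 × Fin 5 // ij.1 < ij.2}

/-- The affine cone over `G(2,5) ⊆ ℙ⁹` in its Plücker embedding: all bivectors `a ∧ b`. -/
def grassmannCone : Set (PluckerIndex → ℂ) :=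
  {w | ∃ a b : Fin 5 → ℂ, ∀ ij, w ij = a ij.1.1 * b ij.1.2 - a ij.1.2 * b ij.1.1}

/-- The homogeneous ideal of the linear section `S₁₀ ∩ ℙ(Λ)`, as the scheme-theoretic
intersection: the sum of the ideals of `S₁₀` and of `ℙ(Λ)`. -/
def sectionIdeal (Λ : Submodule ℂ HalfSpin) : Ideal (MvPolynomial EvenSubset ℂ) :=
  vanishingIdeal ℂ spinorCone ⊔ vanishingIdeal ℂ (Λ : Set HalfSpin)

/-- The Taylor expansion of `f` at `p`, that is, the polynomial `f (p + X)`. -/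
def taylorAt {σ : Type*} (p : σ → ℂ) (f : MvPolynomial σ ℂ) : MvPolynomial σ ℂ :=
  aeval (fun i => C (p i) + X i) f

/-- The ideal of the tangent cone at `p` of the affine scheme defined by `I`: it is generated by
the lowest-degree forms at `p` of the elements of `I`. -/
def tangentConeIdeal {σ : Type*} (I : Ideal (MvPolynomial σ ℂ)) (p : σ → ℂ) :
    Ideal (MvPolynomial σ ℂ) :=
  Ideal.span {g | ∃ f ∈ I, ∃ d : ℕ,
    (∀ e < d, homogeneousComponent e (taylorAt p f) = 0) ∧
    g = homogeneousComponent d (taylorAt p f)}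

/-- The projective scheme with homogeneous ideal `I` has an `n`-dimensional node (ordinary double
point) at the point `[p]`: its tangent cone there is a quadric cone of full rank `n + 1` in a
tangent space of dimension `n + 1`.

This is expressed on the affine cone over the scheme, which near `p` is the product of the scheme
with the line `ℂ p`: the tangent space `T` of the affine cone has dimension `n + 2`, and the
tangent cone is defined in `T` by a quadratic form `g` whose radical is the line `ℂ p`. -/
def IsNode {σ : Type*} [Finite σ] (n : ℕ) (I : Ideal (MvPolynomial σ ℂ)) (p : σ → ℂ) : Prop :=
  p ≠ 0 ∧ ∃ (T : Submodule ℂ (σ → ℂ)) (g : MvPolynomial σ ℂ),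
    p ∈ T ∧ Module.finrank ℂ T = n + 2 ∧ g.IsHomogeneous 2 ∧
    tangentConeIdeal I p = vanishingIdeal ℂ (T : Set (σ → ℂ)) ⊔ Ideal.span {g} ∧
    ∀ x ∈ T, (∀ y ∈ T, eval (x + y) g = eval x g + eval y g) ↔ x ∈ Submodule.span ℂ {p}

/-- Substitution of a linear map in polynomials: `f ↦ f ∘ φ`. -/
def linearPullback {σ τ : Type*} [Fintype σ] [DecidableEq σ] (φ : (σ → ℂ) →ₗ[ℂ] (τ → ℂ)) :
    MvPolynomial τ ℂ →ₐ[ℂ] MvPolynomial σ ℂ :=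
  aeval (fun j => ∑ i, C (φ (Pi.single i 1) j) * X i)

/-- The affine cone over the projection of `S₁₀ ∩ ℙ(Λ)` from the point `[p]`, where `π` is the
linear map inducing the projection: the Zariski closure of the image of the section without the
centre `[p]`. -/
def projectedCone (Λ : Submodule ℂ HalfSpin) (p : HalfSpin)
    (π : HalfSpin →ₗ[ℂ] (Fin 10 → ℂ)) : Set (Fin 10 → ℂ) :=
  zeroLocus ℂ (vanishingIdeal ℂ
    (π '' ((spinorCone ∩ (Λ : Set HalfSpin)) \ (Submodule.span ℂ {p} : Set HalfSpin))))

/-- The homogeneous ideal of the scheme-theoretic image of `S₁₀ ∩ ℙ(Λ)` under the projection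
induced by `π`: the polynomials `f` on `ℂ¹⁰` such that `f ∘ π` vanishes on the section. -/
def projectedIdeal (Λ : Submodule ℂ HalfSpin) (π : HalfSpin →ₗ[ℂ] (Fin 10 → ℂ)) :
    Ideal (MvPolynomial (Fin 10) ℂ) :=
  (sectionIdeal Λ).comap (linearPullback π)

end

/-! Split a half-spinor as (x₀, x, Y) by degree 0, 2, 4. Up to signs, the cone over S₁₀ is cut out
by ten quadrics: the five equations x₀Y = Pf(x), with Pf the 4 × 4 Pfaffians, and the five equations
xY = 0 (`isPureSpinor_iff`). Every datum of the statement is natural under linear automorphisms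
preserving this cone, and such automorphisms move any pure spinor to e_∅. So p = e_∅, where the
affine tangent space of the cone is Y = 0.

At the node the tangent space Λ ∩ {Y = 0} has dimension 7, so Y has rank 4 on the 11-dimensional Λ,
and after a further automorphism fixing p one has Y₀ = 0 on Λ. The equation x₀Y₀ = Pf(x) then loses
its linear term and gives the tangent cone: the Pfaffian of the six xᵢⱼ with i, j ≥ 1. Its radical
in the tangent space is the line of p, so no nonzero vector of Λ has x₀, these six xᵢⱼ and Y all
zero (`IsNodalSection.eq_zero_of_coords`). Hence x₀ and the ten coordinates w = (Y₁, …, Y₄, xᵢⱼ) are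
coordinates on Λ, and the remaining v = (x₀₁, …, x₀₄) is a linear function L(w)
(`IsNodalSection.exists_graph`). Projection from p forgets x₀.

In these terms five of the ten quadrics are the Plücker relations of w, and the other five say that
the skew matrix w kills the vector (-x₀, v). Row 0 does not contain x₀: it is the quadric q = ∑ w₀ₖ
Lₖ(w). Since w has rank two, where w₀₁ or w₀₂ is invertible one further row determines x₀ and the
rest follow. This holds for points with values in any ℂ-algebra, so the ideal of the projection
agrees with P + (q), P the Plücker ideal, after inverting w₀₁ or w₀₂.

To undo the localisations: w₀₁, w₀₂ is a regular sequence modulo the prime P, so if q ∉ P then P +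
(q) has no component, embedded or not, inside w₀₁ = w₀₂ = 0 (`mem_pluckerIdeal_sup_of_pow_mul_mem`).
Both this and the equality of P with the ideal of G(2,5) come from standard monomials. Finally q ∉ P
by dimension: otherwise the whole 7-dimensional cone over G(2,5) would lift to the 6-dimensional
cone over the section (`nodeQuadric_not_mem_pluckerIdeal`). -/

/-! ### Standard monomials and the homogeneous ideal of G(2,5) -/

/-- The Plücker index of a pair `i < j`. -/
abbrev plk (i j : Fin 5) (h : i < j := by decide) : PluckerIndex := ⟨(i, j), h⟩

/-- The Plücker relation of four indices `i < j < k < l`. -/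
noncomputable def pluckerRel (i j k l : Fin 5) (hij : i < j := by decide) (hjk : j < k := by decide)
    (hkl : k < l := by decide) : MvPolynomial PluckerIndex ℂ :=
  X (plk i j hij) * X (plk k l hkl) - X (plk i k (hij.trans hjk)) * X (plk j l (hjk.trans hkl)) +
    X (plk i l ((hij.trans hjk).trans hkl)) * X (plk j k hjk)

/-- The ideal generated by the Plücker relations. -/
noncomputable def pluckerIdeal : Ideal (MvPolynomial PluckerIndex ℂ) :=
  Ideal.span {f | ∃ i j k l hij hjk hkl, f = pluckerRel i j k l hij hjk hkl}

lemma pluckerRel_mem (i j k l : Fin 5) (hij : i < j) (hjk : j < k) (hkl : k < l) :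
    pluckerRel i j k l hij hjk hkl ∈ pluckerIdeal :=
  Ideal.subset_span ⟨i, j, k, l, hij, hjk, hkl, rfl⟩

/-- A monomial in the Plücker coordinates is standard if its factors form a chain. -/
def IsStandard (m : PluckerIndex →₀ ℕ) : Prop :=
  ∀ (i j k l : Fin 5) (hij : i < j) (hjk : j < k) (hkl : k < l),
    m (plk i l ((hij.trans hjk).trans hkl)) = 0 ∨ m (plk j k hjk) = 0

/-- The convex weight `(j - i) ^ 2` of the Plücker coordinates, extended to monomials. -/
noncomputable def pluckerWeight : (PluckerIndex →₀ ℕ) →+ ℕ :=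
  Finsupp.liftAddHom fun ij => AddMonoidHom.mulRight ((ij.1.2.val - ij.1.1.val) ^ 2)

lemma pluckerWeight_single (a : PluckerIndex) :
    pluckerWeight (Finsupp.single a 1) = (a.1.2.val - a.1.1.val) ^ 2 := by
  simp [pluckerWeight]

/-- By convexity of the square, the nested product of a Plücker relation outweighs the crossing and
the disjoint ones. Rewriting nested pairs therefore terminates. -/
lemma convex_weight : ∀ i j k l : Fin 5, i < j → j < k → k < l →
    (k.val - i.val) ^ 2 + (l.val - j.val) ^ 2 < (l.val - i.val) ^ 2 + (k.val - j.val) ^ 2 ∧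
    (j.val - i.val) ^ 2 + (l.val - k.val) ^ 2 < (l.val - i.val) ^ 2 + (k.val - j.val) ^ 2 := by
  decide

/-- Straightening by induction on the weight: a nested pair il, jk is replaced through its Plücker
relation by two monomials of smaller weight. -/
lemma exists_standard_monomial (n : ℕ) : ∀ m : PluckerIndex →₀ ℕ, pluckerWeight m < n →
    ∃ g : MvPolynomial PluckerIndex ℂ, (∀ d ∈ g.support, IsStandard d) ∧
      monomial m 1 - g ∈ pluckerIdeal := by
  classical
  induction n with
  | zero => intro m h; omega
  | succ n ih =>
    intro m hm
    by_cases hs : IsStandard m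
    · refine ⟨monomial m 1, fun d hd => ?_, by simp⟩
      have := support_monomial_subset hd
      simp only [Finset.mem_singleton] at this
      rwa [this]
    · unfold IsStandard at hs
      push Not at hs
      obtain ⟨i, j, k, l, hij, hjk, hkl, h1, h2⟩ := hs
      set a := plk i l ((hij.trans hjk).trans hkl)
      set b := plk j k hjk
      have hab : a ≠ b := by
        intro h
        have := congrArg (fun t : PluckerIndex => t.1.1) h
        simp only [a, b] at this
        omega
      obtain ⟨m', rfl⟩ : ∃ m', m = m' + Finsupp.single a 1 + Finsupp.single b 1 := by
        refine ⟨m - Finsupp.single a 1 - Finsupp.single b 1, ?_⟩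
        ext t
        simp only [Finsupp.add_apply, Finsupp.tsub_apply, Finsupp.single_apply]
        by_cases hat : a = t
        · subst hat
          rw [if_pos rfl, if_neg hab.symm]
          omega
        · by_cases hbt : b = t
          · subst hbt
            rw [if_pos rfl, if_neg hab]
            omega
          · rw [if_neg hat, if_neg hbt]
            omega
      obtain ⟨g₁, hg₁, hm₁⟩ := ih (m' + Finsupp.single (plk i k (hij.trans hjk)) 1 +
        Finsupp.single (plk j l (hjk.trans hkl)) 1) (by
          simp only [map_add, pluckerWeight_single, a, b] at hm ⊢
          have : (k.val - i.val) ^ 2 + (l.val - j.val) ^ 2 <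
            (l.val - i.val) ^ 2 + (k.val - j.val) ^ 2 := by
            exact (convex_weight i j k l hij hjk hkl).1
          omega)
      obtain ⟨g₂, hg₂, hm₂⟩ := ih (m' + Finsupp.single (plk i j hij) 1 +
        Finsupp.single (plk k l hkl) 1) (by
          simp only [map_add, pluckerWeight_single, a, b] at hm ⊢
          have : (j.val - i.val) ^ 2 + (l.val - k.val) ^ 2 <
            (l.val - i.val) ^ 2 + (k.val - j.val) ^ 2 := by
            exact (convex_weight i j k l hij hjk hkl).2
          omega)
      refine ⟨g₁ - g₂, fun d hd => ?_, ?_⟩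
      · rcases Finset.mem_union.1 (support_sub _ _ _ hd) with h | h
        exacts [hg₁ d h, hg₂ d h]
      · have key := pluckerIdeal.mul_mem_left (monomial m' 1) (pluckerRel_mem i j k l hij hjk hkl)
        have e : ∀ s t : PluckerIndex, (monomial (m' + Finsupp.single s 1 + Finsupp.single t 1) 1 :
            MvPolynomial PluckerIndex ℂ) = monomial m' 1 * (X s * X t) := by
          intro s t
          simp [X, monomial_mul, add_assoc]
        rw [e] at hm₁ hm₂ ⊢
        have := pluckerIdeal.add_mem (pluckerIdeal.sub_mem key hm₂) hm₁
        convert this using 1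
        simp only [pluckerRel, a, b]
        ring

lemma exists_standard (f : MvPolynomial PluckerIndex ℂ) :
    ∃ g : MvPolynomial PluckerIndex ℂ, (∀ d ∈ g.support, IsStandard d) ∧
      f - g ∈ pluckerIdeal := by
  classical
  induction f using MvPolynomial.induction_on' with
  | monomial u a =>
    obtain ⟨g, hg, h⟩ := exists_standard_monomial _ u (Nat.lt_succ_self _)
    refine ⟨C a * g, fun d hd => hg d ?_, ?_⟩
    · rw [mem_support_iff, coeff_C_mul] at hd
      exact mem_support_iff.2 (right_ne_zero_of_mul hd)
    · have := pluckerIdeal.mul_mem_left (C a) h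
      rwa [mul_sub, C_mul_monomial, mul_one] at this
  | add p q hp hq =>
    obtain ⟨g₁, h₁, h₁'⟩ := hp
    obtain ⟨g₂, h₂, h₂'⟩ := hq
    refine ⟨g₁ + g₂, fun d hd => ?_, ?_⟩
    · rcases Finset.mem_union.1 (support_add hd) with h | h
      exacts [h₁ d h, h₂ d h]
    · convert pluckerIdeal.add_mem h₁' h₂' using 1
      ring

/-- The parametrisation of the Grassmannian cone by the `2 × 2` minors of a generic matrix. -/
noncomputable def pluckerMinors : MvPolynomial PluckerIndex ℂ →ₐ[ℂ] MvPolynomial (Fin (5 + 5)) ℂ :=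
  aeval fun ij => X (Fin.castAdd 5 ij.1.1) * X (Fin.natAdd 5 ij.1.2) -
    X (Fin.castAdd 5 ij.1.2) * X (Fin.natAdd 5 ij.1.1)

/-- Variables of the first row precede those of the second, and the first ones are the largest, so
the leading term of a minor is its diagonal term. -/
lemma pluckerMinors_degree_X (a : PluckerIndex) :
    MonomialOrder.lex.degree (pluckerMinors (X a)) =
      Finsupp.single (Fin.castAdd 5 a.1.1) 1 + Finsupp.single (Fin.natAdd 5 a.1.2) 1 := by
  have hX : ∀ s t : Fin (5 + 5), MonomialOrder.lex.degree (X s * X t : MvPolynomial (Fin (5 + 5)) ℂ)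
      = Finsupp.single s 1 + Finsupp.single t 1 := by
    intro s t
    rw [MonomialOrder.degree_mul (X_ne_zero _) (X_ne_zero _), MonomialOrder.degree_X,
      MonomialOrder.degree_X]
  rw [pluckerMinors, aeval_X, MonomialOrder.degree_sub_of_lt, hX]
  rw [hX, hX, MonomialOrder.lex_lt_iff]
  refine ⟨Fin.castAdd 5 a.1.1, ?_, ?_⟩
  · intro j hj
    have h1 : Fin.castAdd 5 a.1.1 ≠ j := hj.ne'
    have ha := a.2
    have h2 : Fin.castAdd 5 a.1.2 ≠ j := by
      intro h; subst h; simp only [Fin.lt_def, Fin.val_castAdd] at hj ha; omega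
    have h3 : Fin.natAdd 5 a.1.2 ≠ j := by
      intro h; subst h; simp only [Fin.lt_def, Fin.val_castAdd, Fin.val_natAdd] at hj; omega
    have h4 : Fin.natAdd 5 a.1.1 ≠ j := by
      intro h; subst h; simp only [Fin.lt_def, Fin.val_castAdd, Fin.val_natAdd] at hj; omega
    simp only [ofLex_toLex, Finsupp.add_apply, Finsupp.single_apply, if_neg h1, if_neg h2, if_neg h3, if_neg h4]
  · have ha := a.2
    have h2 : Fin.castAdd 5 a.1.2 ≠ Fin.castAdd 5 a.1.1 := by
      intro h; simp only [Fin.ext_iff, Fin.lt_def, Fin.val_castAdd] at h ha; omega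
    have h4 : Fin.natAdd 5 a.1.1 ≠ Fin.castAdd 5 a.1.1 := by
      intro h; simp only [Fin.ext_iff, Fin.val_natAdd, Fin.val_castAdd] at h; omega
    simp only [ofLex_toLex, Finsupp.add_apply, Finsupp.single_apply, if_neg h2, if_neg h4, if_pos]
    omega

lemma pluckerMinors_X_ne_zero (a : PluckerIndex) : pluckerMinors (X a) ≠ 0 := by
  intro h
  have := pluckerMinors_degree_X a
  rw [h, MonomialOrder.degree_zero] at this
  have := DFunLike.congr_fun this (Fin.castAdd 5 a.1.1)
  simp only [Finsupp.add_apply, Finsupp.single_apply, if_pos, Finsupp.coe_zero,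
    Pi.zero_apply] at this
  omega

/-- The leading exponent of the image of a monomial in the minors. -/
noncomputable def minorsExponent (m : PluckerIndex →₀ ℕ) : Fin (5 + 5) →₀ ℕ :=
  ∑ a, m a • (Finsupp.single (Fin.castAdd 5 a.1.1) 1 + Finsupp.single (Fin.natAdd 5 a.1.2) 1)

lemma pluckerMinors_monomial (m : PluckerIndex →₀ ℕ) :
    pluckerMinors (monomial m 1) = ∏ a, pluckerMinors (X a) ^ m a := by
  rw [monomial_eq, C_1, one_mul, Finsupp.prod_fintype _ _ (by simp), map_prod]
  simp only [map_pow]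

lemma pluckerMinors_monomial_ne_zero (m : PluckerIndex →₀ ℕ) :
    pluckerMinors (monomial m 1) ≠ 0 := by
  rw [pluckerMinors_monomial]
  exact Finset.prod_ne_zero_iff.2 fun a _ => pow_ne_zero _ (pluckerMinors_X_ne_zero a)

lemma pluckerMinors_degree_monomial (m : PluckerIndex →₀ ℕ) :
    MonomialOrder.lex.degree (pluckerMinors (monomial m 1)) = minorsExponent m := by
  rw [pluckerMinors_monomial, MonomialOrder.degree_prod
    (fun a _ => pow_ne_zero _ (pluckerMinors_X_ne_zero a))]
  simp only [MonomialOrder.degree_pow, pluckerMinors_degree_X, minorsExponent]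

lemma pluckerIndex_sum {M : Type*} [AddCommMonoid M] (f : PluckerIndex → M) :
    ∑ a, f a = f (plk 0 1) + f (plk 0 2) + f (plk 0 3) + f (plk 0 4) + f (plk 1 2) + f (plk 1 3) +
      f (plk 1 4) + f (plk 2 3) + f (plk 2 4) + f (plk 3 4) := by
  have : (Finset.univ : Finset PluckerIndex) = {plk 0 1, plk 0 2, plk 0 3, plk 0 4, plk 1 2,
      plk 1 3, plk 1 4, plk 2 3, plk 2 4, plk 3 4} := by decide
  rw [this]
  iterate 9 rw [Finset.sum_insert (by decide)]
  rw [Finset.sum_singleton]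
  simp only [add_assoc]

lemma pluckerIndex_forall {P : PluckerIndex → Prop} (h01 : P (plk 0 1)) (h02 : P (plk 0 2))
    (h03 : P (plk 0 3)) (h04 : P (plk 0 4)) (h12 : P (plk 1 2)) (h13 : P (plk 1 3))
    (h14 : P (plk 1 4)) (h23 : P (plk 2 3)) (h24 : P (plk 2 4)) (h34 : P (plk 3 4)) :
    ∀ a, P a := by
  rintro ⟨⟨i, j⟩, h⟩
  fin_cases i <;> fin_cases j <;> first | assumption | exact absurd h (by decide)

/-- The exponent records the multiset of first indices and that of second indices. Without nested
pairs, the pairing must match both multisets in increasing order, so it can be recovered. -/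
lemma minorsExponent_injOn {m m' : PluckerIndex →₀ ℕ} (hm : IsStandard m) (hm' : IsStandard m')
    (h : minorsExponent m = minorsExponent m') : m = m' := by
  have key : ∀ t, minorsExponent m t = minorsExponent m' t := fun t => by rw [h]
  simp only [minorsExponent, pluckerIndex_sum, Finsupp.add_apply, Finsupp.smul_apply,
    Finsupp.single_apply, smul_eq_mul, Fin.ext_iff, Fin.val_castAdd, Fin.val_natAdd] at key
  have r0 := key 0
  have r1 := key 1
  have r2 := key 2
  have r3 := key 3
  have c1 := key 6
  have c2 := key 7
  have c3 := key 8
  have c4 := key 9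
  simp at r0 r1 r2 r3 c1 c2 c3 c4
  have s1 := hm 0 1 2 3 (by decide) (by decide) (by decide)
  have s2 := hm 0 1 2 4 (by decide) (by decide) (by decide)
  have s3 := hm 0 1 3 4 (by decide) (by decide) (by decide)
  have s4 := hm 0 2 3 4 (by decide) (by decide) (by decide)
  have s5 := hm 1 2 3 4 (by decide) (by decide) (by decide)
  have s1' := hm' 0 1 2 3 (by decide) (by decide) (by decide)
  have s2' := hm' 0 1 2 4 (by decide) (by decide) (by decide)
  have s3' := hm' 0 1 3 4 (by decide) (by decide) (by decide)
  have s4' := hm' 0 2 3 4 (by decide) (by decide) (by decide)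
  have s5' := hm' 1 2 3 4 (by decide) (by decide) (by decide)
  ext a
  revert a
  have e02 : m (plk 0 2) = m' (plk 0 2) := by
    clear s3 s3' s4 s4' s5 s5'
    omega
  have e12 : m (plk 1 2) = m' (plk 1 2) := by omega
  have e04 : m (plk 0 4) = m' (plk 0 4) := by
    clear s1 s1' s2 s2'
    omega
  have e14 : m (plk 1 4) = m' (plk 1 4) := by
    clear s1 s1' s2 s2'
    omega
  apply pluckerIndex_forall <;> clear s1 s1' s2 s2' s3 s3' s4 s4' s5 s5' <;> omega

/-- Distinct standard monomials have images with distinct leading exponents, so the largest of these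
exponents cannot cancel. -/
lemma standard_eq_zero {g : MvPolynomial PluckerIndex ℂ} (hg : ∀ d ∈ g.support, IsStandard d)
    (h : pluckerMinors g = 0) : g = 0 := by
  classical
  by_contra h0
  have hne : g.support.Nonempty := Finset.nonempty_iff_ne_empty.2 fun h => h0 (support_eq_empty.1 h)
  obtain ⟨d, hd, hmax⟩ := g.support.exists_max_image
    (fun d => MonomialOrder.lex.toSyn (minorsExponent d)) hne
  have hco : coeff (minorsExponent d) (pluckerMinors g) =
      coeff d g * coeff (minorsExponent d) (pluckerMinors (monomial d 1)) := by
    conv_lhs => rw [g.as_sum, map_sum, coeff_sum]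
    rw [Finset.sum_eq_single d]
    · rw [← mul_one (coeff d g), ← C_mul_monomial, map_mul]
      simp [pluckerMinors, algebraMap_eq]
    · intro e he hed
      rw [← mul_one (coeff e g), ← C_mul_monomial, map_mul]
      have : coeff (minorsExponent d) (pluckerMinors (monomial e 1)) = 0 := by
        apply MonomialOrder.lex.coeff_eq_zero_of_lt
        rw [pluckerMinors_degree_monomial]
        exact lt_of_le_of_ne (hmax e he) fun h => hed
          (minorsExponent_injOn (hg e he) (hg d hd) (MonomialOrder.lex.toSyn.injective h))
      simp [pluckerMinors, algebraMap_eq] at this ⊢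
      simp [this]
    · intro h; exact absurd hd h
  rw [h, coeff_zero, eq_comm, mul_eq_zero] at hco
  rcases hco with hco | hco
  · exact mem_support_iff.1 hd hco
  · rw [← pluckerMinors_degree_monomial] at hco
    exact pluckerMinors_monomial_ne_zero d (MonomialOrder.lex.coeff_degree_eq_zero_iff.1 hco)

lemma pluckerRel_mem_vanishingIdeal (i j k l : Fin 5) (hij : i < j) (hjk : j < k) (hkl : k < l) :
    pluckerRel i j k l hij hjk hkl ∈ vanishingIdeal ℂ grassmannCone := by
  rintro w ⟨a, b, h⟩
  simp only [pluckerRel, map_add, map_sub, map_mul, aeval_X, h]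
  ring

lemma pluckerMinors_eq_zero_of_mem {f : MvPolynomial PluckerIndex ℂ}
    (hf : f ∈ vanishingIdeal ℂ grassmannCone) : pluckerMinors f = 0 := by
  apply MvPolynomial.funext
  intro c
  have := hf (fun ij => aeval c (pluckerMinors (X ij)))
    ⟨fun i => c (Fin.castAdd 5 i), fun i => c (Fin.natAdd 5 i), fun ij => by
      simp only [pluckerMinors, aeval_X, map_sub, map_mul]⟩
  rw [map_zero, ← coe_aeval_eq_eval, RingHom.coe_coe, ← this, ← AlgHom.comp_apply]
  congr 1
  ext ij
  simp

lemma pluckerIdeal_le_vanishingIdeal : pluckerIdeal ≤ vanishingIdeal ℂ grassmannCone := by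
  rw [pluckerIdeal, Ideal.span_le]
  rintro f ⟨i, j, k, l, hij, hjk, hkl, rfl⟩
  exact pluckerRel_mem_vanishingIdeal i j k l hij hjk hkl

lemma mem_pluckerIdeal_of_pluckerMinors {f : MvPolynomial PluckerIndex ℂ}
    (hf : pluckerMinors f = 0) : f ∈ pluckerIdeal := by
  obtain ⟨g, hg, h⟩ := exists_standard f
  have := pluckerMinors_eq_zero_of_mem (pluckerIdeal_le_vanishingIdeal h)
  rw [map_sub, hf, zero_sub, neg_eq_zero] at this
  rwa [standard_eq_zero hg this, sub_zero] at h

/-- The homogeneous ideal of `G(2,5)` is generated by the Plücker relations. -/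
theorem vanishingIdeal_grassmannCone : vanishingIdeal ℂ grassmannCone = pluckerIdeal :=
  le_antisymm (fun _ hf => mem_pluckerIdeal_of_pluckerMinors (pluckerMinors_eq_zero_of_mem hf))
    pluckerIdeal_le_vanishingIdeal

lemma mem_pluckerIdeal_iff {f : MvPolynomial PluckerIndex ℂ} :
    f ∈ pluckerIdeal ↔ pluckerMinors f = 0 :=
  ⟨fun h => pluckerMinors_eq_zero_of_mem (pluckerIdeal_le_vanishingIdeal h),
    mem_pluckerIdeal_of_pluckerMinors⟩

instance pluckerIdeal_isPrime : pluckerIdeal.IsPrime := by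
  have : pluckerIdeal = RingHom.ker pluckerMinors := by
    ext f; rw [mem_pluckerIdeal_iff, RingHom.mem_ker]
  rw [this]
  exact RingHom.ker_isPrime _

/-! ### The regular sequence w₀₁, w₀₂ modulo the Plücker ideal -/

/-- The pairs 01 and 02 are never part of a nesting: an inner pair starts at 1 or later and an outer
pair ends at 3 or later. -/
lemma isStandard_add_single {m : PluckerIndex →₀ ℕ} (hm : IsStandard m) {s : Fin 5} (hs : 0 < s)
    (hs' : s < 3) : IsStandard (m + Finsupp.single (plk 0 s hs) 1) := by
  intro i j k l hij hjk hkl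
  have h1 : plk 0 s hs ≠ plk i l ((hij.trans hjk).trans hkl) := by
    intro h
    have := congrArg (fun t : PluckerIndex => t.1.2) h
    simp only at this
    omega
  have h2 : plk 0 s hs ≠ plk j k hjk := by
    intro h
    have := congrArg (fun t : PluckerIndex => t.1.1) h
    simp only at this
    omega
  simpa only [Finsupp.add_apply, Finsupp.single_apply, if_neg h1, if_neg h2, add_zero] using
    hm i j k l hij hjk hkl

lemma isStandard_X_mul {g : MvPolynomial PluckerIndex ℂ} (hg : ∀ d ∈ g.support, IsStandard d)
    {s : Fin 5} (hs : 0 < s) (hs' : s < 3) : ∀ d ∈ (X (plk 0 s hs) * g).support, IsStandard d := by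
  intro d hd
  rw [support_X_mul] at hd
  obtain ⟨e, he, rfl⟩ := Finset.mem_map.1 hd
  simpa [add_comm] using isStandard_add_single (hg e he) hs hs'

/-- The coordinates `w₀₁, w₀₂` form a regular sequence modulo the Plücker relations. -/
lemma exists_sub_mem_of_X_mul_sub_mem {g g' : MvPolynomial PluckerIndex ℂ}
    (h : X (plk 0 1) * g - X (plk 0 2) * g' ∈ pluckerIdeal) :
    ∃ k, g' - X (plk 0 1) * k ∈ pluckerIdeal := by
  classical
  obtain ⟨u, hu, hu'⟩ := exists_standard g
  obtain ⟨v, hv, hv'⟩ := exists_standard g'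
  -- With standard representatives both products stay standard, so the congruence is an identity of
  -- polynomials, where `X (plk 0 1)` is prime and does not divide `X (plk 0 2)`.
  have h0 : X (plk 0 1) * u - X (plk 0 2) * v = 0 := by
    apply standard_eq_zero
    · intro d hd
      rcases Finset.mem_union.1 (support_sub _ _ _ hd) with h | h
      exacts [isStandard_X_mul hu (by decide) (by decide) d h,
        isStandard_X_mul hv (by decide) (by decide) d h]
    · rw [← mem_pluckerIdeal_iff]
      convert pluckerIdeal.add_mem (pluckerIdeal.sub_mem h
        (pluckerIdeal.mul_mem_left (X (plk 0 1)) hu'))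
        (pluckerIdeal.mul_mem_left (X (plk 0 2)) hv') using 1
      ring
  have hd : (X (plk 0 1) : MvPolynomial PluckerIndex ℂ) ∣ X (plk 0 2) * v :=
    ⟨u, (sub_eq_zero.1 h0).symm⟩
  rcases (X_prime (R := ℂ) (i := plk 0 1)).2.2 _ _ hd with hd | ⟨k, hk⟩
  · rw [X_dvd_X] at hd
    exact absurd hd (by simp)
  · exact ⟨k, by rwa [← hk]⟩

lemma pow_dvd_of_pow_dvd_pow_mul {R : Type*} [CommRing R] [IsDomain R] {a b : R} (ha : a ≠ 0)
    (hab : ∀ x, a ∣ b * x → a ∣ x) (n m : ℕ) (x : R) (h : a ^ n ∣ b ^ m * x) : a ^ n ∣ x := by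
  have hb : ∀ m x, a ∣ b ^ m * x → a ∣ x := by
    intro m
    induction m with
    | zero => intro x h; simpa using h
    | succ m ih =>
      intro x h
      rw [pow_succ', mul_assoc] at h
      exact ih x (hab _ h)
  induction n generalizing x with
  | zero => simp
  | succ n ih =>
    obtain ⟨y, rfl⟩ := hb m x ((dvd_pow_self a (Nat.succ_ne_zero n)).trans h)
    rw [pow_succ', mul_left_comm] at h
    rw [pow_succ']
    exact mul_dvd_mul_left a (ih y ((mul_dvd_mul_iff_left ha).1 h))

/-- If aⁿf = qg and bᵐf = qk, cancelling q gives bᵐg = aⁿk; regularity of b modulo a makes aⁿ divide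
g, and cancelling aⁿ leaves q ∣ f. -/
lemma dvd_of_dvd_pow_mul {R : Type*} [CommRing R] [IsDomain R] {a b : R} (ha : a ≠ 0)
    (hab : ∀ x, a ∣ b * x → a ∣ x) {q f : R} (hq : q ≠ 0) {n m : ℕ} (h1 : q ∣ a ^ n * f)
    (h2 : q ∣ b ^ m * f) : q ∣ f := by
  obtain ⟨g, hg⟩ := h1
  obtain ⟨k, hk⟩ := h2
  have e : b ^ m * g = a ^ n * k := by
    apply mul_left_cancel₀ hq
    linear_combination a ^ n * hk - b ^ m * hg
  obtain ⟨r, rfl⟩ := pow_dvd_of_pow_dvd_pow_mul ha hab n m g ⟨k, e⟩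
  exact ⟨r, mul_left_cancel₀ (pow_ne_zero n ha) (by linear_combination hg)⟩

lemma X_not_mem_pluckerIdeal (a : PluckerIndex) : X a ∉ pluckerIdeal := fun h =>
  pluckerMinors_X_ne_zero a (mem_pluckerIdeal_iff.1 h)

lemma mem_pluckerIdeal_sup_iff {q f : MvPolynomial PluckerIndex ℂ} :
    f ∈ pluckerIdeal ⊔ Ideal.span {q} ↔
      Ideal.Quotient.mk pluckerIdeal q ∣ Ideal.Quotient.mk pluckerIdeal f := by
  constructor
  · intro h
    obtain ⟨u, hu, v, hv, rfl⟩ := Submodule.mem_sup.1 h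
    obtain ⟨r, rfl⟩ := Ideal.mem_span_singleton.1 hv
    rw [map_add, Ideal.Quotient.eq_zero_iff_mem.2 hu, zero_add, map_mul]
    exact dvd_mul_right _ _
  · rintro ⟨r, hr⟩
    obtain ⟨r, rfl⟩ := Ideal.Quotient.mk_surjective r
    rw [← map_mul, Ideal.Quotient.eq] at hr
    rw [← sub_add_cancel f (q * r)]
    exact Ideal.add_mem _ (Ideal.mem_sup_left hr)
      (Ideal.mem_sup_right (Ideal.mem_span_singleton.2 (dvd_mul_right _ _)))

/-- A quadric section of `G(2,5)` has no component in the locus `w₀₁ = w₀₂ = 0`. -/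
theorem mem_pluckerIdeal_sup_of_pow_mul_mem {q f : MvPolynomial PluckerIndex ℂ}
    (hq : q ∉ pluckerIdeal) {n m : ℕ}
    (h1 : X (plk 0 1) ^ n * f ∈ pluckerIdeal ⊔ Ideal.span {q})
    (h2 : X (plk 0 2) ^ m * f ∈ pluckerIdeal ⊔ Ideal.span {q}) :
    f ∈ pluckerIdeal ⊔ Ideal.span {q} := by
  rw [mem_pluckerIdeal_sup_iff] at h1 h2 ⊢
  rw [map_mul, map_pow] at h1 h2
  refine dvd_of_dvd_pow_mul (fun h => X_not_mem_pluckerIdeal (plk 0 1)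
    (Ideal.Quotient.eq_zero_iff_mem.1 h)) (fun x => ?_)
    (fun h => hq (Ideal.Quotient.eq_zero_iff_mem.1 h)) h1 h2
  rintro ⟨y, hy⟩
  obtain ⟨x, rfl⟩ := Ideal.Quotient.mk_surjective x
  obtain ⟨y, rfl⟩ := Ideal.Quotient.mk_surjective y
  rw [← map_mul, ← map_mul, eq_comm, Ideal.Quotient.eq] at hy
  obtain ⟨k, hk⟩ := exists_sub_mem_of_X_mul_sub_mem hy
  exact ⟨Ideal.Quotient.mk _ k, by rwa [← map_mul, Ideal.Quotient.eq]⟩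

/-! ### Points of the cone over G(2,5) -/

/-- The skew-symmetric matrix with the given Plücker coordinates. -/
def skewOfPlucker (w : PluckerIndex → ℂ) (i j : Fin 5) : ℂ :=
  if h : i < j then w ⟨(i, j), h⟩ else if h : j < i then -w ⟨(j, i), h⟩ else 0

/-- With signs and repeated indices allowed, each instance is trivial or one of the five relations
up to sign. -/
lemma skewOfPlucker_rel {w : PluckerIndex → ℂ}
    (hw : ∀ i j k l hij hjk hkl, eval w (pluckerRel i j k l hij hjk hkl) = 0)
    (s t : PluckerIndex) :
    skewOfPlucker w s.1.1 s.1.2 * skewOfPlucker w t.1.1 t.1.2 -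
      skewOfPlucker w s.1.1 t.1.1 * skewOfPlucker w s.1.2 t.1.2 +
      skewOfPlucker w s.1.1 t.1.2 * skewOfPlucker w s.1.2 t.1.1 = 0 := by
  have h1 := hw 0 1 2 3 (by decide) (by decide) (by decide)
  have h2 := hw 0 1 2 4 (by decide) (by decide) (by decide)
  have h3 := hw 0 1 3 4 (by decide) (by decide) (by decide)
  have h4 := hw 0 2 3 4 (by decide) (by decide) (by decide)
  have h5 := hw 1 2 3 4 (by decide) (by decide) (by decide)
  simp only [pluckerRel, map_add, map_sub, map_mul, eval_X] at h1 h2 h3 h4 h5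
  revert s
  apply pluckerIndex_forall <;> revert t <;> apply pluckerIndex_forall <;>
    simp [skewOfPlucker] <;>
    first
    | ring1
    | linear_combination h1
    | linear_combination h2
    | linear_combination h3
    | linear_combination h4
    | linear_combination h5
    | linear_combination -h1
    | linear_combination -h2
    | linear_combination -h3
    | linear_combination -h4
    | linear_combination -h5

theorem mem_grassmannCone_iff {w : PluckerIndex → ℂ} :
    w ∈ grassmannCone ↔ ∀ i j k l hij hjk hkl, eval w (pluckerRel i j k l hij hjk hkl) = 0 := by
  constructor
  · intro h i j k l hij hjk hkl
    exact pluckerRel_mem_vanishingIdeal i j k l hij hjk hkl w h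
  · intro hw
    by_cases h0 : w = 0
    · exact ⟨0, 0, fun ij => by simp [h0]⟩
    · obtain ⟨⟨⟨i, j⟩, hij⟩, hne⟩ := Function.ne_iff.1 h0
      have e : ∀ ij : PluckerIndex, w ij = skewOfPlucker w ij.1.1 ij.1.2 := by
        rintro ⟨⟨k, l⟩, h⟩
        simp only [skewOfPlucker, dif_pos h]
      rw [e] at hne
      simp only [Pi.zero_apply] at hne
      -- A skew matrix of rank two is recovered from rows i and j once its entry at ij is nonzero;
      -- dividing one row by this entry normalises the bivector.
      refine ⟨skewOfPlucker w i, fun k => skewOfPlucker w j k / skewOfPlucker w i j, fun kl => ?_⟩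
      rw [e kl]
      have := skewOfPlucker_rel hw (plk i j hij) kl
      simp only at this
      field_simp
      linear_combination this

/-! ### Naturality of ideals, tangent cones and nodes under linear maps -/

section LinearChange

variable {σ τ : Type*} [Fintype σ] [DecidableEq σ]

lemma sum_apply_single_mul (φ : (σ → ℂ) →ₗ[ℂ] (τ → ℂ)) (x : σ → ℂ) (j : τ) :
    ∑ i, φ (Pi.single i 1) j * x i = φ x j := by
  rw [LinearMap.pi_apply_eq_sum_univ φ x, Finset.sum_apply]
  refine Finset.sum_congr rfl fun i _ => ?_
  have : (Pi.single i 1 : σ → ℂ) = fun k => if i = k then 1 else 0 := by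
    ext k
    simp [Pi.single_apply, eq_comm]
  rw [Pi.smul_apply, smul_eq_mul, mul_comm, this]

lemma eval_linearPullback (φ : (σ → ℂ) →ₗ[ℂ] (τ → ℂ)) (x : σ → ℂ) (f : MvPolynomial τ ℂ) :
    eval x (linearPullback φ f) = eval (φ x) f := by
  rw [linearPullback, aeval_def, eval_eval₂, eval, coe_eval₂Hom]
  congr 1
  · ext; simp
  · ext j
    simp [sum_apply_single_mul]

lemma linearPullback_linearPullback {υ : Type*} [Fintype τ] [DecidableEq τ]
    (φ : (σ → ℂ) →ₗ[ℂ] (τ → ℂ)) (ψ : (τ → ℂ) →ₗ[ℂ] (υ → ℂ)) (f : MvPolynomial υ ℂ) :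
    linearPullback φ (linearPullback ψ f) = linearPullback (ψ ∘ₗ φ) f :=
  MvPolynomial.funext fun x => by simp [eval_linearPullback]

lemma linearPullback_symm_apply (g : (σ → ℂ) ≃ₗ[ℂ] (σ → ℂ)) (f : MvPolynomial σ ℂ) :
    linearPullback g.symm.toLinearMap (linearPullback g.toLinearMap f) = f :=
  MvPolynomial.funext fun x => by simp [eval_linearPullback]

lemma linearPullback_apply_symm (g : (σ → ℂ) ≃ₗ[ℂ] (σ → ℂ)) (f : MvPolynomial σ ℂ) :
    linearPullback g.toLinearMap (linearPullback g.symm.toLinearMap f) = f :=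
  MvPolynomial.funext fun x => by simp [eval_linearPullback]

lemma isHomogeneous_linearPullback (φ : (σ → ℂ) →ₗ[ℂ] (τ → ℂ)) {f : MvPolynomial τ ℂ} {n : ℕ}
    (hf : f.IsHomogeneous n) : (linearPullback φ f).IsHomogeneous n := by
  have := hf.aeval (n := 1) (fun j => ∑ i, C (φ (Pi.single i 1) j) * X i) fun j =>
    IsHomogeneous.sum _ _ _ fun i _ => by
      simpa using (isHomogeneous_C σ (φ (Pi.single i 1) j)).mul (isHomogeneous_X ℂ i)
  rwa [one_mul] at this

lemma homogeneousComponent_linearPullback (φ : (σ → ℂ) →ₗ[ℂ] (τ → ℂ)) (f : MvPolynomial τ ℂ)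
    (n : ℕ) : homogeneousComponent n (linearPullback φ f) =
      linearPullback φ (homogeneousComponent n f) := by
  conv_lhs => rw [← sum_homogeneousComponent f, map_sum, map_sum]
  simp only [homogeneousComponent_of_mem (isHomogeneous_linearPullback φ
    (homogeneousComponent_isHomogeneous _ f))]
  rw [Finset.sum_ite_eq]
  split_ifs with h
  · rfl
  · rw [homogeneousComponent_eq_zero _ _ (by simpa using h), map_zero]

lemma eval_taylorAt {σ : Type*} (p x : σ → ℂ) (f : MvPolynomial σ ℂ) :
    eval x (taylorAt p f) = eval (p + x) f := by
  rw [taylorAt, aeval_def, eval_eval₂, eval, coe_eval₂Hom]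
  congr 1
  · ext; simp
  · ext j
    simp

lemma taylorAt_linearPullback [Fintype τ] [DecidableEq τ] (φ : (σ → ℂ) →ₗ[ℂ] (τ → ℂ)) (p : σ → ℂ)
    (f : MvPolynomial τ ℂ) :
    taylorAt p (linearPullback φ f) = linearPullback φ (taylorAt (φ p) f) :=
  MvPolynomial.funext fun x => by simp [eval_linearPullback, eval_taylorAt]

lemma comap_symm_comap (g : (σ → ℂ) ≃ₗ[ℂ] (σ → ℂ)) (I : Ideal (MvPolynomial σ ℂ)) :
    (I.comap (linearPullback g.toLinearMap)).comap (linearPullback g.symm.toLinearMap) = I := by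
  ext f
  rw [Ideal.mem_comap, Ideal.mem_comap, linearPullback_apply_symm]

lemma tangentConeIdeal_comap_le (g : (σ → ℂ) ≃ₗ[ℂ] (σ → ℂ)) (I : Ideal (MvPolynomial σ ℂ))
    (p : σ → ℂ) : tangentConeIdeal (I.comap (linearPullback g.toLinearMap)) (g p) ≤
      (tangentConeIdeal I p).comap (linearPullback g.toLinearMap) := by
  refine Ideal.span_le.2 ?_
  rintro _ ⟨f, hf, d, hd, rfl⟩
  refine Ideal.subset_span ⟨linearPullback g.toLinearMap f, hf, d, fun e he => ?_, ?_⟩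
  · rw [taylorAt_linearPullback, homogeneousComponent_linearPullback]
    erw [hd e he]
    rw [map_zero]
  · rw [taylorAt_linearPullback, homogeneousComponent_linearPullback]
    rfl

/-- The reverse inclusion is the previous one applied to the inverse of g. -/
lemma tangentConeIdeal_comap (g : (σ → ℂ) ≃ₗ[ℂ] (σ → ℂ)) (I : Ideal (MvPolynomial σ ℂ))
    (p : σ → ℂ) : tangentConeIdeal (I.comap (linearPullback g.toLinearMap)) (g p) =
      (tangentConeIdeal I p).comap (linearPullback g.toLinearMap) := by
  refine le_antisymm (tangentConeIdeal_comap_le g I p) fun f hf => ?_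
  have := tangentConeIdeal_comap_le g.symm (I.comap (linearPullback g.toLinearMap)) (g p)
  rw [comap_symm_comap, g.symm_apply_apply] at this
  have := this hf
  rwa [Ideal.mem_comap, linearPullback_symm_apply] at this

lemma vanishingIdeal_comap (φ : (σ → ℂ) →ₗ[ℂ] (τ → ℂ)) (V : Set (σ → ℂ)) :
    (vanishingIdeal ℂ V).comap (linearPullback φ) = vanishingIdeal ℂ (φ '' V) := by
  ext f
  simp only [Ideal.mem_comap, mem_vanishingIdeal_iff, Set.forall_mem_image, aeval_eq_eval,
    eval_linearPullback]

lemma comap_sup_linearPullback (g : (σ → ℂ) ≃ₗ[ℂ] (σ → ℂ)) (I J : Ideal (MvPolynomial σ ℂ)) :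
    (I ⊔ J).comap (linearPullback g.toLinearMap) =
      I.comap (linearPullback g.toLinearMap) ⊔ J.comap (linearPullback g.toLinearMap) := by
  refine le_antisymm (fun f hf => ?_) (sup_le (Ideal.comap_mono le_sup_left)
    (Ideal.comap_mono le_sup_right))
  obtain ⟨u, hu, v, hv, huv⟩ := Submodule.mem_sup.1 (Ideal.mem_comap.1 hf)
  rw [← linearPullback_symm_apply g f, ← huv, map_add]
  refine Ideal.add_mem _ (Ideal.mem_sup_left ?_) (Ideal.mem_sup_right ?_)
  · rwa [Ideal.mem_comap, linearPullback_apply_symm]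
  · rwa [Ideal.mem_comap, linearPullback_apply_symm]

lemma IsNode.comap {n : ℕ} {I : Ideal (MvPolynomial σ ℂ)} {p : σ → ℂ} (h : IsNode n I p)
    (g : (σ → ℂ) ≃ₗ[ℂ] (σ → ℂ)) : IsNode n (I.comap (linearPullback g.toLinearMap)) (g p) := by
  obtain ⟨hp, T, q, hpT, hT, hq, htc, hr⟩ := h
  refine ⟨by simpa using hp, T.map g.toLinearMap, linearPullback g.symm.toLinearMap q,
    Submodule.mem_map_of_mem hpT, ?_, isHomogeneous_linearPullback _ hq, ?_, ?_⟩
  · rw [← hT]; exact LinearEquiv.finrank_map_eq g T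
  · rw [tangentConeIdeal_comap, htc, comap_sup_linearPullback, vanishingIdeal_comap]
    congr 1
    ext f
    rw [Ideal.mem_comap, Ideal.mem_span_singleton, Ideal.mem_span_singleton]
    constructor
    · rintro ⟨r, hr⟩
      exact ⟨linearPullback g.symm.toLinearMap r, by
        rw [← map_mul, ← hr, linearPullback_symm_apply]⟩
    · rintro ⟨r, rfl⟩
      rw [map_mul, linearPullback_apply_symm]
      exact dvd_mul_right _ _
  · rintro _ ⟨x, hx, rfl⟩
    have := hr x hx
    simp only [Submodule.mem_map, forall_exists_index, and_imp, forall_apply_eq_imp_iff₂,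
      eval_linearPullback, LinearEquiv.coe_coe, map_add, LinearEquiv.symm_apply_apply]
    rw [this, Submodule.mem_span_singleton, Submodule.mem_span_singleton]
    simp only [← map_smul, g.injective.eq_iff]

lemma ringKrullDim_quotient_comap (g : (σ → ℂ) ≃ₗ[ℂ] (σ → ℂ)) (I : Ideal (MvPolynomial σ ℂ)) :
    ringKrullDim (MvPolynomial σ ℂ ⧸ I.comap (linearPullback g.toLinearMap)) =
      ringKrullDim (MvPolynomial σ ℂ ⧸ I) := by
  refine ringKrullDim_eq_of_ringEquiv (Ideal.quotientEquiv _ _ (AlgEquiv.ofAlgHom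
    (linearPullback g.toLinearMap) (linearPullback g.symm.toLinearMap)
    (AlgHom.ext fun f => linearPullback_apply_symm g f)
    (AlgHom.ext fun f => linearPullback_symm_apply g f)).toRingEquiv ?_)
  refine (Ideal.map_comap_of_surjective (AlgEquiv.ofAlgHom
    (linearPullback g.toLinearMap) (linearPullback g.symm.toLinearMap)
    (AlgHom.ext fun f => linearPullback_apply_symm g f)
    (AlgHom.ext fun f => linearPullback_symm_apply g f)).toRingEquiv (RingEquiv.surjective _) I).symm

end LinearChange

/-! ### Second-order Taylor expansions at a node -/

section Node

variable {σ : Type*}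

/-- The restriction of a polynomial to the affine line `p + t x`. -/
noncomputable def alongLine (p x : σ → ℂ) : MvPolynomial σ ℂ →ₐ[ℂ] Polynomial ℂ :=
  aeval fun i => Polynomial.C (p i) + Polynomial.C (x i) * Polynomial.X

/-- The restriction of a polynomial to the line spanned by `x`. -/
noncomputable def alongRay (x : σ → ℂ) : MvPolynomial σ ℂ →ₐ[ℂ] Polynomial ℂ :=
  aeval fun i => Polynomial.C (x i) * Polynomial.X

lemma alongRay_taylorAt (p x : σ → ℂ) (f : MvPolynomial σ ℂ) :
    alongRay x (taylorAt p f) = alongLine p x f := by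
  rw [taylorAt, ← AlgHom.comp_apply, alongLine]
  congr 1
  ext i
  simp [alongRay]

lemma alongRay_monomial (x : σ → ℂ) (d : σ →₀ ℕ) (a : ℂ) :
    alongRay x (monomial d a) =
      Polynomial.C (eval x (monomial d a)) * Polynomial.X ^ d.degree := by
  rw [alongRay, aeval_monomial, eval_monomial, Finsupp.degree_apply]
  simp only [Finsupp.prod, mul_pow, Finset.prod_mul_distrib, Finset.prod_pow_eq_pow_sum, map_mul,
    map_prod, map_pow, mul_assoc]
  rfl

lemma coeff_alongRay (x : σ → ℂ) (f : MvPolynomial σ ℂ) (n : ℕ) :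
    (alongRay x f).coeff n = eval x (homogeneousComponent n f) := by
  induction f using MvPolynomial.induction_on' with
  | monomial d a =>
    rw [alongRay_monomial, Polynomial.coeff_C_mul_X_pow,
      homogeneousComponent_of_mem (isHomogeneous_monomial a rfl)]
    split_ifs <;> simp
  | add p q hp hq => simp [hp, hq]

lemma coeff_alongLine (p x : σ → ℂ) (f : MvPolynomial σ ℂ) (n : ℕ) :
    (alongLine p x f).coeff n = eval x (homogeneousComponent n (taylorAt p f)) := by
  rw [← alongRay_taylorAt, coeff_alongRay]

lemma eval_alongLine (p x : σ → ℂ) (f : MvPolynomial σ ℂ) (t : ℂ) :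
    (alongLine p x f).eval t = eval (p + t • x) f := by
  rw [alongLine, ← Polynomial.coe_aeval_eq_eval, comp_aeval_apply, aeval_eq_eval]
  congr 2
  ext i
  simp only [Polynomial.coe_aeval_eq_eval, Polynomial.eval_C, Polynomial.eval_mul,
    Polynomial.eval_X, Pi.add_apply, Pi.smul_apply, smul_eq_mul, map_add]
  ring

lemma coeff_zero_alongLine (p x : σ → ℂ) (f : MvPolynomial σ ℂ) :
    (alongLine p x f).coeff 0 = eval p f := by
  rw [Polynomial.coeff_zero_eq_eval_zero, eval_alongLine, zero_smul, add_zero]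

lemma alongRay_eq_alongLine (x : σ → ℂ) : alongRay x = alongLine 0 x := by
  simp [alongRay, alongLine]

lemma alongLine_eq_zero {p x : σ → ℂ} {V : Set (σ → ℂ)} (h : ∀ t : ℂ, p + t • x ∈ V)
    {f : MvPolynomial σ ℂ} (hf : f ∈ vanishingIdeal ℂ V) : alongLine p x f = 0 := by
  refine Polynomial.funext fun t => ?_
  rw [eval_alongLine, Polynomial.eval_zero]
  exact hf _ (h t)

lemma coeff_two_mul {R : Type*} [CommRing R] (f g : Polynomial R) :
    (f * g).coeff 2 = f.coeff 0 * g.coeff 2 + f.coeff 1 * g.coeff 1 + f.coeff 2 * g.coeff 0 := by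
  rw [Polynomial.coeff_mul, Finset.Nat.sum_antidiagonal_eq_sum_range_succ_mk]
  simp [Finset.sum_range_succ]

/-- The linear form as a polynomial. -/
noncomputable def linearForm [Fintype σ] [DecidableEq σ] (ℓ : (σ → ℂ) →ₗ[ℂ] ℂ) :
    MvPolynomial σ ℂ := ∑ i, C (ℓ (Pi.single i 1)) * X i

lemma eval_linearForm [Fintype σ] [DecidableEq σ] (ℓ : (σ → ℂ) →ₗ[ℂ] ℂ) (x : σ → ℂ) :
    eval x (linearForm ℓ) = ℓ x := by
  have := sum_apply_single_mul (LinearMap.pi fun _ : Unit => ℓ) x ()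
  rw [linearForm, map_sum]
  simp only [map_mul, eval_C, eval_X]
  exact this

lemma alongLine_linearForm [Fintype σ] [DecidableEq σ] (ℓ : (σ → ℂ) →ₗ[ℂ] ℂ) (p x : σ → ℂ) :
    alongLine p x (linearForm ℓ) = Polynomial.C (ℓ p) + Polynomial.C (ℓ x) * Polynomial.X :=
  Polynomial.funext fun t => by
    rw [eval_alongLine, eval_linearForm]
    simp only [Polynomial.eval_add, Polynomial.eval_C, Polynomial.eval_mul, Polynomial.eval_X,
      smul_eq_mul, map_add, map_smul]
    ring

lemma linearForm_mem_vanishingIdeal [Fintype σ] [DecidableEq σ] {ℓ : (σ → ℂ) →ₗ[ℂ] ℂ}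
    {T : Submodule ℂ (σ → ℂ)} (h : T ≤ LinearMap.ker ℓ) :
    linearForm ℓ ∈ vanishingIdeal ℂ (T : Set (σ → ℂ)) := fun x hx => by
  rw [aeval_eq_eval]; simpa [eval_linearForm] using h hx

/-- For an x killed by all linear parts, a generator of the tangent cone has no term of order below
2 along the ray of x: either its degree is at least 2, or it is a constant or linear part that
vanishes there. -/
lemma coeff_alongRay_tangentCone {I : Ideal (MvPolynomial σ ℂ)} {p : σ → ℂ}
    (hI : ∀ f ∈ I, eval p f = 0) {x : σ → ℂ} (hx : ∀ f ∈ I, (alongLine p x f).coeff 1 = 0)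
    {h : MvPolynomial σ ℂ} (hh : h ∈ tangentConeIdeal I p) :
    (alongRay x h).coeff 0 = 0 ∧ (alongRay x h).coeff 1 = 0 := by
  induction hh using Submodule.span_induction with
  | mem h hh =>
    obtain ⟨f, hf, d, hd, rfl⟩ := hh
    have h0 := hI f hf
    have h1 := hx f hf
    rw [← coeff_zero_alongLine p x] at h0
    rw [coeff_alongLine] at h0 h1
    simp only [coeff_alongRay, homogeneousComponent_of_mem (homogeneousComponent_isHomogeneous d _)]
    constructor <;> split_ifs with hd <;> first | subst hd; assumption | simp
  | zero => simp
  | add a b _ _ ha hb => simp [ha.1, ha.2, hb.1, hb.2]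
  | smul r a _ ha =>
    simp [Polynomial.mul_coeff_zero, Polynomial.mul_coeff_one, ha.1, ha.2]

/-- The tangent space and the quadratic tangent cone at a node, in terms of Taylor coefficients. -/
theorem IsNode.exists_tangentSpace [Fintype σ] [DecidableEq σ] {n : ℕ}
    {I : Ideal (MvPolynomial σ ℂ)} {p : σ → ℂ}
    (h : IsNode n I p) (hI : ∀ f ∈ I, eval p f = 0) :
    ∃ T : Submodule ℂ (σ → ℂ), Module.finrank ℂ T = n + 2 ∧
      (∀ x, x ∈ T ↔ ∀ f ∈ I, (alongLine p x f).coeff 1 = 0) ∧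
      ∀ G : (σ → ℂ) → ℂ,
        (∀ f ∈ I, (∀ x, (alongLine p x f).coeff 1 = 0) →
          ∃ c, ∀ x ∈ T, (alongLine p x f).coeff 2 = c * G x) →
        ∀ x ∈ T, (∀ y ∈ T, G (x + y) = G x + G y) → x ∈ Submodule.span ℂ {p} := by
  obtain ⟨hp, T, g, hpT, hT, hg, htc, hr⟩ := h
  have hg0 : ∀ x, (alongRay x g).coeff 0 = 0 ∧ (alongRay x g).coeff 1 = 0 := fun x => by
    simp [coeff_alongRay, homogeneousComponent_of_mem hg]
  have hTx : ∀ x, x ∈ T ↔ ∀ f ∈ I, (alongLine p x f).coeff 1 = 0 := by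
    intro x
    constructor
    · intro hx f hf
      have hmem : homogeneousComponent 1 (taylorAt p f) ∈ tangentConeIdeal I p := by
        refine Ideal.subset_span ⟨f, hf, 1, fun e he => ?_, rfl⟩
        have h0 := hI f hf
        rw [← coeff_zero_alongLine p 0, coeff_alongLine, homogeneousComponent_zero, eval_C] at h0
        obtain rfl : e = 0 := by omega
        rw [homogeneousComponent_zero, h0, C_0]
      rw [htc] at hmem
      obtain ⟨u, hu, v, hv, huv⟩ := Submodule.mem_sup.1 hmem
      obtain ⟨r, rfl⟩ := Ideal.mem_span_singleton.1 hv
      have hu0 : alongRay x u = 0 := by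
        rw [alongRay_eq_alongLine]
        exact alongLine_eq_zero (fun t => by simpa using T.smul_mem t hx) hu
      have : (alongRay x (homogeneousComponent 1 (taylorAt p f))).coeff 1 = 0 := by
        rw [← huv, map_add, hu0, zero_add, map_mul, Polynomial.mul_coeff_one, (hg0 x).1, (hg0 x).2]
        simp
      rwa [coeff_alongRay, homogeneousComponent_of_mem (homogeneousComponent_isHomogeneous 1 _),
        if_pos rfl, ← coeff_alongLine] at this
    · intro hx
      by_contra hxT
      obtain ⟨ℓ, hℓ, hTℓ⟩ := Submodule.exists_le_ker_of_notMem hxT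
      have hmem : linearForm ℓ ∈ tangentConeIdeal I p := by
        rw [htc]
        exact Ideal.mem_sup_left (linearForm_mem_vanishingIdeal hTℓ)
      have := (coeff_alongRay_tangentCone hI hx hmem).2
      rw [alongRay_eq_alongLine, alongLine_linearForm] at this
      simp at this
      exact hℓ this
  refine ⟨T, hT, hTx, fun G hG x hx hxy => ?_⟩
  -- Terms of order 0 and 1 vanish on T, so multiplying by r only scales the second-order term by
  -- r(0). Applied to the equation g of the tangent cone, this makes g a multiple of G on T, and
  -- additivity for G passes to g.
  have key : ∀ h ∈ tangentConeIdeal I p, ∃ c, ∀ x ∈ T, (alongRay x h).coeff 2 = c * G x := by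
    intro h hh
    have hsub : ∀ h ∈ tangentConeIdeal I p, ∀ x ∈ T,
        (alongRay x h).coeff 0 = 0 ∧ (alongRay x h).coeff 1 = 0 := fun h hh x hx =>
      coeff_alongRay_tangentCone hI ((hTx x).1 hx) hh
    unfold tangentConeIdeal at hh
    induction hh using Submodule.span_induction with
    | mem h hh =>
      obtain ⟨f, hf, d, hd, rfl⟩ := hh
      simp only [coeff_alongRay,
        homogeneousComponent_of_mem (homogeneousComponent_isHomogeneous d _)]
      by_cases hd2 : 2 = d
      · subst hd2
        obtain ⟨c, hc⟩ := hG f hf fun y => by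
          rw [coeff_alongLine, hd 1 (by norm_num), map_zero]
        refine ⟨c, fun x hx => ?_⟩
        rw [if_pos rfl, ← coeff_alongLine, hc x hx]
      · exact ⟨0, fun x hx => by simp [hd2]⟩
    | zero => exact ⟨0, by simp⟩
    | add a b _ _ ha hb =>
      obtain ⟨c, hc⟩ := ha
      obtain ⟨e, he⟩ := hb
      exact ⟨c + e, fun x hx => by simp [hc x hx, he x hx, add_mul]⟩
    | smul r a ha' ha =>
      obtain ⟨c, hc⟩ := ha
      refine ⟨(eval 0 r) * c, fun x hx => ?_⟩
      obtain ⟨h0, h1⟩ := hsub a ha' x hx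
      have e0 : (alongRay x r).coeff 0 = eval 0 r := by
        rw [alongRay_eq_alongLine, coeff_zero_alongLine]
      rw [smul_eq_mul, map_mul, coeff_two_mul, h0, h1, hc x hx, e0]
      ring
  obtain ⟨c, hc⟩ := key g (by rw [htc]; exact Ideal.mem_sup_right (Ideal.mem_span_singleton_self g))
  have hgG : ∀ x ∈ T, eval x g = c * G x := fun x hx => by
    rw [← hc x hx, coeff_alongRay, homogeneousComponent_of_mem hg, if_pos rfl]
  refine (hr x hx).1 fun y hy => ?_
  rw [hgG _ (T.add_mem hx hy), hgG x hx, hgG y hy, hxy y hy, mul_add]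

/-- The second-order Taylor expansion of a polynomial along a curve. -/
lemma coeff_aeval_curve (γ : σ → Polynomial ℂ) {p A B : σ → ℂ} (h0 : ∀ i, (γ i).coeff 0 = p i)
    (h1 : ∀ i, (γ i).coeff 1 = A i) (h2 : ∀ i, (γ i).coeff 2 = B i) (f : MvPolynomial σ ℂ) :
    (aeval γ f).coeff 0 = eval p f ∧ (aeval γ f).coeff 1 = (alongLine p A f).coeff 1 ∧
      (aeval γ f).coeff 2 = (alongLine p A f).coeff 2 + (alongLine p B f).coeff 1 := by
  induction f using MvPolynomial.induction_on with
  | C a => simp [alongLine, Polynomial.coeff_C]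
  | add f g hf hg =>
    simp only [map_add, Polynomial.coeff_add, hf.1, hf.2.1, hf.2.2, hg.1, hg.2.1, hg.2.2]
    refine ⟨trivial, trivial, ?_⟩
    ring
  | mul_X f i hf =>
    have e0 := fun x : σ → ℂ => coeff_zero_alongLine p x f
    have l : ∀ x : σ → ℂ, alongLine p x (X i) =
      Polynomial.C (p i) + Polynomial.C (x i) * Polynomial.X := fun x => by simp [alongLine]
    simp only [map_mul, Polynomial.mul_coeff_zero, Polynomial.mul_coeff_one, coeff_two_mul, hf.1,
      hf.2.1, hf.2.2, aeval_X, h0, h1, h2, e0, l, eval_X]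
    simp [Polynomial.coeff_C, Polynomial.coeff_X]
    ring

lemma aeval_curve_eq_zero {V : Set (σ → ℂ)} {γ : σ → Polynomial ℂ}
    (h : ∀ t, (fun i => (γ i).eval t) ∈ V) {f : MvPolynomial σ ℂ}
    (hf : f ∈ vanishingIdeal ℂ V) : aeval γ f = 0 := by
  refine Polynomial.funext fun t => ?_
  have := hf _ (h t)
  rw [Polynomial.eval_zero, ← this, ← Polynomial.coe_aeval_eq_eval, comp_aeval_apply]

/-- Vanishing at all complex parameters is vanishing as a polynomial, which can then be specialised
to parameters in any ℂ-algebra. -/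
lemma aeval_parametrisation_eq_zero {τ : Type*} {V : Set (σ → ℂ)} {Φ : σ → MvPolynomial τ ℂ}
    (h : ∀ c : τ → ℂ, (fun i => eval c (Φ i)) ∈ V) {f : MvPolynomial σ ℂ}
    (hf : f ∈ vanishingIdeal ℂ V) : aeval Φ f = 0 := by
  refine MvPolynomial.funext fun t => ?_
  have := hf _ (h t)
  rw [map_zero, ← this, ← aeval_eq_eval, comp_aeval_apply]

end Node

/-! ### Pure spinors in coordinates and their ten quadrics -/

section Coordinates

/-- The enumeration of the coordinates of the half-spin space: `∅`, the ten pairs in lexicographic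
order, and the complements of `0, …, 4`. -/
def evenSet : Fin 16 → EvenSubset :=
  ![⟨∅, by decide⟩,
    ⟨{0, 1}, by decide⟩,
    ⟨{0, 2}, by decide⟩,
    ⟨{0, 3}, by decide⟩,
    ⟨{0, 4}, by decide⟩,
    ⟨{1, 2}, by decide⟩,
    ⟨{1, 3}, by decide⟩,
    ⟨{1, 4}, by decide⟩,
    ⟨{2, 3}, by decide⟩,
    ⟨{2, 4}, by decide⟩,
    ⟨{3, 4}, by decide⟩,
    ⟨{1, 2, 3, 4}, by decide⟩,
    ⟨{0, 2, 3, 4}, by decide⟩,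
    ⟨{0, 1, 3, 4}, by decide⟩,
    ⟨{0, 1, 2, 4}, by decide⟩,
    ⟨{0, 1, 2, 3}, by decide⟩]

lemma evenSet_bijective : Function.Bijective evenSet := by
  constructor
  · decide
  · decide

/-- The coordinates of the half-spin space, numbered by `evenSet`. -/
noncomputable def evenEquiv : Fin 16 ≃ EvenSubset := Equiv.ofBijective evenSet evenSet_bijective

lemma evenEquiv_symm_evenSet (i : Fin 16) : evenEquiv.symm (evenSet i) = i :=
  evenEquiv.symm_apply_apply i

/-- The half-spin space in numbered coordinates. -/
noncomputable def coords : HalfSpin ≃ₗ[ℂ] (Fin 16 → ℂ) := LinearEquiv.funCongrLeft ℂ ℂ evenEquiv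

lemma coords_apply (ψ : HalfSpin) (i : Fin 16) : coords ψ i = ψ (evenSet i) := rfl

lemma coords_symm_evenSet (z : Fin 16 → ℂ) (i : Fin 16) : coords.symm z (evenSet i) = z i := by
  exact congrFun (coords.apply_symm_apply z) i

lemma coeff_of_odd (ψ : HalfSpin) {T : Finset (Fin 5)} (h : ¬ Even T.card) : ψ.coeff T = 0 := by
  simp [HalfSpin.coeff, h]

lemma coeff_eq_coords (ψ : HalfSpin) {T : Finset (Fin 5)} {k : Fin 16} (h : T = (evenSet k).1) :
    ψ.coeff T = coords ψ k := by
  rw [h, HalfSpin.coeff, dif_pos (evenSet k).2]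
  rfl

/-- Separates the combinatorics from the algebra: the signs s and indices k are finite tables that
`decide` can check. -/
lemma cliffordAction_eq (u : (Fin 5 → ℂ) × (Fin 5 → ℂ)) (ψ : HalfSpin) (T : Finset (Fin 5))
    (s : Fin 5 → ℤ) (k : Fin 5 → Fin 16)
    (hs : ∀ i, (-1) ^ (T.filter (fun j => j < i)).card = s i)
    (hk : ∀ i, (if i ∈ T then T.erase i else insert i T) = (evenSet (k i)).1) :
    cliffordAction u ψ T = ∑ i, s i * ((if i ∈ T then u.1 i else u.2 i) * coords ψ (k i)) := by
  unfold cliffordAction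
  refine Finset.sum_congr rfl fun i _ => ?_
  rw [← hs i]
  have := hk i
  split_ifs at this ⊢ with h
  · rw [coeff_eq_coords ψ this]
    push_cast
    ring
  · rw [coeff_eq_coords ψ this]
    push_cast
    ring

lemma cliffordAction_of_even (u : (Fin 5 → ℂ) × (Fin 5 → ℂ)) (ψ : HalfSpin) {T : Finset (Fin 5)}
    (hT : Even T.card) : cliffordAction u ψ T = 0 := by
  unfold cliffordAction
  refine Finset.sum_eq_zero fun i _ => ?_
  split_ifs with h
  · rw [coeff_of_odd, mul_zero, mul_zero]
    rw [Finset.card_erase_of_mem h]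
    have := Finset.card_pos.2 ⟨i, h⟩
    rw [Nat.even_sub (by omega)]
    simp [hT]
  · rw [coeff_of_odd, mul_zero, mul_zero]
    rw [Finset.card_insert_of_notMem h, Nat.even_add_one]
    simp [hT]

/-- The vanishing of the Clifford product of `u` with the spinor with coordinates `z`. -/
def CliffordAnnihilates (u : (Fin 5 → ℂ) × (Fin 5 → ℂ)) (z : Fin 16 → ℂ) : Prop :=
    u.1 0 * z 0 - u.2 1 * z 1 - u.2 2 * z 2 - u.2 3 * z 3 - u.2 4 * z 4 = 0 ∧
    u.2 0 * z 1 + u.1 1 * z 0 - u.2 2 * z 5 - u.2 3 * z 6 - u.2 4 * z 7 = 0 ∧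
    u.2 0 * z 2 + u.2 1 * z 5 + u.1 2 * z 0 - u.2 3 * z 8 - u.2 4 * z 9 = 0 ∧
    u.2 0 * z 3 + u.2 1 * z 6 + u.2 2 * z 8 + u.1 3 * z 0 - u.2 4 * z 10 = 0 ∧
    u.2 0 * z 4 + u.2 1 * z 7 + u.2 2 * z 9 + u.2 3 * z 10 + u.1 4 * z 0 = 0 ∧
    u.1 0 * z 5 - u.1 1 * z 2 + u.1 2 * z 1 - u.2 3 * z 15 - u.2 4 * z 14 = 0 ∧
    u.1 0 * z 6 - u.1 1 * z 3 + u.2 2 * z 15 + u.1 3 * z 1 - u.2 4 * z 13 = 0 ∧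
    u.1 0 * z 7 - u.1 1 * z 4 + u.2 2 * z 14 + u.2 3 * z 13 + u.1 4 * z 1 = 0 ∧
    u.1 0 * z 8 - u.2 1 * z 15 - u.1 2 * z 3 + u.1 3 * z 2 - u.2 4 * z 12 = 0 ∧
    u.1 0 * z 9 - u.2 1 * z 14 - u.1 2 * z 4 + u.2 3 * z 12 + u.1 4 * z 2 = 0 ∧
    u.1 0 * z 10 - u.2 1 * z 13 - u.2 2 * z 12 - u.1 3 * z 4 + u.1 4 * z 3 = 0 ∧
    u.2 0 * z 15 + u.1 1 * z 8 - u.1 2 * z 6 + u.1 3 * z 5 - u.2 4 * z 11 = 0 ∧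
    u.2 0 * z 14 + u.1 1 * z 9 - u.1 2 * z 7 + u.2 3 * z 11 + u.1 4 * z 5 = 0 ∧
    u.2 0 * z 13 + u.1 1 * z 10 - u.2 2 * z 11 - u.1 3 * z 7 + u.1 4 * z 6 = 0 ∧
    u.2 0 * z 12 + u.2 1 * z 11 + u.1 2 * z 10 - u.1 3 * z 9 + u.1 4 * z 8 = 0 ∧
    u.1 0 * z 11 - u.1 1 * z 12 + u.1 2 * z 13 - u.1 3 * z 14 + u.1 4 * z 15 = 0

lemma oddSet_cases : ∀ T : Finset (Fin 5), ¬ Even T.card →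
    T = {0} ∨ T = {1} ∨ T = {2} ∨ T = {3} ∨ T = {4} ∨ T = {0, 1, 2} ∨ T = {0, 1, 3} ∨ T = {0, 1, 4} ∨ T = {0, 2, 3} ∨ T = {0, 2, 4} ∨ T = {0, 3, 4} ∨ T = {1, 2, 3} ∨ T = {1, 2, 4} ∨ T = {1, 3, 4} ∨ T = {2, 3, 4} ∨ T = {0, 1, 2, 3, 4} := by
  decide

lemma cliffordAction_eq_zero_iff (u : (Fin 5 → ℂ) × (Fin 5 → ℂ)) (ψ : HalfSpin) :
    (∀ T, cliffordAction u ψ T = 0) ↔ CliffordAnnihilates u (coords ψ) := by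
  have e0 := cliffordAction_eq u ψ {0} ![1, -1, -1, -1, -1] ![0, 1, 2, 3, 4] (by decide) (by decide)
  have e1 := cliffordAction_eq u ψ {1} ![1, 1, -1, -1, -1] ![1, 0, 5, 6, 7] (by decide) (by decide)
  have e2 := cliffordAction_eq u ψ {2} ![1, 1, 1, -1, -1] ![2, 5, 0, 8, 9] (by decide) (by decide)
  have e3 := cliffordAction_eq u ψ {3} ![1, 1, 1, 1, -1] ![3, 6, 8, 0, 10] (by decide) (by decide)
  have e4 := cliffordAction_eq u ψ {4} ![1, 1, 1, 1, 1] ![4, 7, 9, 10, 0] (by decide) (by decide)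
  have e5 := cliffordAction_eq u ψ {0, 1, 2} ![1, -1, 1, -1, -1] ![5, 2, 1, 15, 14] (by decide) (by decide)
  have e6 := cliffordAction_eq u ψ {0, 1, 3} ![1, -1, 1, 1, -1] ![6, 3, 15, 1, 13] (by decide) (by decide)
  have e7 := cliffordAction_eq u ψ {0, 1, 4} ![1, -1, 1, 1, 1] ![7, 4, 14, 13, 1] (by decide) (by decide)
  have e8 := cliffordAction_eq u ψ {0, 2, 3} ![1, -1, -1, 1, -1] ![8, 15, 3, 2, 12] (by decide) (by decide)
  have e9 := cliffordAction_eq u ψ {0, 2, 4} ![1, -1, -1, 1, 1] ![9, 14, 4, 12, 2] (by decide) (by decide)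
  have e10 := cliffordAction_eq u ψ {0, 3, 4} ![1, -1, -1, -1, 1] ![10, 13, 12, 4, 3] (by decide) (by decide)
  have e11 := cliffordAction_eq u ψ {1, 2, 3} ![1, 1, -1, 1, -1] ![15, 8, 6, 5, 11] (by decide) (by decide)
  have e12 := cliffordAction_eq u ψ {1, 2, 4} ![1, 1, -1, 1, 1] ![14, 9, 7, 11, 5] (by decide) (by decide)
  have e13 := cliffordAction_eq u ψ {1, 3, 4} ![1, 1, -1, -1, 1] ![13, 10, 11, 7, 6] (by decide) (by decide)
  have e14 := cliffordAction_eq u ψ {2, 3, 4} ![1, 1, 1, -1, 1] ![12, 11, 10, 9, 8] (by decide) (by decide)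
  have e15 := cliffordAction_eq u ψ {0, 1, 2, 3, 4} ![1, -1, 1, -1, 1] ![11, 12, 13, 14, 15] (by decide) (by decide)
  simp [Fin.sum_univ_five] at e0 e1 e2 e3 e4 e5 e6 e7 e8 e9 e10 e11 e12 e13 e14 e15
  constructor
  · intro h
    refine ⟨?_, ?_, ?_, ?_, ?_, ?_, ?_, ?_, ?_, ?_, ?_, ?_, ?_, ?_, ?_, ?_⟩
    · linear_combination h {0} - e0
    · linear_combination h {1} - e1
    · linear_combination h {2} - e2
    · linear_combination h {3} - e3
    · linear_combination h {4} - e4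
    · linear_combination h {0, 1, 2} - e5
    · linear_combination h {0, 1, 3} - e6
    · linear_combination h {0, 1, 4} - e7
    · linear_combination h {0, 2, 3} - e8
    · linear_combination h {0, 2, 4} - e9
    · linear_combination h {0, 3, 4} - e10
    · linear_combination h {1, 2, 3} - e11
    · linear_combination h {1, 2, 4} - e12
    · linear_combination h {1, 3, 4} - e13
    · linear_combination h {2, 3, 4} - e14
    · linear_combination h {0, 1, 2, 3, 4} - e15
  · rintro ⟨h0, h1, h2, h3, h4, h5, h6, h7, h8, h9, h10, h11, h12, h13, h14, h15⟩ T
    by_cases hT : Even T.card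
    · exact cliffordAction_of_even u ψ hT
    · rcases oddSet_cases T hT with rfl | rfl | rfl | rfl | rfl | rfl | rfl | rfl | rfl | rfl | rfl | rfl | rfl | rfl | rfl | rfl
      · rw [e0]; linear_combination h0
      · rw [e1]; linear_combination h1
      · rw [e2]; linear_combination h2
      · rw [e3]; linear_combination h3
      · rw [e4]; linear_combination h4
      · rw [e5]; linear_combination h5
      · rw [e6]; linear_combination h6
      · rw [e7]; linear_combination h7
      · rw [e8]; linear_combination h8
      · rw [e9]; linear_combination h9
      · rw [e10]; linear_combination h10
      · rw [e11]; linear_combination h11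
      · rw [e12]; linear_combination h12
      · rw [e13]; linear_combination h13
      · rw [e14]; linear_combination h14
      · rw [e15]; linear_combination h15

/-- Pure spinors in numbered coordinates. -/
def IsPureSpinor (z : Fin 16 → ℂ) : Prop :=
  ∃ U : Submodule ℂ ((Fin 5 → ℂ) × (Fin 5 → ℂ)),
    Module.finrank ℂ U = 5 ∧ (∀ u ∈ U, ∑ i, u.1 i * u.2 i = 0) ∧ ∀ u ∈ U, CliffordAnnihilates u z

lemma mem_spinorCone_iff_isPureSpinor (ψ : HalfSpin) :
    ψ ∈ spinorCone ↔ IsPureSpinor (coords ψ) := by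
  simp only [spinorCone, Set.mem_ofPred_eq, IsPureSpinor, cliffordAction_eq_zero_iff]

/-- The ten quadratic equations of the spinor variety. -/
def SatisfiesSpinorQuadrics {R : Type*} [CommRing R] (z : Fin 16 → R) : Prop :=
    z 0 * z 11 - z 10 * z 5 + z 6 * z 9 - z 7 * z 8 = 0 ∧
    z 0 * z 12 - z 10 * z 2 + z 3 * z 9 - z 4 * z 8 = 0 ∧
    z 0 * z 13 - z 1 * z 10 + z 3 * z 7 - z 4 * z 6 = 0 ∧
    z 0 * z 14 - z 1 * z 9 + z 2 * z 7 - z 4 * z 5 = 0 ∧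
    z 0 * z 15 - z 1 * z 8 + z 2 * z 6 - z 3 * z 5 = 0 ∧
    -z 1 * z 12 + z 13 * z 2 - z 14 * z 3 + z 15 * z 4 = 0 ∧
    -z 1 * z 11 + z 13 * z 5 - z 14 * z 6 + z 15 * z 7 = 0 ∧
    -z 11 * z 2 + z 12 * z 5 - z 14 * z 8 + z 15 * z 9 = 0 ∧
    -z 11 * z 3 + z 12 * z 6 - z 13 * z 8 + z 10 * z 15 = 0 ∧
    -z 11 * z 4 + z 12 * z 7 - z 13 * z 9 + z 10 * z 14 = 0

/-- The action of the cyclic permutation of the basis of `ℂ⁵` on half-spinors. -/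
def spinCycle (z : Fin 16 → ℂ) : Fin 16 → ℂ :=
  ![z 0, -z 4, -z 7, -z 9, -z 10, z 1, z 2, z 3, z 5, z 6, z 8, z 15, -z 11, -z 12, -z 13, -z 14]

/-- The action on half-spinors of the exchange of two basis vectors with their duals. -/
def spinSwap (z : Fin 16 → ℂ) : Fin 16 → ℂ :=
  ![-z 1, z 0, z 5, z 6, z 7, -z 2, -z 3, -z 4, -z 15, -z 14, -z 13, -z 12, z 11, z 10, z 9, z 8]

/-- The cyclic permutation of the basis on `ℂ⁵ ⊕ (ℂ⁵)*`. -/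
def vectorCycle : ((Fin 5 → ℂ) × (Fin 5 → ℂ)) ≃ₗ[ℂ] ((Fin 5 → ℂ) × (Fin 5 → ℂ)) :=
  (LinearEquiv.funCongrLeft ℂ ℂ (finRotate 5).symm).prodCongr
    (LinearEquiv.funCongrLeft ℂ ℂ (finRotate 5).symm)

/-- The exchange of two basis vectors with their duals on `ℂ⁵ ⊕ (ℂ⁵)*`. -/
def vectorSwap : ((Fin 5 → ℂ) × (Fin 5 → ℂ)) ≃ₗ[ℂ] ((Fin 5 → ℂ) × (Fin 5 → ℂ)) :=
  LinearEquiv.ofInvolutive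
    { toFun := fun u => (![-u.2 0, -u.2 1, u.1 2, u.1 3, u.1 4],
        ![-u.1 0, -u.1 1, u.2 2, u.2 3, u.2 4])
      map_add' := fun u v => by
        ext i <;> fin_cases i <;> simp <;> ring
      map_smul' := fun c u => by
        ext i <;> fin_cases i <;> simp }
    (fun u => by ext i <;> fin_cases i <;> simp)

lemma vectorSwap_apply (u : (Fin 5 → ℂ) × (Fin 5 → ℂ)) : vectorSwap u =
    (![-u.2 0, -u.2 1, u.1 2, u.1 3, u.1 4], ![-u.1 0, -u.1 1, u.2 2, u.2 3, u.2 4]) := rfl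

lemma cliffordAnnihilates_cycle (u : (Fin 5 → ℂ) × (Fin 5 → ℂ)) (z : Fin 16 → ℂ) :
    CliffordAnnihilates (vectorCycle u) (spinCycle z) ↔ CliffordAnnihilates u z := by
  obtain ⟨v, ξ⟩ := u
  have e : ∀ w : Fin 5 → ℂ, LinearEquiv.funCongrLeft ℂ ℂ (finRotate 5).symm w =
      ![w 4, w 0, w 1, w 2, w 3] := by
    intro w; ext i; fin_cases i <;> rfl
  simp only [CliffordAnnihilates, vectorCycle, LinearEquiv.prodCongr_apply, e, spinCycle]
  simp only [Matrix.cons_val]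
  constructor
  · rintro ⟨h0, h1, h2, h3, h4, h5, h6, h7, h8, h9, h10, h11, h12, h13, h14, h15⟩
    exact ⟨by linear_combination h1,
    by linear_combination h2,
    by linear_combination h3,
    by linear_combination h4,
    by linear_combination h0,
    by linear_combination h11,
    by linear_combination h12,
    by linear_combination h5,
    by linear_combination h13,
    by linear_combination h6,
    by linear_combination h7,
    by linear_combination h14,
    by linear_combination h8,
    by linear_combination h9,
    by linear_combination h10,
    by linear_combination h15⟩
  · rintro ⟨h0, h1, h2, h3, h4, h5, h6, h7, h8, h9, h10, h11, h12, h13, h14, h15⟩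
    exact ⟨by linear_combination h4,
    by linear_combination h0,
    by linear_combination h1,
    by linear_combination h2,
    by linear_combination h3,
    by linear_combination h7,
    by linear_combination h9,
    by linear_combination h10,
    by linear_combination h12,
    by linear_combination h13,
    by linear_combination h14,
    by linear_combination h5,
    by linear_combination h6,
    by linear_combination h8,
    by linear_combination h11,
    by linear_combination h15⟩

lemma cliffordAnnihilates_swap (u : (Fin 5 → ℂ) × (Fin 5 → ℂ)) (z : Fin 16 → ℂ) :
    CliffordAnnihilates (vectorSwap u) (spinSwap z) ↔ CliffordAnnihilates u z := by
  obtain ⟨v, ξ⟩ := u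
  simp only [CliffordAnnihilates, vectorSwap_apply, spinSwap]
  simp only [Matrix.cons_val]
  constructor
  · rintro ⟨h0, h1, h2, h3, h4, h5, h6, h7, h8, h9, h10, h11, h12, h13, h14, h15⟩
    exact ⟨by linear_combination -h1,
    by linear_combination h0,
    by linear_combination h5,
    by linear_combination h6,
    by linear_combination h7,
    by linear_combination -h2,
    by linear_combination -h3,
    by linear_combination -h4,
    by linear_combination -h11,
    by linear_combination -h12,
    by linear_combination -h13,
    by linear_combination h8,
    by linear_combination h9,
    by linear_combination h10,
    by linear_combination h15,
    by linear_combination -h14⟩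
  · rintro ⟨h0, h1, h2, h3, h4, h5, h6, h7, h8, h9, h10, h11, h12, h13, h14, h15⟩
    exact ⟨by linear_combination h1,
    by linear_combination -h0,
    by linear_combination -h5,
    by linear_combination -h6,
    by linear_combination -h7,
    by linear_combination h2,
    by linear_combination h3,
    by linear_combination h4,
    by linear_combination h11,
    by linear_combination h12,
    by linear_combination h13,
    by linear_combination -h8,
    by linear_combination -h9,
    by linear_combination -h10,
    by linear_combination -h15,
    by linear_combination h14⟩

/-- An isometry of ℂ⁵ ⊕ (ℂ⁵)* compatible with the Clifford action carries annihilating isotropic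
subspaces to such subspaces. -/
lemma isPureSpinor_of_equiv {z z' : Fin 16 → ℂ}
    (h : ((Fin 5 → ℂ) × (Fin 5 → ℂ)) ≃ₗ[ℂ] ((Fin 5 → ℂ) × (Fin 5 → ℂ)))
    (hq : ∀ u, ∑ i, (h u).1 i * (h u).2 i = ∑ i, u.1 i * u.2 i)
    (hz : ∀ u, CliffordAnnihilates (h u) z' ↔ CliffordAnnihilates u z) :
    IsPureSpinor z' ↔ IsPureSpinor z := by
  constructor
  · rintro ⟨U, hU, hU1, hU2⟩
    refine ⟨U.comap h.toLinearMap, ?_, fun u hu => ?_, fun u hu => ?_⟩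
    · refine Eq.trans ?_ ((LinearEquiv.finrank_map_eq h.symm U).trans hU)
      rw [Submodule.map_equiv_eq_comap_symm]
      rfl
    · rw [← hq]; exact hU1 _ hu
    · rw [← hz]; exact hU2 _ hu
  · rintro ⟨U, hU, hU1, hU2⟩
    refine ⟨U.map h.toLinearMap, ?_, ?_, ?_⟩
    · exact (LinearEquiv.finrank_map_eq h U).trans hU
    · rintro _ ⟨u, hu, rfl⟩
      exact (hq u).trans (hU1 u hu)
    · rintro _ ⟨u, hu, rfl⟩
      exact (hz u).2 (hU2 u hu)

lemma isPureSpinor_cycle (z : Fin 16 → ℂ) : IsPureSpinor (spinCycle z) ↔ IsPureSpinor z := by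
  refine isPureSpinor_of_equiv vectorCycle (fun u => ?_) fun u => cliffordAnnihilates_cycle u z
  exact Equiv.sum_comp (finRotate 5).symm fun i => u.1 i * u.2 i

lemma isPureSpinor_swap (z : Fin 16 → ℂ) : IsPureSpinor (spinSwap z) ↔ IsPureSpinor z := by
  refine isPureSpinor_of_equiv vectorSwap (fun u => ?_) fun u => cliffordAnnihilates_swap u z
  simp [vectorSwap_apply, Fin.sum_univ_five]
  ring

lemma satisfiesSpinorQuadrics_cycle (z : Fin 16 → ℂ) :
    SatisfiesSpinorQuadrics (spinCycle z) ↔ SatisfiesSpinorQuadrics z := by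
  simp only [SatisfiesSpinorQuadrics, spinCycle]
  simp only [Matrix.cons_val]
  constructor
  · rintro ⟨h0, h1, h2, h3, h4, h5, h6, h7, h8, h9⟩
    exact ⟨by linear_combination -h1,
    by linear_combination -h2,
    by linear_combination -h3,
    by linear_combination -h4,
    by linear_combination h0,
    by linear_combination h6,
    by linear_combination h7,
    by linear_combination h8,
    by linear_combination h9,
    by linear_combination h5⟩
  · rintro ⟨h0, h1, h2, h3, h4, h5, h6, h7, h8, h9⟩
    exact ⟨by linear_combination h4,
    by linear_combination -h0,
    by linear_combination -h1,
    by linear_combination -h2,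
    by linear_combination -h3,
    by linear_combination h9,
    by linear_combination h5,
    by linear_combination h6,
    by linear_combination h7,
    by linear_combination h8⟩

lemma satisfiesSpinorQuadrics_swap (z : Fin 16 → ℂ) :
    SatisfiesSpinorQuadrics (spinSwap z) ↔ SatisfiesSpinorQuadrics z := by
  simp only [SatisfiesSpinorQuadrics, spinSwap]
  simp only [Matrix.cons_val]
  constructor
  · rintro ⟨h0, h1, h2, h3, h4, h5, h6, h7, h8, h9⟩
    exact ⟨by linear_combination -h5,
    by linear_combination h6,
    by linear_combination h2,
    by linear_combination h3,
    by linear_combination h4,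
    by linear_combination -h0,
    by linear_combination h1,
    by linear_combination h7,
    by linear_combination h8,
    by linear_combination h9⟩
  · rintro ⟨h0, h1, h2, h3, h4, h5, h6, h7, h8, h9⟩
    exact ⟨by linear_combination -h5,
    by linear_combination h6,
    by linear_combination h2,
    by linear_combination h3,
    by linear_combination h4,
    by linear_combination -h0,
    by linear_combination h1,
    by linear_combination h7,
    by linear_combination h8,
    by linear_combination h9⟩

/-- Every nonzero half-spinor can be moved to one with nonzero first coordinate. -/
lemma spinor_induction {P : (Fin 16 → ℂ) → Prop} (hc : ∀ z, P (spinCycle z) → P z)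
    (hs : ∀ z, P (spinSwap z) → P z) (h0 : ∀ z, z 0 ≠ 0 → P z) : ∀ z, z ≠ 0 → P z := by
  -- The cycle permutes, up to sign, the adjacent pairs, the non-adjacent pairs and the four-element
  -- sets in three orbits of length five; the swap links ∅ to 01, 12 to 02, and 23 to 0123.
  have h1 : ∀ z, z 1 ≠ 0 → P z := fun z hz => hs z (h0 _ (by simpa [spinSwap] using hz))
  have h4 : ∀ z, z 4 ≠ 0 → P z := fun z hz => hc z (h1 _ (by simpa [spinCycle] using hz))
  have h10 : ∀ z, z 10 ≠ 0 → P z := fun z hz => hc z (h4 _ (by simpa [spinCycle] using hz))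
  have h8 : ∀ z, z 8 ≠ 0 → P z := fun z hz => hc z (h10 _ (by simpa [spinCycle] using hz))
  have h5 : ∀ z, z 5 ≠ 0 → P z := fun z hz => hc z (h8 _ (by simpa [spinCycle] using hz))
  have h2 : ∀ z, z 2 ≠ 0 → P z := fun z hz => hs z (h5 _ (by simpa [spinSwap] using hz))
  have h7 : ∀ z, z 7 ≠ 0 → P z := fun z hz => hc z (h2 _ (by simpa [spinCycle] using hz))
  have h3 : ∀ z, z 3 ≠ 0 → P z := fun z hz => hc z (h7 _ (by simpa [spinCycle] using hz))
  have h9 : ∀ z, z 9 ≠ 0 → P z := fun z hz => hc z (h3 _ (by simpa [spinCycle] using hz))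
  have h6 : ∀ z, z 6 ≠ 0 → P z := fun z hz => hc z (h9 _ (by simpa [spinCycle] using hz))
  have h15 : ∀ z, z 15 ≠ 0 → P z := fun z hz => hs z (h8 _ (by simpa [spinSwap] using hz))
  have h14 : ∀ z, z 14 ≠ 0 → P z := fun z hz => hc z (h15 _ (by simpa [spinCycle] using hz))
  have h13 : ∀ z, z 13 ≠ 0 → P z := fun z hz => hc z (h14 _ (by simpa [spinCycle] using hz))
  have h12 : ∀ z, z 12 ≠ 0 → P z := fun z hz => hc z (h13 _ (by simpa [spinCycle] using hz))
  have h11 : ∀ z, z 11 ≠ 0 → P z := fun z hz => hc z (h12 _ (by simpa [spinCycle] using hz))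
  intro z hz
  obtain ⟨i, hi⟩ := Function.ne_iff.1 hz
  fin_cases i
  exacts [h0 z hi, h1 z hi, h2 z hi, h3 z hi, h4 z hi, h5 z hi, h6 z hi, h7 z hi, h8 z hi, h9 z hi, h10 z hi, h11 z hi, h12 z hi, h13 z hi, h14 z hi, h15 z hi]

/-- For x₀ ≠ 0 no nonzero (v, 0) annihilates z, so U projects isomorphically onto (ℂ⁵)*. Lifting the
dual basis and eliminating v from the Clifford equations leaves the quadrics: three-element sets
give x₀Y = Pf(x), the full set gives xY = 0. -/
lemma SatisfiesSpinorQuadrics.of_isPureSpinor {z : Fin 16 → ℂ} (hz : z 0 ≠ 0)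
    (h : IsPureSpinor z) : SatisfiesSpinorQuadrics z := by
  obtain ⟨U, hU, -, hU2⟩ := h
  have hinj : Function.Injective ((LinearMap.snd ℂ (Fin 5 → ℂ) (Fin 5 → ℂ)).domRestrict U) := by
    rw [← LinearMap.ker_eq_bot, LinearMap.ker_eq_bot']
    rintro ⟨⟨v, ξ⟩, hu⟩ h
    obtain rfl : ξ = 0 := h
    obtain ⟨h0, h1, h2, h3, h4, -⟩ := hU2 _ hu
    simp [hz] at h0 h1 h2 h3 h4
    ext i
    · fin_cases i <;> assumption
    · rfl
  have hsurj : ∀ ξ : Fin 5 → ℂ, ∃ v, CliffordAnnihilates (v, ξ) z := by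
    intro ξ
    obtain ⟨⟨⟨v, ξ'⟩, hu⟩, h⟩ := (LinearMap.injective_iff_surjective_of_finrank_eq_finrank
      (by rw [hU]; simp)).1 hinj ξ
    obtain rfl : ξ' = ξ := h
    exact ⟨v, hU2 _ hu⟩
  obtain ⟨v0, hv0⟩ := hsurj ![1, 0, 0, 0, 0]
  simp only [CliffordAnnihilates, Matrix.cons_val] at hv0
  obtain ⟨a0_0, a0_1, a0_2, a0_3, a0_4, a0_5, a0_6, a0_7, a0_8, a0_9, a0_10, a0_11, a0_12, a0_13, a0_14, a0_15⟩ := hv0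
  obtain ⟨v1, hv1⟩ := hsurj ![0, 1, 0, 0, 0]
  simp only [CliffordAnnihilates, Matrix.cons_val] at hv1
  obtain ⟨a1_0, a1_1, a1_2, a1_3, a1_4, a1_5, a1_6, a1_7, a1_8, a1_9, a1_10, a1_11, a1_12, a1_13, a1_14, a1_15⟩ := hv1
  obtain ⟨v2, hv2⟩ := hsurj ![0, 0, 1, 0, 0]
  simp only [CliffordAnnihilates, Matrix.cons_val] at hv2
  obtain ⟨a2_0, a2_1, a2_2, a2_3, a2_4, a2_5, a2_6, a2_7, a2_8, a2_9, a2_10, a2_11, a2_12, a2_13, a2_14, a2_15⟩ := hv2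
  obtain ⟨v3, hv3⟩ := hsurj ![0, 0, 0, 1, 0]
  simp only [CliffordAnnihilates, Matrix.cons_val] at hv3
  obtain ⟨a3_0, a3_1, a3_2, a3_3, a3_4, a3_5, a3_6, a3_7, a3_8, a3_9, a3_10, a3_11, a3_12, a3_13, a3_14, a3_15⟩ := hv3
  obtain ⟨v4, hv4⟩ := hsurj ![0, 0, 0, 0, 1]
  simp only [CliffordAnnihilates, Matrix.cons_val] at hv4
  obtain ⟨a4_0, a4_1, a4_2, a4_3, a4_4, a4_5, a4_6, a4_7, a4_8, a4_9, a4_10, a4_11, a4_12, a4_13, a4_14, a4_15⟩ := hv4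
  exact ⟨by linear_combination -(z 0 * a4_11 - z 8 * a4_1 + z 6 * a4_2 - z 5 * a4_3),
    by linear_combination -(z 0 * a4_8 - z 8 * a4_0 + z 3 * a4_2 - z 2 * a4_3),
    by linear_combination -(z 0 * a4_6 - z 6 * a4_0 + z 3 * a4_1 - z 1 * a4_3),
    by linear_combination -(z 0 * a4_5 - z 5 * a4_0 + z 2 * a4_1 - z 1 * a4_2),
    by linear_combination -(z 0 * a3_5 - z 5 * a3_0 + z 2 * a3_1 - z 1 * a3_2),
    by linear_combination -(z 0 * a0_15 - z 11 * a0_0 + z 12 * a0_1 - z 13 * a0_2 + z 14 * a0_3 - z 15 * a0_4),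
    by linear_combination -(z 0 * a1_15 - z 11 * a1_0 + z 12 * a1_1 - z 13 * a1_2 + z 14 * a1_3 - z 15 * a1_4),
    by linear_combination -(z 0 * a2_15 - z 11 * a2_0 + z 12 * a2_1 - z 13 * a2_2 + z 14 * a2_3 - z 15 * a2_4),
    by linear_combination -(z 0 * a3_15 - z 11 * a3_0 + z 12 * a3_1 - z 13 * a3_2 + z 14 * a3_3 - z 15 * a3_4),
    by linear_combination -(z 0 * a4_15 - z 11 * a4_0 + z 12 * a4_1 - z 13 * a4_2 + z 14 * a4_3 - z 15 * a4_4)⟩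

/-- The annihilator is the graph of the skew matrix x/x₀, parametrised here without denominators;
skewness makes it isotropic. -/
lemma IsPureSpinor.of_quadrics {z : Fin 16 → ℂ} (hz : z 0 ≠ 0) (h : SatisfiesSpinorQuadrics z) :
    IsPureSpinor z := by
  obtain ⟨q0, q1, q2, q3, q4, q5, q6, q7, q8, q9⟩ := h
  let F : (Fin 5 → ℂ) →ₗ[ℂ] ((Fin 5 → ℂ) × (Fin 5 → ℂ)) :=
    { toFun := fun η => (![
        η 1 * z 1 + η 2 * z 2 + η 3 * z 3 + η 4 * z 4,
        -η 0 * z 1 + η 2 * z 5 + η 3 * z 6 + η 4 * z 7,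
        -η 0 * z 2 - η 1 * z 5 + η 3 * z 8 + η 4 * z 9,
        -η 0 * z 3 - η 1 * z 6 - η 2 * z 8 + η 4 * z 10,
        -η 0 * z 4 - η 1 * z 7 - η 2 * z 9 - η 3 * z 10], z 0 • η)
      map_add' := fun u v => by
        ext i
        · fin_cases i <;> simp <;> ring
        · simp [mul_add]
      map_smul' := fun c u => by
        ext i
        · fin_cases i <;> simp <;> ring
        · simp [mul_left_comm] }
  have hF : Function.Injective F := by
    intro u v huv
    have : z 0 • u = z 0 • v := congrArg Prod.snd huv
    exact smul_right_injective _ hz this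
  refine ⟨LinearMap.range F, ?_, ?_, ?_⟩
  · rw [LinearMap.finrank_range_of_inj hF]; simp
  · rintro _ ⟨η, rfl⟩
    simp [F, Fin.sum_univ_five]
    ring
  · rintro _ ⟨η, rfl⟩
    simp only [F, LinearMap.coe_mk, AddHom.coe_mk, CliffordAnnihilates, Pi.smul_apply, smul_eq_mul]
    simp only [Matrix.cons_val]
    exact ⟨by ring,
      by ring,
      by ring,
      by ring,
      by ring,
      by linear_combination -η 3 * q4 - η 4 * q3,
      by linear_combination η 2 * q4 - η 4 * q2,
      by linear_combination η 2 * q3 + η 3 * q2,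
      by linear_combination -η 1 * q4 - η 4 * q1,
      by linear_combination -η 1 * q3 + η 3 * q1,
      by linear_combination -η 1 * q2 - η 2 * q1,
      by linear_combination η 0 * q4 - η 4 * q0,
      by linear_combination η 0 * q3 + η 3 * q0,
      by linear_combination η 0 * q2 - η 2 * q0,
      by linear_combination η 0 * q1 + η 1 * q0,
      by linear_combination -η 0 * q5 - η 1 * q6 - η 2 * q7 - η 3 * q8 - η 4 * q9⟩

/-- Both sides are invariant under the cycle and the swap, so the case x₀ ≠ 0 suffices for z ≠ 0. At
z = 0 any isotropic 5-space will do, for instance ℂ⁵ ⊕ 0. -/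
theorem isPureSpinor_iff (z : Fin 16 → ℂ) : IsPureSpinor z ↔ SatisfiesSpinorQuadrics z := by
  by_cases hz : z = 0
  · subst hz
    simp only [SatisfiesSpinorQuadrics, IsPureSpinor, CliffordAnnihilates, Pi.zero_apply]
    simp only [mul_zero, add_zero, sub_zero, neg_zero, and_self, iff_true, implies_true, and_true]
    refine ⟨LinearMap.range (LinearMap.inl ℂ (Fin 5 → ℂ) (Fin 5 → ℂ)), ?_, ?_⟩
    · rw [LinearMap.finrank_range_of_inj LinearMap.inl_injective]; simp
    · rintro _ ⟨v, rfl⟩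
      simp
  · revert z
    refine spinor_induction (fun z h => ?_) (fun z h => ?_) (fun z h => ?_)
    · rwa [isPureSpinor_cycle, satisfiesSpinorQuadrics_cycle] at h
    · rwa [isPureSpinor_swap, satisfiesSpinorQuadrics_swap] at h
    · exact ⟨SatisfiesSpinorQuadrics.of_isPureSpinor h, IsPureSpinor.of_quadrics h⟩

/-- The cone over the spinor variety is defined by ten quadrics. -/
theorem mem_spinorCone_iff (ψ : HalfSpin) :
    ψ ∈ spinorCone ↔ SatisfiesSpinorQuadrics (coords ψ) := by
  rw [mem_spinorCone_iff_isPureSpinor, isPureSpinor_iff]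

end Coordinates

/-! ### Unipotent automorphisms of the spinor cone -/

section Automorphisms

lemma spinor_ext {S : Type*} {a b : Fin 16 → S} (h0 : a 0 = b 0) (h1 : a 1 = b 1) (h2 : a 2 = b 2)
    (h3 : a 3 = b 3) (h4 : a 4 = b 4) (h5 : a 5 = b 5) (h6 : a 6 = b 6) (h7 : a 7 = b 7)
    (h8 : a 8 = b 8) (h9 : a 9 = b 9) (h10 : a 10 = b 10) (h11 : a 11 = b 11) (h12 : a 12 = b 12)
    (h13 : a 13 = b 13) (h14 : a 14 = b 14) (h15 : a 15 = b 15) : a = b := by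
  ext i
  fin_cases i <;> assumption

/-- The cyclic permutation on half-spinors as a linear equivalence. -/
def spinCycleEquiv : (Fin 16 → ℂ) ≃ₗ[ℂ] (Fin 16 → ℂ) where
  toFun := spinCycle
  invFun z := ![z 0, z 5, z 6, z 7, -z 1, z 8, z 9, -z 2, z 10, -z 3, -z 4, -z 12, -z 13, -z 14, -z 15, z 11]
  map_add' z w := by
    ext i; fin_cases i <;> simp [spinCycle] <;> ring
  map_smul' c z := by
    ext i; fin_cases i <;> simp [spinCycle]
  left_inv z := by
    ext i; fin_cases i <;> simp [spinCycle]
  right_inv z := by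
    ext i; fin_cases i <;> simp [spinCycle]

/-- The exchange of two basis vectors with their duals as a linear equivalence. -/
def spinSwapEquiv : (Fin 16 → ℂ) ≃ₗ[ℂ] (Fin 16 → ℂ) where
  toFun := spinSwap
  invFun z := ![z 1, -z 0, -z 5, -z 6, -z 7, z 2, z 3, z 4, z 15, z 14, z 13, z 12, -z 11, -z 10, -z 9, -z 8]
  map_add' z w := by
    ext i; fin_cases i <;> simp [spinSwap] <;> ring
  map_smul' c z := by
    ext i; fin_cases i <;> simp [spinSwap]
  left_inv z := by
    ext i; fin_cases i <;> simp [spinSwap]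
  right_inv z := by
    ext i; fin_cases i <;> simp [spinSwap]

/-- The multiplication of half-spinors by the exponential of a bivector `ω`. -/
def spinExp (ω : Fin 10 → ℂ) : (Fin 16 → ℂ) →ₗ[ℂ] (Fin 16 → ℂ) where
  toFun z := ![z 0,
      z 1 + ω 0 * z 0,
      z 2 + ω 1 * z 0,
      z 3 + ω 2 * z 0,
      z 4 + ω 3 * z 0,
      z 5 + ω 4 * z 0,
      z 6 + ω 5 * z 0,
      z 7 + ω 6 * z 0,
      z 8 + ω 7 * z 0,
      z 9 + ω 8 * z 0,
      z 10 + ω 9 * z 0,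
      z 11 + ω 4 * z 10 - ω 5 * z 9 + ω 6 * z 8 + ω 9 * z 5 - ω 8 * z 6 + ω 7 * z 7 + ω 4 * ω 9 * z 0 - ω 5 * ω 8 * z 0 + ω 6 * ω 7 * z 0,
      z 12 + ω 1 * z 10 - ω 2 * z 9 + ω 3 * z 8 + ω 9 * z 2 - ω 8 * z 3 + ω 7 * z 4 + ω 1 * ω 9 * z 0 - ω 2 * ω 8 * z 0 + ω 3 * ω 7 * z 0,
      z 13 + ω 0 * z 10 - ω 2 * z 7 + ω 3 * z 6 + ω 9 * z 1 - ω 6 * z 3 + ω 5 * z 4 + ω 0 * ω 9 * z 0 - ω 2 * ω 6 * z 0 + ω 3 * ω 5 * z 0,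
      z 14 + ω 0 * z 9 - ω 1 * z 7 + ω 3 * z 5 + ω 8 * z 1 - ω 6 * z 2 + ω 4 * z 4 + ω 0 * ω 8 * z 0 - ω 1 * ω 6 * z 0 + ω 3 * ω 4 * z 0,
      z 15 + ω 0 * z 8 - ω 1 * z 6 + ω 2 * z 5 + ω 7 * z 1 - ω 5 * z 2 + ω 4 * z 3 + ω 0 * ω 7 * z 0 - ω 1 * ω 5 * z 0 + ω 2 * ω 4 * z 0]
  map_add' z w := by
    apply spinor_ext <;> simp only [Pi.add_apply, Matrix.cons_val] <;> ring
  map_smul' c z := by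
    apply spinor_ext <;>
      simp only [Pi.smul_apply, smul_eq_mul, RingHom.id_apply, Matrix.cons_val] <;> ring

lemma spinExp_neg_spinExp (ω : Fin 10 → ℂ) (z : Fin 16 → ℂ) : spinExp (-ω) (spinExp ω z) = z := by
  apply spinor_ext <;>
    simp only [spinExp, LinearMap.coe_mk, AddHom.coe_mk, Pi.neg_apply, Matrix.cons_val] <;> ring

/-- The multiplication by the exponential of a bivector as a linear equivalence. -/
def spinExpEquiv (ω : Fin 10 → ℂ) : (Fin 16 → ℂ) ≃ₗ[ℂ] (Fin 16 → ℂ) :=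
  { spinExp ω with
    invFun := spinExp (-ω)
    left_inv := spinExp_neg_spinExp ω
    right_inv := fun z => by simpa using spinExp_neg_spinExp (-ω) z }

lemma SatisfiesSpinorQuadrics.spinExp (ω : Fin 10 → ℂ) {z : Fin 16 → ℂ}
    (h : SatisfiesSpinorQuadrics z) : SatisfiesSpinorQuadrics (spinExp ω z) := by
  obtain ⟨h0, h1, h2, h3, h4, h5, h6, h7, h8, h9⟩ := h
  simp only [SatisfiesSpinorQuadrics, _root_.spinExp, LinearMap.coe_mk, AddHom.coe_mk]
  simp only [Matrix.cons_val]
  exact ⟨by linear_combination h0,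
    by linear_combination h1,
    by linear_combination h2,
    by linear_combination h3,
    by linear_combination h4,
    by linear_combination h5 - ω 0 * h1 + ω 1 * h2 - ω 2 * h3 + ω 3 * h4,
    by linear_combination h6 - ω 0 * h0 + ω 4 * h2 - ω 5 * h3 + ω 6 * h4,
    by linear_combination h7 - ω 1 * h0 + ω 4 * h1 - ω 7 * h3 + ω 8 * h4,
    by linear_combination h8 - ω 2 * h0 + ω 5 * h1 - ω 7 * h2 + ω 9 * h4,
    by linear_combination h9 - ω 3 * h0 + ω 6 * h1 - ω 8 * h2 + ω 9 * h3⟩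

/-- The action of a transvection of `ℂ⁵` on half-spinors. -/
def spinTransvection (b : Fin 4 → ℂ) : (Fin 16 → ℂ) →ₗ[ℂ] (Fin 16 → ℂ) where
  toFun z := ![z 0,
      z 1,
      z 2,
      z 3,
      z 4,
      z 5 - b 0 * z 2 + b 1 * z 1,
      z 6 - b 0 * z 3 + b 2 * z 1,
      z 7 - b 0 * z 4 + b 3 * z 1,
      z 8 - b 1 * z 3 + b 2 * z 2,
      z 9 - b 1 * z 4 + b 3 * z 2,
      z 10 - b 2 * z 4 + b 3 * z 3,
      z 11 - b 0 * z 12 + b 1 * z 13 - b 2 * z 14 + b 3 * z 15,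
      z 12,
      z 13,
      z 14,
      z 15]
  map_add' z w := by
    apply spinor_ext <;> simp only [Pi.add_apply, Matrix.cons_val] <;> ring
  map_smul' c z := by
    apply spinor_ext <;>
      simp only [Pi.smul_apply, smul_eq_mul, RingHom.id_apply, Matrix.cons_val] <;> ring

lemma spinTransvection_neg_spinTransvection (b : Fin 4 → ℂ) (z : Fin 16 → ℂ) :
    spinTransvection (-b) (spinTransvection b z) = z := by
  apply spinor_ext <;>
    simp only [spinTransvection, LinearMap.coe_mk, AddHom.coe_mk, Pi.neg_apply, Matrix.cons_val] <;> ring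

/-- The action of a transvection on half-spinors as a linear equivalence. -/
def spinTransvectionEquiv (b : Fin 4 → ℂ) : (Fin 16 → ℂ) ≃ₗ[ℂ] (Fin 16 → ℂ) :=
  { spinTransvection b with
    invFun := spinTransvection (-b)
    left_inv := spinTransvection_neg_spinTransvection b
    right_inv := fun z => by simpa using spinTransvection_neg_spinTransvection (-b) z }

lemma SatisfiesSpinorQuadrics.spinTransvection (b : Fin 4 → ℂ) {z : Fin 16 → ℂ}
    (h : SatisfiesSpinorQuadrics z) : SatisfiesSpinorQuadrics (spinTransvection b z) := by
  obtain ⟨h0, h1, h2, h3, h4, h5, h6, h7, h8, h9⟩ := h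
  simp only [SatisfiesSpinorQuadrics, _root_.spinTransvection, LinearMap.coe_mk, AddHom.coe_mk]
  simp only [Matrix.cons_val]
  exact ⟨by linear_combination h0 - b 0 * h1 + b 1 * h2 - b 2 * h3 + b 3 * h4,
    by linear_combination h1,
    by linear_combination h2,
    by linear_combination h3,
    by linear_combination h4,
    by linear_combination h5,
    by linear_combination h6 - b 0 * h5,
    by linear_combination h7 - b 1 * h5,
    by linear_combination h8 - b 2 * h5,
    by linear_combination h9 - b 3 * h5⟩

/-- A pure spinor with x₀ ≠ 0 is x₀ exp(x/x₀), so exp(-x/x₀) followed by division by x₀ brings it to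
e_∅. -/
lemma spinExp_eq_single {z : Fin 16 → ℂ} {c : ℂ} (hc : c * z 0 = 1)
    (h : SatisfiesSpinorQuadrics z) :
    c • spinExp ![-c * z 1, -c * z 2, -c * z 3, -c * z 4, -c * z 5, -c * z 6, -c * z 7, -c * z 8, -c * z 9, -c * z 10] z = Pi.single 0 1 := by
  obtain ⟨h0, h1, h2, h3, h4, -⟩ := h
  have e : (Pi.single 0 1 : Fin 16 → ℂ) = ![1, 0, 0, 0, 0, 0, 0, 0, 0, 0, 0, 0, 0, 0, 0, 0] := by
    apply spinor_ext <;> rfl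
  rw [e]
  simp only [spinExp, LinearMap.coe_mk, AddHom.coe_mk]
  apply spinor_ext <;> simp only [Pi.smul_apply, smul_eq_mul, Matrix.cons_val]
  · linear_combination hc
  · linear_combination -c * z 1 * hc
  · linear_combination -c * z 2 * hc
  · linear_combination -c * z 3 * hc
  · linear_combination -c * z 4 * hc
  · linear_combination -c * z 5 * hc
  · linear_combination -c * z 6 * hc
  · linear_combination -c * z 7 * hc
  · linear_combination -c * z 8 * hc
  · linear_combination -c * z 9 * hc
  · linear_combination -c * z 10 * hc
  · linear_combination c ^ 2 * h0 + (c ^ 2 * (z 10 * z 5 - z 6 * z 9 + z 7 * z 8) - c * z 11) * hc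
  · linear_combination c ^ 2 * h1 + (c ^ 2 * (z 10 * z 2 - z 3 * z 9 + z 4 * z 8) - c * z 12) * hc
  · linear_combination c ^ 2 * h2 + (c ^ 2 * (z 1 * z 10 - z 3 * z 7 + z 4 * z 6) - c * z 13) * hc
  · linear_combination c ^ 2 * h3 + (c ^ 2 * (z 1 * z 9 - z 2 * z 7 + z 4 * z 5) - c * z 14) * hc
  · linear_combination c ^ 2 * h4 + (c ^ 2 * (z 1 * z 8 - z 2 * z 6 + z 3 * z 5) - c * z 15) * hc

lemma SatisfiesSpinorQuadrics.smul (c : ℂ) {z : Fin 16 → ℂ}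
    (h : SatisfiesSpinorQuadrics z) : SatisfiesSpinorQuadrics (c • z) := by
  obtain ⟨h0, h1, h2, h3, h4, h5, h6, h7, h8, h9⟩ := h
  simp only [SatisfiesSpinorQuadrics, Pi.smul_apply, smul_eq_mul]
  exact ⟨by linear_combination c ^ 2 * h0,
    by linear_combination c ^ 2 * h1,
    by linear_combination c ^ 2 * h2,
    by linear_combination c ^ 2 * h3,
    by linear_combination c ^ 2 * h4,
    by linear_combination c ^ 2 * h5,
    by linear_combination c ^ 2 * h6,
    by linear_combination c ^ 2 * h7,
    by linear_combination c ^ 2 * h8,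
    by linear_combination c ^ 2 * h9⟩

/-- A linear equivalence of the numbered coordinates as one of the half-spin space. -/
noncomputable def coordsConj (g : (Fin 16 → ℂ) ≃ₗ[ℂ] (Fin 16 → ℂ)) : HalfSpin ≃ₗ[ℂ] HalfSpin :=
  coords.trans (g.trans coords.symm)

lemma coordsConj_coords_symm (g : (Fin 16 → ℂ) ≃ₗ[ℂ] (Fin 16 → ℂ)) (z : Fin 16 → ℂ) :
    coordsConj g (coords.symm z) = coords.symm (g z) := by
  simp [coordsConj]

lemma coords_coordsConj (g : (Fin 16 → ℂ) ≃ₗ[ℂ] (Fin 16 → ℂ)) (ψ : HalfSpin) :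
    coords (coordsConj g ψ) = g (coords ψ) := by
  simp [coordsConj]

lemma coordsConj_mem_spinorCone {g : (Fin 16 → ℂ) ≃ₗ[ℂ] (Fin 16 → ℂ)}
    (h1 : ∀ z, SatisfiesSpinorQuadrics z → SatisfiesSpinorQuadrics (g z))
    (h2 : ∀ z, SatisfiesSpinorQuadrics z → SatisfiesSpinorQuadrics (g.symm z)) (ψ : HalfSpin) :
    coordsConj g ψ ∈ spinorCone ↔ ψ ∈ spinorCone := by
  rw [mem_spinorCone_iff, mem_spinorCone_iff, coords_coordsConj]
  exact ⟨fun h => by simpa using h2 _ h, h1 _⟩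

end Automorphisms

/-! ### Reduction to the base point e_∅ -/

section Transport

/-- The linear section of the spinor variety by `ℙ(Λ)` is five-dimensional with a node at `[p]`. -/
structure IsNodalSection (Λ : Submodule ℂ HalfSpin) (p : HalfSpin) : Prop where
  finrank_eq : Module.finrank ℂ Λ = 11
  dim_eq : ringKrullDim (MvPolynomial EvenSubset ℂ ⧸ sectionIdeal Λ) = 5 + 1
  mem_spinorCone : p ∈ spinorCone
  mem : p ∈ Λ
  isNode : IsNode 5 (sectionIdeal Λ) p

/-- The projection from `[p]` is projectively equivalent to a quadric section of `G(2,5)`. -/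
def ProjectsToQuadricSection (Λ : Submodule ℂ HalfSpin) (p : HalfSpin)
    (π : HalfSpin →ₗ[ℂ] (Fin 10 → ℂ)) : Prop :=
  ∃ (A : (Fin 10 → ℂ) ≃ₗ[ℂ] (PluckerIndex → ℂ)) (q : MvPolynomial PluckerIndex ℂ),
    q.IsHomogeneous 2 ∧ q ∉ vanishingIdeal ℂ grassmannCone ∧
    A '' projectedCone Λ p π = grassmannCone ∩ {w | eval w q = 0} ∧
    (projectedIdeal Λ π).comap (linearPullback A.toLinearMap) =
      vanishingIdeal ℂ grassmannCone ⊔ Ideal.span {q}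

/-- If the section is nodal at `[p]` then its projections from `[p]` are quadric sections. -/
def NodalProjectionProperty (Λ : Submodule ℂ HalfSpin) (p : HalfSpin) : Prop :=
  IsNodalSection Λ p → ∀ π : HalfSpin →ₗ[ℂ] (Fin 10 → ℂ),
    Λ ⊓ LinearMap.ker π = Submodule.span ℂ {p} → ProjectsToQuadricSection Λ p π

lemma sectionIdeal_map {g : HalfSpin ≃ₗ[ℂ] HalfSpin}
    (hg : ∀ ψ, g ψ ∈ spinorCone ↔ ψ ∈ spinorCone) (Λ : Submodule ℂ HalfSpin) :
    sectionIdeal (Λ.map g.toLinearMap) = (sectionIdeal Λ).comap (linearPullback g.toLinearMap) := by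
  have himg : g.toLinearMap '' spinorCone = spinorCone := by
    ext ψ
    constructor
    · rintro ⟨φ, hφ, rfl⟩
      exact (hg φ).2 hφ
    · intro h
      exact ⟨g.symm ψ, by rwa [← hg, g.apply_symm_apply], g.apply_symm_apply ψ⟩
  rw [sectionIdeal, sectionIdeal, comap_sup_linearPullback, vanishingIdeal_comap,
    vanishingIdeal_comap, himg, Submodule.map_coe]

lemma IsNodalSection.map {g : HalfSpin ≃ₗ[ℂ] HalfSpin}
    (hg : ∀ ψ, g ψ ∈ spinorCone ↔ ψ ∈ spinorCone) {Λ : Submodule ℂ HalfSpin} {p : HalfSpin}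
    (h : IsNodalSection Λ p) : IsNodalSection (Λ.map g.toLinearMap) (g p) where
  finrank_eq := (LinearEquiv.finrank_map_eq g Λ).trans h.finrank_eq
  dim_eq := by rw [sectionIdeal_map hg, ringKrullDim_quotient_comap, h.dim_eq]
  mem_spinorCone := (hg p).2 h.mem_spinorCone
  mem := Submodule.mem_map_of_mem h.mem
  isNode := by rw [sectionIdeal_map hg]; exact h.isNode.comap g

/-- Precomposing π with the inverse of g leaves both the projected cone and the projected ideal
unchanged. -/
lemma NodalProjectionProperty.of_map {g : HalfSpin ≃ₗ[ℂ] HalfSpin}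
    (hg : ∀ ψ, g ψ ∈ spinorCone ↔ ψ ∈ spinorCone) {Λ : Submodule ℂ HalfSpin} {p : HalfSpin}
    (h : NodalProjectionProperty (Λ.map g.toLinearMap) (g p)) : NodalProjectionProperty Λ p := by
  intro hs π hπ
  have hmem : ∀ x, g x ∈ Submodule.span ℂ {g p} ↔ x ∈ Submodule.span ℂ {p} := by
    intro x
    rw [Submodule.mem_span_singleton, Submodule.mem_span_singleton]
    simp only [← map_smul, g.injective.eq_iff]
  have hmap : ∀ x, g x ∈ Λ.map g.toLinearMap ↔ x ∈ Λ := fun x =>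
    ⟨fun ⟨y, hy, h⟩ => g.injective h ▸ hy, fun h => ⟨x, h, rfl⟩⟩
  obtain ⟨A, q, hq, hq', hset, hideal⟩ := h (hs.map hg) (π ∘ₗ g.symm.toLinearMap) (by
    ext y
    obtain ⟨x, rfl⟩ := g.surjective y
    rw [hmem, ← hπ, Submodule.mem_inf, Submodule.mem_inf, hmap]
    simp)
  refine ⟨A, q, hq, hq', ?_, ?_⟩
  · rw [← hset]
    congr 1
    unfold projectedCone
    congr 2
    ext y
    constructor
    · rintro ⟨x, ⟨⟨h1, h2⟩, h3⟩, rfl⟩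
      exact ⟨g x, ⟨⟨(hg x).2 h1, (hmap x).2 h2⟩, fun h => h3 ((hmem x).1 h)⟩, by simp⟩
    · rintro ⟨x, ⟨⟨h1, h2⟩, h3⟩, rfl⟩
      obtain ⟨x, rfl⟩ := g.surjective x
      exact ⟨x, ⟨⟨(hg x).1 h1, (hmap x).1 h2⟩, fun h => h3 ((hmem x).2 h)⟩, by simp⟩
  · have hcomp : (π ∘ₗ g.symm.toLinearMap) ∘ₗ g.toLinearMap = π :=
      LinearMap.ext fun x => by simp
    have : projectedIdeal (Λ.map g.toLinearMap) (π ∘ₗ g.symm.toLinearMap) = projectedIdeal Λ π := by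
      ext f
      rw [projectedIdeal, projectedIdeal, sectionIdeal_map hg, Ideal.mem_comap, Ideal.mem_comap,
        Ideal.mem_comap, linearPullback_linearPullback, hcomp]
    rw [← hideal, this]

/-- The highest weight vector `e_∅` of the half-spin space. -/
noncomputable def baseSpinor : HalfSpin := coords.symm (Pi.single 0 1)

lemma nodalProjectionProperty_of_baseSpinor (H : ∀ Λ, NodalProjectionProperty Λ baseSpinor)
    (Λ : Submodule ℂ HalfSpin) (p : HalfSpin) : NodalProjectionProperty Λ p := by
  by_cases hp : p = 0
  · intro hs
    exact absurd hp hs.isNode.1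
  have key : ∀ z : Fin 16 → ℂ, z ≠ 0 → ∀ Λ, NodalProjectionProperty Λ (coords.symm z) := by
    refine spinor_induction (fun z h Λ => ?_) (fun z h Λ => ?_) (fun z hz Λ => ?_)
    · refine NodalProjectionProperty.of_map (g := coordsConj spinCycleEquiv)
        (coordsConj_mem_spinorCone (fun z => (satisfiesSpinorQuadrics_cycle z).2) fun z hz => ?_) ?_
      · rw [← satisfiesSpinorQuadrics_cycle]
        change SatisfiesSpinorQuadrics (spinCycleEquiv (spinCycleEquiv.symm z))
        rwa [LinearEquiv.apply_symm_apply]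
      · rw [coordsConj_coords_symm]
        exact h _
    · refine NodalProjectionProperty.of_map (g := coordsConj spinSwapEquiv)
        (coordsConj_mem_spinorCone (fun z => (satisfiesSpinorQuadrics_swap z).2) fun z hz => ?_) ?_
      · rw [← satisfiesSpinorQuadrics_swap]
        change SatisfiesSpinorQuadrics (spinSwapEquiv (spinSwapEquiv.symm z))
        rwa [LinearEquiv.apply_symm_apply]
      · rw [coordsConj_coords_symm]
        exact h _
    -- Only in the chart x₀ ≠ 0 is purity of p needed; it is read off from the nodal hypothesis.
    · intro hs
      have hq := (mem_spinorCone_iff _).1 hs.mem_spinorCone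
      rw [LinearEquiv.apply_symm_apply] at hq
      revert hs
      refine NodalProjectionProperty.of_map (g := coordsConj
        (spinExpEquiv ![-(z 0)⁻¹ * z 1, -(z 0)⁻¹ * z 2, -(z 0)⁻¹ * z 3, -(z 0)⁻¹ * z 4, -(z 0)⁻¹ * z 5, -(z 0)⁻¹ * z 6, -(z 0)⁻¹ * z 7, -(z 0)⁻¹ * z 8, -(z 0)⁻¹ * z 9, -(z 0)⁻¹ * z 10]))
        (coordsConj_mem_spinorCone (fun z hz => hz.spinExp _) fun z hz => hz.spinExp _) ?_
      refine NodalProjectionProperty.of_map (g := coordsConj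
        (LinearEquiv.smulOfNeZero ℂ _ (z 0)⁻¹ (inv_ne_zero hz)))
        (coordsConj_mem_spinorCone (fun z hz => hz.smul _) fun z hz => ?_) ?_
      · exact hz.smul _
      · rw [coordsConj_coords_symm, coordsConj_coords_symm]
        convert H _ using 1
        exact congrArg coords.symm (spinExp_eq_single (inv_mul_cancel₀ hz) hq)
  have := key (coords p) (by simpa using hp) Λ
  rwa [LinearEquiv.symm_apply_apply] at this

end Transport

/-! ### The tangent cone of the section at e_∅ -/

section TangentSpace

lemma coeff_one_alongLine_add {σ : Type*} (p a b : σ → ℂ) (f : MvPolynomial σ ℂ) :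
    (alongLine p (a + b) f).coeff 1 = (alongLine p a f).coeff 1 + (alongLine p b f).coeff 1 := by
  induction f using MvPolynomial.induction_on with
  | C c => simp [alongLine]
  | add f g hf hg => simp only [map_add, Polynomial.coeff_add, hf, hg]; ring
  | mul_X f i hf =>
    simp only [map_mul, Polynomial.mul_coeff_one, hf, coeff_zero_alongLine]
    simp [alongLine]
    ring

lemma coeff_one_alongLine_smul {σ : Type*} (p : σ → ℂ) (c : ℂ) (a : σ → ℂ)
    (f : MvPolynomial σ ℂ) :
    (alongLine p (c • a) f).coeff 1 = c * (alongLine p a f).coeff 1 := by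
  induction f using MvPolynomial.induction_on with
  | C c => simp [alongLine]
  | add f g hf hg => simp only [map_add, Polynomial.coeff_add, hf, hg]; ring
  | mul_X f i hf =>
    simp only [map_mul, Polynomial.mul_coeff_one, hf, coeff_zero_alongLine]
    simp [alongLine]
    ring

/-- The equations of the spinor variety as polynomials. -/
noncomputable def spinorQuadric : Fin 10 → MvPolynomial EvenSubset ℂ :=
  ![X (evenSet 0) * X (evenSet 11) - X (evenSet 10) * X (evenSet 5) + X (evenSet 6) * X (evenSet 9) - X (evenSet 7) * X (evenSet 8),
    X (evenSet 0) * X (evenSet 12) - X (evenSet 10) * X (evenSet 2) + X (evenSet 3) * X (evenSet 9) - X (evenSet 4) * X (evenSet 8),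
    X (evenSet 0) * X (evenSet 13) - X (evenSet 1) * X (evenSet 10) + X (evenSet 3) * X (evenSet 7) - X (evenSet 4) * X (evenSet 6),
    X (evenSet 0) * X (evenSet 14) - X (evenSet 1) * X (evenSet 9) + X (evenSet 2) * X (evenSet 7) - X (evenSet 4) * X (evenSet 5),
    X (evenSet 0) * X (evenSet 15) - X (evenSet 1) * X (evenSet 8) + X (evenSet 2) * X (evenSet 6) - X (evenSet 3) * X (evenSet 5),
    -X (evenSet 1) * X (evenSet 12) + X (evenSet 13) * X (evenSet 2) - X (evenSet 14) * X (evenSet 3) + X (evenSet 15) * X (evenSet 4),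
    -X (evenSet 1) * X (evenSet 11) + X (evenSet 13) * X (evenSet 5) - X (evenSet 14) * X (evenSet 6) + X (evenSet 15) * X (evenSet 7),
    -X (evenSet 11) * X (evenSet 2) + X (evenSet 12) * X (evenSet 5) - X (evenSet 14) * X (evenSet 8) + X (evenSet 15) * X (evenSet 9),
    -X (evenSet 11) * X (evenSet 3) + X (evenSet 12) * X (evenSet 6) - X (evenSet 13) * X (evenSet 8) + X (evenSet 10) * X (evenSet 15),
    -X (evenSet 11) * X (evenSet 4) + X (evenSet 12) * X (evenSet 7) - X (evenSet 13) * X (evenSet 9) + X (evenSet 10) * X (evenSet 14)]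

lemma spinorQuadric_mem (k : Fin 10) : spinorQuadric k ∈ vanishingIdeal ℂ spinorCone := by
  intro ψ hψ
  obtain ⟨h0, h1, h2, h3, h4, h5, h6, h7, h8, h9⟩ := (mem_spinorCone_iff ψ).1 hψ
  simp only [coords_apply] at h0 h1 h2 h3 h4 h5 h6 h7 h8 h9
  fin_cases k
  · simpa [spinorQuadric] using h0
  · simpa [spinorQuadric] using h1
  · simpa [spinorQuadric] using h2
  · simpa [spinorQuadric] using h3
  · simpa [spinorQuadric] using h4
  · simpa [spinorQuadric] using h5
  · simpa [spinorQuadric] using h6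
  · simpa [spinorQuadric] using h7
  · simpa [spinorQuadric] using h8
  · simpa [spinorQuadric] using h9

/-- The parametrisation of the spinor variety by skew-symmetric matrices, homogenised by `s`. -/
def spinorPoint {R : Type*} [CommRing R] (s : R) (x : Fin 10 → R) : Fin 16 → R :=
  ![s ^ 2, s * x 0, s * x 1, s * x 2, s * x 3, s * x 4, s * x 5, s * x 6, s * x 7, s * x 8, s * x 9,
    x 9 * x 4 - x 5 * x 8 + x 6 * x 7,
    x 9 * x 1 - x 2 * x 8 + x 3 * x 7,
    x 0 * x 9 - x 2 * x 6 + x 3 * x 5,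
    x 0 * x 8 - x 1 * x 6 + x 3 * x 4,
    x 0 * x 7 - x 1 * x 5 + x 2 * x 4]

lemma satisfiesSpinorQuadrics_spinorPoint {R : Type*} [CommRing R] (s : R) (x : Fin 10 → R) :
    SatisfiesSpinorQuadrics (spinorPoint s x) := by
  simp only [SatisfiesSpinorQuadrics, spinorPoint]
  simp only [Matrix.cons_val]
  refine ⟨?_, ?_, ?_, ?_, ?_, ?_, ?_, ?_, ?_, ?_⟩ <;> ring

lemma baseSpinor_evenSet (i : Fin 16) : baseSpinor (evenSet i) = if i = 0 then 1 else 0 := by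
  rw [baseSpinor, coords_symm_evenSet, Pi.single_apply]

lemma evenSet_surjective (T : EvenSubset) : ∃ i, evenSet i = T := evenSet_bijective.2 T

/-- Curves on the spinor variety through the base point with given second-order jets. -/
lemma exists_spinorCurve (A B : HalfSpin) (hA : ∀ m : Fin 16, 11 ≤ m → coords A m = 0)
    (hB0 : coords B 11 = coords A 10 * coords A 5 - coords A 6 * coords A 9 + coords A 7 * coords A 8)
    (hB1 : coords B 12 = coords A 10 * coords A 2 - coords A 3 * coords A 9 + coords A 4 * coords A 8)
    (hB2 : coords B 13 = coords A 1 * coords A 10 - coords A 3 * coords A 7 + coords A 4 * coords A 6)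
    (hB3 : coords B 14 = coords A 1 * coords A 9 - coords A 2 * coords A 7 + coords A 4 * coords A 5)
    (hB4 : coords B 15 = coords A 1 * coords A 8 - coords A 2 * coords A 6 + coords A 3 * coords A 5) :
    ∃ γ : EvenSubset → Polynomial ℂ, (∀ t, (fun i => (γ i).eval t) ∈ spinorCone) ∧
      (∀ i, (γ i).coeff 0 = baseSpinor i) ∧ (∀ i, (γ i).coeff 1 = A i) ∧
      ∀ i, (γ i).coeff 2 = B i := by
  -- These choices make s² = 1 + A₀t + B₀t² + … and give s·xᵢ the 2-jet Aᵢt + Bᵢt². The Pfaffians of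
  -- x start at order two with those of A, whence the conditions on A and B in degree four.
  set α : ℂ := coords A 0 / 2
  set β : ℂ := (coords B 0 - α ^ 2) / 2
  set s : Polynomial ℂ := 1 + Polynomial.C α * Polynomial.X + Polynomial.C β * Polynomial.X ^ 2
    with hs
  set x : Fin 10 → Polynomial ℂ := fun i =>
    Polynomial.C (coords A (Fin.castAdd 5 i.succ)) * Polynomial.X +
      Polynomial.C (coords B (Fin.castAdd 5 i.succ) - α * coords A (Fin.castAdd 5 i.succ)) *
        Polynomial.X ^ 2 with hx
  have s0 : s.coeff 0 = 1 := by simp [hs]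
  have s1 : s.coeff 1 = α := by simp [hs, Polynomial.coeff_one, Polynomial.coeff_X_pow]
  have s2 : s.coeff 2 = β := by simp [hs, Polynomial.coeff_one]
  have x0 : ∀ i, (x i).coeff 0 = 0 := fun i => by simp [hx]
  have x1 : ∀ i, (x i).coeff 1 = coords A (Fin.castAdd 5 i.succ) := fun i => by
    simp [hx, Polynomial.coeff_X_pow, -map_sub]
  have x2 : ∀ i, (x i).coeff 2 =
      coords B (Fin.castAdd 5 i.succ) - α * coords A (Fin.castAdd 5 i.succ) := fun i => by
    simp [hx, -map_sub]
  have hα : 2 * α = coords A 0 := by simp only [α]; ring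
  have hβ : 2 * β = coords B 0 - α ^ 2 := by simp only [β]; ring
  refine ⟨fun i => spinorPoint s x (evenEquiv.symm i), fun t => ?_, fun i => ?_, fun i => ?_,
    fun i => ?_⟩
  · rw [mem_spinorCone_iff]
    convert satisfiesSpinorQuadrics_spinorPoint (s.eval t) (fun i => (x i).eval t) using 1
    ext i
    simp only [coords_apply, evenEquiv_symm_evenSet]
    revert i
    refine funext_iff.1 ?_
    apply spinor_ext <;> simp [spinorPoint]
  · obtain ⟨i, rfl⟩ := evenSet_surjective i
    simp only [evenEquiv_symm_evenSet, baseSpinor_evenSet]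
    fin_cases i <;> simp [spinorPoint, pow_two, Polynomial.mul_coeff_zero, s0, x0]
  · obtain ⟨i, rfl⟩ := evenSet_surjective i
    simp only [evenEquiv_symm_evenSet, ← coords_apply]
    revert i
    refine funext_iff.1 ?_
    apply spinor_ext
    · simp [spinorPoint, pow_two, Polynomial.mul_coeff_one, s0, s1, ← hα]
      ring
    · simp [spinorPoint, Polynomial.mul_coeff_one, s0, x0, x1]
    · simp [spinorPoint, Polynomial.mul_coeff_one, s0, x0, x1]
    · simp [spinorPoint, Polynomial.mul_coeff_one, s0, x0, x1]
    · simp [spinorPoint, Polynomial.mul_coeff_one, s0, x0, x1]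
    · simp [spinorPoint, Polynomial.mul_coeff_one, s0, x0, x1]
    · simp [spinorPoint, Polynomial.mul_coeff_one, s0, x0, x1]
    · simp [spinorPoint, Polynomial.mul_coeff_one, s0, x0, x1]
    · simp [spinorPoint, Polynomial.mul_coeff_one, s0, x0, x1]
    · simp [spinorPoint, Polynomial.mul_coeff_one, s0, x0, x1]
    · simp [spinorPoint, Polynomial.mul_coeff_one, s0, x0, x1]
    all_goals
      rw [hA _ (by decide)]
      simp [spinorPoint, Polynomial.mul_coeff_one, x0, x1]
  · obtain ⟨i, rfl⟩ := evenSet_surjective i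
    simp only [evenEquiv_symm_evenSet, ← coords_apply]
    revert i
    refine funext_iff.1 ?_
    apply spinor_ext
    · simp [spinorPoint, pow_two, coeff_two_mul, s0, s1, s2]
      linear_combination hβ
    · simp [spinorPoint, coeff_two_mul, s0, s1, x0, x1, x2]
    · simp [spinorPoint, coeff_two_mul, s0, s1, x0, x1, x2]
    · simp [spinorPoint, coeff_two_mul, s0, s1, x0, x1, x2]
    · simp [spinorPoint, coeff_two_mul, s0, s1, x0, x1, x2]
    · simp [spinorPoint, coeff_two_mul, s0, s1, x0, x1, x2]
    · simp [spinorPoint, coeff_two_mul, s0, s1, x0, x1, x2]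
    · simp [spinorPoint, coeff_two_mul, s0, s1, x0, x1, x2]
    · simp [spinorPoint, coeff_two_mul, s0, s1, x0, x1, x2]
    · simp [spinorPoint, coeff_two_mul, s0, s1, x0, x1, x2]
    · simp [spinorPoint, coeff_two_mul, s0, s1, x0, x1, x2]
    · rw [hB0]
      simp [spinorPoint, coeff_two_mul, x0, x1]
    · rw [hB1]
      simp [spinorPoint, coeff_two_mul, x0, x1]
    · rw [hB2]
      simp [spinorPoint, coeff_two_mul, x0, x1]
    · rw [hB3]
      simp [spinorPoint, coeff_two_mul, x0, x1]
    · rw [hB4]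
      simp [spinorPoint, coeff_two_mul, x0, x1]

lemma exists_halfSpin_coords (y : Fin 5 → ℂ) : ∃ B : HalfSpin,
    coords B 11 = y 0 ∧ coords B 12 = y 1 ∧ coords B 13 = y 2 ∧ coords B 14 = y 3 ∧
      coords B 15 = y 4 := by
  refine ⟨coords.symm ![0, 0, 0, 0, 0, 0, 0, 0, 0, 0, 0, y 0, y 1, y 2, y 3, y 4], ?_⟩
  simp only [LinearEquiv.apply_symm_apply]
  exact ⟨rfl, rfl, rfl, rfl, rfl⟩

/-- The affine tangent space of the spinor variety at the base point is `{Y = 0}`. -/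
lemma coeff_one_alongLine_baseSpinor {A : HalfSpin} (hA : ∀ m : Fin 16, 11 ≤ m → coords A m = 0)
    {f : MvPolynomial EvenSubset ℂ} (hf : f ∈ vanishingIdeal ℂ spinorCone) :
    (alongLine baseSpinor A f).coeff 1 = 0 := by
  obtain ⟨B, h0, h1, h2, h3, h4⟩ := exists_halfSpin_coords ![
    coords A 10 * coords A 5 - coords A 6 * coords A 9 + coords A 7 * coords A 8,
    coords A 10 * coords A 2 - coords A 3 * coords A 9 + coords A 4 * coords A 8,
    coords A 1 * coords A 10 - coords A 3 * coords A 7 + coords A 4 * coords A 6,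
    coords A 1 * coords A 9 - coords A 2 * coords A 7 + coords A 4 * coords A 5,
    coords A 1 * coords A 8 - coords A 2 * coords A 6 + coords A 3 * coords A 5]
  obtain ⟨γ, hγ, hγ0, hγ1, hγ2⟩ := exists_spinorCurve A B hA h0 h1 h2 h3 h4
  rw [← (coeff_aeval_curve γ hγ0 hγ1 hγ2 f).2.1, aeval_curve_eq_zero hγ hf, Polynomial.coeff_zero]

lemma baseSpinor_add_smul_mem {Λ : Submodule ℂ HalfSpin} (hp : baseSpinor ∈ Λ) {x : HalfSpin}
    (hx : x ∈ Λ) (t : ℂ) : baseSpinor + t • x ∈ (Λ : Set HalfSpin) :=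
  Λ.add_mem hp (Λ.smul_mem t hx)

lemma eval_eq_zero_of_mem_sectionIdeal {Λ : Submodule ℂ HalfSpin} {ψ : HalfSpin}
    (h1 : ψ ∈ spinorCone) (h2 : ψ ∈ Λ) {f : MvPolynomial EvenSubset ℂ} (hf : f ∈ sectionIdeal Λ) :
    eval ψ f = 0 := by
  obtain ⟨u, hu, v, hv, rfl⟩ := Submodule.mem_sup.1 hf
  rw [← aeval_eq_eval, map_add, hu ψ h1, hv ψ h2, add_zero]

lemma coords_baseSpinor : coords baseSpinor = Pi.single 0 1 := by
  simp [baseSpinor]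

/-- The linear parts at e_∅ of the first five quadrics are the five coordinates Y. Conversely every
vector with Y = 0 is the velocity of a curve on the cone. -/
lemma forall_coeff_one_iff {Λ : Submodule ℂ HalfSpin} (hp : baseSpinor ∈ Λ) (x : HalfSpin) :
    (∀ f ∈ sectionIdeal Λ, (alongLine baseSpinor x f).coeff 1 = 0) ↔
      x ∈ Λ ∧ ∀ m : Fin 16, 11 ≤ m → coords x m = 0 := by
  constructor
  · intro h
    constructor
    · by_contra hx
      obtain ⟨ℓ, hℓ, hΛ⟩ := Submodule.exists_le_ker_of_notMem hx
      have := h _ (Ideal.mem_sup_right (linearForm_mem_vanishingIdeal hΛ))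
      rw [alongLine_linearForm] at this
      simp at this
      exact hℓ this
    · have key := fun k => h _ (Ideal.mem_sup_left (spinorQuadric_mem k))
      have k0 := key 0
      simp [spinorQuadric, alongLine, baseSpinor_evenSet, Polynomial.mul_coeff_one, Polynomial.coeff_X, Polynomial.coeff_C] at k0
      have k1 := key 1
      simp [spinorQuadric, alongLine, baseSpinor_evenSet, Polynomial.mul_coeff_one, Polynomial.coeff_X, Polynomial.coeff_C] at k1
      have k2 := key 2
      simp [spinorQuadric, alongLine, baseSpinor_evenSet, Polynomial.mul_coeff_one, Polynomial.coeff_X, Polynomial.coeff_C] at k2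
      have k3 := key 3
      simp [spinorQuadric, alongLine, baseSpinor_evenSet, Polynomial.mul_coeff_one, Polynomial.coeff_X, Polynomial.coeff_C] at k3
      have k4 := key 4
      simp [spinorQuadric, alongLine, baseSpinor_evenSet, Polynomial.mul_coeff_one, Polynomial.coeff_X, Polynomial.coeff_C] at k4
      intro m hm
      rw [coords_apply]
      fin_cases m <;> first | exact absurd hm (by decide) | assumption
  · rintro ⟨hx, hY⟩ f hf
    obtain ⟨u, hu, v, hv, rfl⟩ := Submodule.mem_sup.1 hf
    rw [map_add, alongLine_eq_zero (baseSpinor_add_smul_mem hp hx) hv, add_zero]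
    exact coeff_one_alongLine_baseSpinor hY hu

/-- The consequences of the nodal hypothesis at the base point. -/
lemma IsNodalSection.exists_tangentSpace {Λ : Submodule ℂ HalfSpin}
    (h : IsNodalSection Λ baseSpinor) :
    ∃ T : Submodule ℂ HalfSpin, Module.finrank ℂ T = 7 ∧
      (∀ x, x ∈ T ↔ x ∈ Λ ∧ ∀ m : Fin 16, 11 ≤ m → coords x m = 0) ∧
      ∀ G : HalfSpin → ℂ,
        (∀ f ∈ sectionIdeal Λ, (∀ x, (alongLine baseSpinor x f).coeff 1 = 0) →
          ∃ c, ∀ x ∈ T, (alongLine baseSpinor x f).coeff 2 = c * G x) →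
        ∀ x ∈ T, (∀ y ∈ T, G (x + y) = G x + G y) → x ∈ Submodule.span ℂ {baseSpinor} := by
  obtain ⟨T, hT, hT1, hT2⟩ := h.isNode.exists_tangentSpace fun f hf =>
    eval_eq_zero_of_mem_sectionIdeal h.mem_spinorCone h.mem hf
  exact ⟨T, hT, fun x => (hT1 x).trans (forall_coeff_one_iff h.mem x), hT2⟩

/-- The five coordinates that vanish on the tangent space at the base point. -/
noncomputable def topCoords : HalfSpin →ₗ[ℂ] (Fin 5 → ℂ) :=
  LinearMap.pi fun m => LinearMap.proj (evenSet (Fin.natAdd 11 m))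

lemma topCoords_eq_zero_iff (x : HalfSpin) :
    topCoords x = 0 ↔ ∀ m : Fin 16, 11 ≤ m → coords x m = 0 := by
  constructor
  · intro h m hm
    obtain ⟨k, rfl⟩ : ∃ k : Fin 5, m = Fin.natAdd 11 k :=
      ⟨⟨m.val - 11, by omega⟩, by ext; simp [Fin.le_def] at hm ⊢; omega⟩
    exact congrFun h k
  · intro h
    ext k
    exact h (Fin.natAdd 11 k) (by simp [Fin.le_def])

lemma finrank_range_topCoords {Λ T : Submodule ℂ HalfSpin} (hΛ : Module.finrank ℂ Λ = 11)
    (hT : Module.finrank ℂ T = 7)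
    (hT1 : ∀ x, x ∈ T ↔ x ∈ Λ ∧ ∀ m : Fin 16, 11 ≤ m → coords x m = 0) :
    Module.finrank ℂ (Λ.map topCoords) = 4 := by
  have h1 := LinearMap.finrank_range_add_finrank_ker (topCoords.domRestrict Λ)
  have hker : (LinearMap.ker (topCoords.domRestrict Λ)).map Λ.subtype = T := by
    ext x
    rw [hT1, ← topCoords_eq_zero_iff]
    simp only [Submodule.mem_map, LinearMap.mem_ker, LinearMap.domRestrict_apply,
      Submodule.subtype_apply, Subtype.exists, exists_and_right, exists_eq_right]
    exact ⟨fun ⟨a, b⟩ => ⟨a, b⟩, fun ⟨a, b⟩ => ⟨a, b⟩⟩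
  have h2 : Module.finrank ℂ (LinearMap.ker (topCoords.domRestrict Λ)) = 7 := by
    rw [← hT, ← hker]
    exact (LinearEquiv.finrank_eq (Submodule.equivMapOfInjective _ Λ.injective_subtype _))
  rw [LinearMap.range_domRestrict, h2, hΛ] at h1
  omega

/-- The Pfaffian that cuts out the tangent cone of the section at the base point. -/
noncomputable def nodePfaffian (x : HalfSpin) : ℂ :=
  coords x 10 * coords x 5 - coords x 6 * coords x 9 + coords x 7 * coords x 8

/-- A section contained in `{Y₀ = 0}` is determined by `x₀`, the `xᵢⱼ` with `i, j ≠ 0`, and `Y`. -/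
lemma IsNodalSection.eq_zero_of_coords {Λ : Submodule ℂ HalfSpin}
    (h : IsNodalSection Λ baseSpinor) (hΛ : ∀ x ∈ Λ, coords x 11 = 0) {x : HalfSpin} (hx : x ∈ Λ)
    (h0 : coords x 0 = 0) (h1 : ∀ m : Fin 16, 5 ≤ m → coords x m = 0) : x = 0 := by
  obtain ⟨T, hT, hT1, hT2⟩ := h.exists_tangentSpace
  have hxT : x ∈ T := (hT1 x).2 ⟨hx, fun m hm => h1 m (le_trans (by decide) hm)⟩
  -- The image has dimension 4, so Y₀ = 0 is the only relation: Y₁, …, Y₄ can be prescribed freely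
  -- on Λ.
  have himage : Λ.map topCoords = LinearMap.ker (LinearMap.proj 0 : (Fin 5 → ℂ) →ₗ[ℂ] ℂ) := by
    apply Submodule.eq_of_le_of_finrank_eq
    · rintro _ ⟨y, hy, rfl⟩
      exact hΛ y hy
    · rw [finrank_range_topCoords h.finrank_eq hT hT1]
      have := LinearMap.finrank_range_add_finrank_ker (LinearMap.proj 0 : (Fin 5 → ℂ) →ₗ[ℂ] ℂ)
      rw [LinearMap.range_eq_top.2 (LinearMap.proj_surjective 0)] at this
      simp at this
      omega
  have hspan := hT2 nodePfaffian (fun f hf hf1 => ?_) x hxT fun y _ => ?_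
  · obtain ⟨c, rfl⟩ := Submodule.mem_span_singleton.1 hspan
    rw [map_smul, coords_baseSpinor] at h0
    simp at h0
    rw [h0, zero_smul]
  · obtain ⟨u, hu, v, hv, rfl⟩ := Submodule.mem_sup.1 hf
    set e : HalfSpin := coords.symm (Pi.single 11 1)
    -- Here f = u + v with u vanishing on the spinor cone and v on Λ, and e is the basis vector of
    -- Y₀. For A in T, follow a curve on the cone with velocity A and second-order term z + Pf(A)e,
    -- where z in Λ supplies the other four Pfaffians. Since u vanishes along it and v is blind to A
    -- and z, the second-order term of f at A is Pf(A) times the derivative of v along e.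
    refine ⟨(alongLine baseSpinor e v).coeff 1, fun A hA => ?_⟩
    obtain ⟨hAΛ, hA⟩ := (hT1 A).1 hA
    obtain ⟨z, hzΛ, hz⟩ : ![0, coords A 10 * coords A 2 - coords A 3 * coords A 9 + coords A 4 * coords A 8,
        coords A 1 * coords A 10 - coords A 3 * coords A 7 + coords A 4 * coords A 6,
        coords A 1 * coords A 9 - coords A 2 * coords A 7 + coords A 4 * coords A 5,
        coords A 1 * coords A 8 - coords A 2 * coords A 6 + coords A 3 * coords A 5] ∈ Λ.map topCoords := by
      rw [himage]; simp
    have he : coords e = Pi.single 11 1 := by simp [e]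
    have hB : ∀ m, coords (z + nodePfaffian A • e) m =
        coords z m + nodePfaffian A * (Pi.single 11 1 : Fin 16 → ℂ) m := by
      intro m
      rw [map_add, map_smul, he]; simp
    obtain ⟨γ, hγ, hγ0, hγ1, hγ2⟩ := exists_spinorCurve A (z + nodePfaffian A • e) hA
      (by rw [hB, hΛ z hzΛ]; simp [nodePfaffian])
      (by rw [hB, Pi.single_eq_of_ne (by decide), mul_zero, add_zero]; exact congrFun hz 1)
      (by rw [hB, Pi.single_eq_of_ne (by decide), mul_zero, add_zero]; exact congrFun hz 2)
      (by rw [hB, Pi.single_eq_of_ne (by decide), mul_zero, add_zero]; exact congrFun hz 3)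
      (by rw [hB, Pi.single_eq_of_ne (by decide), mul_zero, add_zero]; exact congrFun hz 4)
    have e1 := (coeff_aeval_curve γ hγ0 hγ1 hγ2 (u + v)).2.2
    have e2 := (coeff_aeval_curve γ hγ0 hγ1 hγ2 v).2.2
    rw [hf1, add_zero, map_add, aeval_curve_eq_zero hγ hu, zero_add] at e1
    rw [alongLine_eq_zero (baseSpinor_add_smul_mem h.mem hAΛ) hv, Polynomial.coeff_zero, zero_add,
      coeff_one_alongLine_add, coeff_one_alongLine_smul, alongLine_eq_zero (baseSpinor_add_smul_mem h.mem hzΛ) hv,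
      Polynomial.coeff_zero, zero_add] at e2
    rw [← e1, e2, mul_comm]
  -- The Pfaffian only sees the six coordinates that vanish on x, so x is in its radical.
  · simp only [nodePfaffian, map_add, Pi.add_apply, h1 5 (by decide), h1 6 (by decide),
      h1 7 (by decide), h1 8 (by decide), h1 9 (by decide), h1 10 (by decide)]
    ring

end TangentSpace

/-! ### Normal form of the section: Y₀ = 0, and a graph over (x₀, w) -/

section NormalForm

lemma spinTransvectionEquiv_apply (b : Fin 4 → ℂ) (z : Fin 16 → ℂ) :
    spinTransvectionEquiv b z = spinTransvection b z := rfl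

lemma coordsConj_baseSpinor {g : (Fin 16 → ℂ) ≃ₗ[ℂ] (Fin 16 → ℂ)}
    (hg : g (Pi.single 0 1) = Pi.single 0 1) : coordsConj g baseSpinor = baseSpinor := by
  rw [baseSpinor, coordsConj_coords_symm, hg]

lemma single_zero_eq : (Pi.single 0 1 : Fin 16 → ℂ) = ![1, 0, 0, 0, 0, 0, 0, 0, 0, 0, 0, 0, 0, 0, 0, 0] := by
  apply spinor_ext <;> rfl

/-- A linear dependency between the five top coordinates can be moved to `Y₀ = 0`. -/
lemma nodalProjectionProperty_of_dependency
    (H : ∀ Λ : Submodule ℂ HalfSpin, (∀ x ∈ Λ, coords x 11 = 0) → NodalProjectionProperty Λ baseSpinor)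
    {β : Fin 5 → ℂ} (hβ : β ≠ 0) {Λ : Submodule ℂ HalfSpin}
    (h : ∀ x ∈ Λ, β 0 * coords x 11 + β 1 * coords x 12 + β 2 * coords x 13 + β 3 * coords x 14 +
      β 4 * coords x 15 = 0) : NodalProjectionProperty Λ baseSpinor := by
  have zero : ∀ (β : Fin 5 → ℂ), β 0 ≠ 0 → ∀ Λ : Submodule ℂ HalfSpin,
      (∀ x ∈ Λ, β 0 * coords x 11 + β 1 * coords x 12 + β 2 * coords x 13 + β 3 * coords x 14 +
        β 4 * coords x 15 = 0) → NodalProjectionProperty Λ baseSpinor := by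
    intro β hβ Λ h
    -- This transvection sends Y₀ to Y₀ - b₀Y₁ + b₁Y₂ - b₂Y₃ + b₃Y₄; the parameters turn it into the
    -- given dependency divided by β₀.
    refine NodalProjectionProperty.of_map (g := coordsConj (spinTransvectionEquiv
      ![-(β 1 / β 0), β 2 / β 0, -(β 3 / β 0), β 4 / β 0])) (coordsConj_mem_spinorCone
      (fun z hz => hz.spinTransvection _) fun z hz => hz.spinTransvection _) ?_
    rw [coordsConj_baseSpinor (by
      rw [single_zero_eq, spinTransvectionEquiv_apply]
      apply spinor_ext <;> simp [spinTransvection])]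
    refine H _ ?_
    rintro _ ⟨x, hx, rfl⟩
    have := h x hx
    rw [LinearEquiv.coe_coe, coords_coordsConj, spinTransvectionEquiv_apply]
    simp only [spinTransvection, LinearMap.coe_mk, AddHom.coe_mk, Matrix.cons_val]
    field_simp
    linear_combination this
  -- If β₀ = 0, the cycle moves another nonzero coefficient into position 0. It fixes e_∅ and
  -- changes coefficients only by a rotation and signs.
  have cycle : ∀ β : Fin 5 → ℂ,
      (∀ Λ : Submodule ℂ HalfSpin, (∀ x ∈ Λ, β 4 * coords x 11 - β 0 * coords x 12 -
        β 1 * coords x 13 - β 2 * coords x 14 - β 3 * coords x 15 = 0) →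
        NodalProjectionProperty Λ baseSpinor) →
      ∀ Λ : Submodule ℂ HalfSpin, (∀ x ∈ Λ, β 0 * coords x 11 + β 1 * coords x 12 +
        β 2 * coords x 13 + β 3 * coords x 14 + β 4 * coords x 15 = 0) →
        NodalProjectionProperty Λ baseSpinor := by
    intro β hH Λ h
    refine NodalProjectionProperty.of_map (g := coordsConj spinCycleEquiv)
        (coordsConj_mem_spinorCone (fun z => (satisfiesSpinorQuadrics_cycle z).2) fun z hz => ?_) ?_
    · rw [← satisfiesSpinorQuadrics_cycle]
      change SatisfiesSpinorQuadrics (spinCycleEquiv (spinCycleEquiv.symm z))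
      rwa [LinearEquiv.apply_symm_apply]
    rw [coordsConj_baseSpinor (by
      rw [single_zero_eq]
      apply spinor_ext <;> simp [spinCycleEquiv, spinCycle])]
    refine hH _ ?_
    rintro _ ⟨x, hx, rfl⟩
    have := h x hx
    rw [LinearEquiv.coe_coe, coords_coordsConj]
    simp only [spinCycleEquiv, LinearEquiv.coe_mk, LinearMap.coe_mk, AddHom.coe_mk, spinCycle, Matrix.cons_val]
    linear_combination this
  have rot : ∀ β : Fin 5 → ℂ,
      (∀ Λ : Submodule ℂ HalfSpin, (∀ x ∈ Λ, β 4 * coords x 11 + -β 0 * coords x 12 +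
        -β 1 * coords x 13 + -β 2 * coords x 14 + -β 3 * coords x 15 = 0) →
        NodalProjectionProperty Λ baseSpinor) →
      ∀ Λ : Submodule ℂ HalfSpin, (∀ x ∈ Λ, β 0 * coords x 11 + β 1 * coords x 12 +
        β 2 * coords x 13 + β 3 * coords x 14 + β 4 * coords x 15 = 0) →
        NodalProjectionProperty Λ baseSpinor := fun β hH =>
    cycle β fun Λ h => hH Λ fun x hx => by linear_combination h x hx
  have r4 : ∀ β : Fin 5 → ℂ, β 4 ≠ 0 → _ := fun β hβ =>
    rot β (zero ![β 4, -β 0, -β 1, -β 2, -β 3] hβ)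
  have r3 : ∀ β : Fin 5 → ℂ, β 3 ≠ 0 → _ := fun β hβ =>
    rot β (r4 ![β 4, -β 0, -β 1, -β 2, -β 3] (neg_ne_zero.2 hβ))
  have r2 : ∀ β : Fin 5 → ℂ, β 2 ≠ 0 → _ := fun β hβ =>
    rot β (r3 ![β 4, -β 0, -β 1, -β 2, -β 3] (neg_ne_zero.2 hβ))
  have r1 : ∀ β : Fin 5 → ℂ, β 1 ≠ 0 → _ := fun β hβ =>
    rot β (r2 ![β 4, -β 0, -β 1, -β 2, -β 3] (neg_ne_zero.2 hβ))
  obtain ⟨i, hi⟩ := Function.ne_iff.1 hβ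
  fin_cases i
  · exact zero β hi Λ h
  · exact r1 β hi Λ h
  · exact r2 β hi Λ h
  · exact r3 β hi Λ h
  · exact r4 β hi Λ h

/-- The rank of Y on Λ is 11 - 7 = 4 < 5, so some nonzero linear form in Y vanishes on Λ. -/
lemma nodalProjectionProperty_of_normalForm
    (H : ∀ Λ : Submodule ℂ HalfSpin, (∀ x ∈ Λ, coords x 11 = 0) → NodalProjectionProperty Λ baseSpinor)
    (Λ : Submodule ℂ HalfSpin) : NodalProjectionProperty Λ baseSpinor := by
  intro hs
  obtain ⟨T, hT, hT1, -⟩ := hs.exists_tangentSpace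
  have hlt : Λ.map topCoords < ⊤ := by
    rw [lt_top_iff_ne_top]
    intro htop
    have := finrank_range_topCoords hs.finrank_eq hT hT1
    rw [htop, finrank_top, Module.finrank_fin_fun] at this
    omega
  obtain ⟨ℓ, hℓ, hΛ⟩ := Submodule.exists_le_ker_of_lt_top _ hlt
  have hsum : ∀ y : Fin 5 → ℂ, ℓ y = ∑ i, ℓ (Pi.single i 1) * y i := fun y => by
    conv_lhs => rw [pi_eq_sum_univ' y, map_sum]
    refine Finset.sum_congr rfl fun i _ => ?_
    rw [map_smul, smul_eq_mul, mul_comm]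
  revert hs
  refine nodalProjectionProperty_of_dependency H (β := fun i => ℓ (Pi.single i 1)) (fun h0 => hℓ ?_)
    fun x hx => ?_
  · ext i
    simpa using congrFun h0 i
  · have h1 : ℓ (topCoords x) = 0 := hΛ (Submodule.mem_map_of_mem hx)
    rw [hsum, Fin.sum_univ_five] at h1
    exact h1

/-- The ten coordinates of the projection from the base point, arranged as Plücker coordinates. -/
def toPlucker {R : Type*} [CommRing R] (z : Fin 16 → R) : PluckerIndex → R := fun ij =>
  (![![0, -z 12, z 13, -z 14, z 15], ![0, 0, z 10, -z 9, z 8], ![0, 0, 0, z 7, -z 6],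
    ![0, 0, 0, 0, z 5], 0] : Fin 5 → Fin 5 → R) ij.1.1 ij.1.2

/-- The point with `Y₀ = 0` and given `x₀`, `x₀ₖ` and Plücker coordinates. -/
def fromPlucker {R : Type*} [CommRing R] (x₀ : R) (v : Fin 4 → R) (w : PluckerIndex → R) :
    Fin 16 → R :=
  ![x₀, v 0, v 1, v 2, v 3, w (plk 3 4), -w (plk 2 4), w (plk 2 3), w (plk 1 4), -w (plk 1 3),
    w (plk 1 2), 0, -w (plk 0 1), w (plk 0 2), -w (plk 0 3), w (plk 0 4)]

lemma toPlucker_fromPlucker {R : Type*} [CommRing R] (x₀ : R) (v : Fin 4 → R) (w : PluckerIndex → R) :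
    toPlucker (fromPlucker x₀ v w) = w := by
  ext a
  induction a using pluckerIndex_forall <;> simp [toPlucker, fromPlucker]

lemma fromPlucker_toPlucker {R : Type*} [CommRing R] {z : Fin 16 → R} (h : z 11 = 0) :
    fromPlucker (z 0) ![z 1, z 2, z 3, z 4] (toPlucker z) = z := by
  ext i
  fin_cases i <;> simp [toPlucker, fromPlucker, h]

/-- The linear map `toPlucker` on half-spinors. -/
noncomputable def spinorToPlucker : HalfSpin →ₗ[ℂ] (PluckerIndex → ℂ) where
  toFun x := toPlucker (coords x)
  map_add' x y := by
    ext a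
    induction a using pluckerIndex_forall <;> simp [toPlucker] <;> ring
  map_smul' c x := by
    ext a
    induction a using pluckerIndex_forall <;> simp [toPlucker]

lemma spinorToPlucker_apply (x : HalfSpin) : spinorToPlucker x = toPlucker (coords x) := rfl

lemma card_pluckerIndex : Fintype.card PluckerIndex = 10 := by decide

/-- A nodal section inside `{Y₀ = 0}` is a graph over the coordinates `x₀` and `w`, and the
functions `x₀ₖ` on it only depend on `w`. -/
lemma IsNodalSection.exists_graph {Λ : Submodule ℂ HalfSpin}
    (h : IsNodalSection Λ baseSpinor) (hΛ : ∀ x ∈ Λ, coords x 11 = 0) :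
    ∃ L : (PluckerIndex → ℂ) →ₗ[ℂ] (Fin 4 → ℂ), ∀ x, x ∈ Λ ↔
      ∃ x₀ w, coords x = fromPlucker x₀ (L w) w := by
  set φ : Λ →ₗ[ℂ] ℂ × (PluckerIndex → ℂ) :=
    ((LinearMap.proj (evenSet 0) : HalfSpin →ₗ[ℂ] ℂ).prod spinorToPlucker).domRestrict Λ with hφ
  have hφ1 : ∀ x : Λ, φ x = (coords x.1 0, toPlucker (coords x.1)) := fun x => rfl
  have hinj : Function.Injective φ := by
    rw [← LinearMap.ker_eq_bot, LinearMap.ker_eq_bot']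
    rintro ⟨x, hx⟩ h0
    rw [hφ1, Prod.mk_eq_zero] at h0
    ext1
    refine h.eq_zero_of_coords hΛ hx h0.1 fun m hm => ?_
    have e := fromPlucker_toPlucker (hΛ x hx)
    rw [h0.2] at e
    change coords x m = 0
    rw [← e]
    fin_cases m <;> first | exact absurd hm (by decide) | simp [fromPlucker]
  have hdim : Module.finrank ℂ Λ = Module.finrank ℂ (ℂ × (PluckerIndex → ℂ)) := by
    rw [h.finrank_eq, Module.finrank_prod, Module.finrank_self, Module.finrank_fintype_fun_eq_card,
      card_pluckerIndex]
  set e : Λ ≃ₗ[ℂ] ℂ × (PluckerIndex → ℂ) := LinearEquiv.ofInjectiveOfFinrankEq φ hinj hdim with he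
  have he1 : ∀ x : Λ, e x = (coords x.1 0, toPlucker (coords x.1)) := fun x => rfl
  have he2 : ∀ x₀ w, coords (e.symm (x₀, w)).1 0 = x₀ ∧
      toPlucker (coords (e.symm (x₀, w)).1) = w := fun x₀ w => by
    have := he1 (e.symm (x₀, w))
    rw [LinearEquiv.apply_symm_apply, Prod.mk.injEq] at this
    exact ⟨this.1.symm, this.2.symm⟩
  set pr : HalfSpin →ₗ[ℂ] (Fin 4 → ℂ) :=
    LinearMap.pi fun k => LinearMap.proj (evenSet (Fin.castAdd 11 k.succ))
  have hpr : ∀ x, pr x = ![coords x 1, coords x 2, coords x 3, coords x 4] := fun x => by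
    ext k; fin_cases k <;> rfl
  -- Since e_∅ lies in Λ and has zero coordinates x₀ₖ, these do not depend on x₀ and L is a function
  -- of w alone.
  have hbase : ∀ x₀, e.symm (x₀, 0) = x₀ • (⟨baseSpinor, h.mem⟩ : Λ) := fun x₀ => by
    rw [LinearEquiv.symm_apply_eq, map_smul, he1, coords_baseSpinor]
    ext a
    · simp
    · induction a using pluckerIndex_forall <;> simp [toPlucker]
  set L : (PluckerIndex → ℂ) →ₗ[ℂ] (Fin 4 → ℂ) :=
    pr ∘ₗ Λ.subtype ∘ₗ e.symm.toLinearMap ∘ₗ LinearMap.inr ℂ ℂ (PluckerIndex → ℂ)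
  have hL : ∀ x₀ w, pr (e.symm (x₀, w)).1 = L w := fun x₀ w => by
    have : ((x₀, w) : ℂ × (PluckerIndex → ℂ)) = (x₀, 0) + (0, w) := by simp
    rw [this, map_add, hbase]
    simp only [Submodule.coe_add, Submodule.coe_smul, map_add, map_smul]
    rw [hpr, coords_baseSpinor]
    ext k
    fin_cases k <;> simp [L]
  have hgraph : ∀ x₀ w, coords (e.symm (x₀, w)).1 = fromPlucker x₀ (L w) w := fun x₀ w => by
    have := fromPlucker_toPlucker (hΛ _ (e.symm (x₀, w)).2)
    rw [(he2 x₀ w).1, (he2 x₀ w).2, ← hpr, hL] at this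
    exact this.symm
  refine ⟨L, fun x => ⟨fun hx => ?_, ?_⟩⟩
  · refine ⟨(e ⟨x, hx⟩).1, (e ⟨x, hx⟩).2, ?_⟩
    rw [← hgraph, Prod.mk.eta, LinearEquiv.symm_apply_apply]
  · rintro ⟨x₀, w, hx⟩
    rw [← hgraph] at hx
    rw [coords.injective hx]
    exact (e.symm (x₀, w)).2

end NormalForm

/-! ### The spinor quadrics in Plücker coordinates, over any ℂ-algebra -/

section QuadricSection

variable {R : Type*} [CommRing R]

/-- The five Plücker relations. -/
def SatisfiesPluckerRelations (w : PluckerIndex → R) : Prop :=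
  w (plk 0 1) * w (plk 2 3) - w (plk 0 2) * w (plk 1 3) + w (plk 0 3) * w (plk 1 2) = 0 ∧
  w (plk 0 1) * w (plk 2 4) - w (plk 0 2) * w (plk 1 4) + w (plk 0 4) * w (plk 1 2) = 0 ∧
  w (plk 0 1) * w (plk 3 4) - w (plk 0 3) * w (plk 1 4) + w (plk 0 4) * w (plk 1 3) = 0 ∧
  w (plk 0 2) * w (plk 3 4) - w (plk 0 3) * w (plk 2 4) + w (plk 0 4) * w (plk 2 3) = 0 ∧
  w (plk 1 2) * w (plk 3 4) - w (plk 1 3) * w (plk 2 4) + w (plk 1 4) * w (plk 2 3) = 0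

lemma fin_five_chain : ∀ i j k l : Fin 5, i < j → j < k → k < l →
    (i = 0 ∧ j = 1 ∧ k = 2 ∧ l = 3) ∨ (i = 0 ∧ j = 1 ∧ k = 2 ∧ l = 4) ∨
    (i = 0 ∧ j = 1 ∧ k = 3 ∧ l = 4) ∨ (i = 0 ∧ j = 2 ∧ k = 3 ∧ l = 4) ∨
    (i = 1 ∧ j = 2 ∧ k = 3 ∧ l = 4) := by decide

lemma satisfiesPluckerRelations_iff [Algebra ℂ R] (w : PluckerIndex → R) :
    SatisfiesPluckerRelations w ↔ ∀ f ∈ pluckerIdeal, aeval w f = 0 := by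
  constructor
  · rintro ⟨h1, h2, h3, h4, h5⟩ f hf
    have : pluckerIdeal ≤ RingHom.ker (aeval (R := ℂ) w) := by
      refine Ideal.span_le.2 ?_
      rintro _ ⟨i, j, k, l, hij, hjk, hkl, rfl⟩
      simp only [SetLike.mem_coe, RingHom.mem_ker, pluckerRel, map_add, map_sub, map_mul, aeval_X]
      rcases fin_five_chain i j k l hij hjk hkl with ⟨rfl, rfl, rfl, rfl⟩ | ⟨rfl, rfl, rfl, rfl⟩ |
        ⟨rfl, rfl, rfl, rfl⟩ | ⟨rfl, rfl, rfl, rfl⟩ | ⟨rfl, rfl, rfl, rfl⟩ <;> assumption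
    exact this hf
  · intro h
    have key := fun i j k l hij hjk hkl => h _ (pluckerRel_mem i j k l hij hjk hkl)
    simp only [pluckerRel, map_add, map_sub, map_mul, aeval_X] at key
    exact ⟨key 0 1 2 3 (by decide) (by decide) (by decide),
      key 0 1 2 4 (by decide) (by decide) (by decide),
      key 0 1 3 4 (by decide) (by decide) (by decide),
      key 0 2 3 4 (by decide) (by decide) (by decide),
      key 1 2 3 4 (by decide) (by decide) (by decide)⟩

lemma mem_grassmannCone_iff_relations (w : PluckerIndex → ℂ) :
    w ∈ grassmannCone ↔ SatisfiesPluckerRelations w := by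
  rw [mem_grassmannCone_iff, satisfiesPluckerRelations_iff]
  constructor
  · intro h f hf
    have : pluckerIdeal ≤ RingHom.ker (eval w) := by
      refine Ideal.span_le.2 ?_
      rintro _ ⟨i, j, k, l, hij, hjk, hkl, rfl⟩
      exact h i j k l hij hjk hkl
    rw [aeval_eq_eval]
    exact this hf
  · intro h i j k l hij hjk hkl
    rw [← aeval_eq_eval]
    exact h _ (pluckerRel_mem i j k l hij hjk hkl)

/-- The last five equations are the rows of the product of the skew matrix w with the vector (-x₀,
v); only row 0 is free of x₀. -/
lemma satisfiesSpinorQuadrics_fromPlucker_iff (x₀ : R) (v : Fin 4 → R) (w : PluckerIndex → R) :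
    SatisfiesSpinorQuadrics (fromPlucker x₀ v w) ↔ SatisfiesPluckerRelations w ∧
      w (plk 0 1) * v 0 + w (plk 0 2) * v 1 + w (plk 0 3) * v 2 + w (plk 0 4) * v 3 = 0 ∧
      x₀ * w (plk 0 1) + w (plk 1 2) * v 1 + w (plk 1 3) * v 2 + w (plk 1 4) * v 3 = 0 ∧
      x₀ * w (plk 0 2) - w (plk 1 2) * v 0 + w (plk 2 3) * v 2 + w (plk 2 4) * v 3 = 0 ∧
      x₀ * w (plk 0 3) - w (plk 1 3) * v 0 - w (plk 2 3) * v 1 + w (plk 3 4) * v 3 = 0 ∧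
      x₀ * w (plk 0 4) - w (plk 1 4) * v 0 - w (plk 2 4) * v 1 - w (plk 3 4) * v 2 = 0 := by
  simp only [SatisfiesSpinorQuadrics, fromPlucker, SatisfiesPluckerRelations, Matrix.cons_val]
  constructor
  · rintro ⟨h0, h1, h2, h3, h4, h5, h6, h7, h8, h9⟩
    exact ⟨⟨by linear_combination -h9, by linear_combination h8, by linear_combination -h7,
      by linear_combination h6, by linear_combination -h0⟩,
      by linear_combination h5, by linear_combination -h1, by linear_combination h2,
      by linear_combination -h3, by linear_combination h4⟩
  · rintro ⟨⟨h9, h8, h7, h6, h0⟩, h5, h1, h2, h3, h4⟩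
    exact ⟨by linear_combination -h0, by linear_combination -h1, by linear_combination h2,
      by linear_combination -h3, by linear_combination h4, by linear_combination h5,
      by linear_combination h6, by linear_combination -h7, by linear_combination h8,
      by linear_combination -h9⟩

/-- Row 1 is solved for x₀ by inverting w₀₁. The Plücker relations make the remaining rows
combinations of rows 0 and 1. -/
lemma satisfiesSpinorQuadrics_of_mul_eq_one {u : R} {v : Fin 4 → R} {w : PluckerIndex → R}
    (hu : u * w (plk 0 1) = 1) (hw : SatisfiesPluckerRelations w)
    (hv : w (plk 0 1) * v 0 + w (plk 0 2) * v 1 + w (plk 0 3) * v 2 + w (plk 0 4) * v 3 = 0) :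
    SatisfiesSpinorQuadrics (fromPlucker
      (-u * (w (plk 1 2) * v 1 + w (plk 1 3) * v 2 + w (plk 1 4) * v 3)) v w) := by
  rw [satisfiesSpinorQuadrics_fromPlucker_iff]
  refine ⟨hw, hv, ?_⟩
  obtain ⟨h1, h2, h3, h4, h5⟩ := hw
  set s := w (plk 1 2) * v 1 + w (plk 1 3) * v 2 + w (plk 1 4) * v 3 with hs
  refine ⟨?_, ?_, ?_, ?_⟩
  · linear_combination -s * hu + hs
  · linear_combination (-w (plk 1 2) * u) * hv + u * (v 2 * h1 + v 3 * h2) - u * w (plk 0 2) * hs -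
      (w (plk 2 3) * v 2 + w (plk 2 4) * v 3 - w (plk 1 2) * v 0) * hu
  · linear_combination (-w (plk 1 3) * u) * hv + u * (-v 1 * h1 + v 3 * h3) - u * w (plk 0 3) * hs -
      (-w (plk 2 3) * v 1 + w (plk 3 4) * v 3 - w (plk 1 3) * v 0) * hu
  · linear_combination (-w (plk 1 4) * u) * hv + u * (-v 1 * h2 - v 2 * h3) - u * w (plk 0 4) * hs -
      (-w (plk 2 4) * v 1 - w (plk 3 4) * v 2 - w (plk 1 4) * v 0) * hu

/-- The same with row 2 and w₀₂. -/
lemma satisfiesSpinorQuadrics_of_mul_eq_one' {u : R} {v : Fin 4 → R} {w : PluckerIndex → R}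
    (hu : u * w (plk 0 2) = 1) (hw : SatisfiesPluckerRelations w)
    (hv : w (plk 0 1) * v 0 + w (plk 0 2) * v 1 + w (plk 0 3) * v 2 + w (plk 0 4) * v 3 = 0) :
    SatisfiesSpinorQuadrics (fromPlucker
      (-u * (-w (plk 1 2) * v 0 + w (plk 2 3) * v 2 + w (plk 2 4) * v 3)) v w) := by
  rw [satisfiesSpinorQuadrics_fromPlucker_iff]
  refine ⟨hw, hv, ?_⟩
  obtain ⟨h1, h2, h3, h4, h5⟩ := hw
  set s := -w (plk 1 2) * v 0 + w (plk 2 3) * v 2 + w (plk 2 4) * v 3 with hs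
  refine ⟨?_, ?_, ?_, ?_⟩
  · linear_combination (w (plk 1 2) * u) * hv - u * (v 2 * h1 + v 3 * h2) - u * w (plk 0 1) * hs -
      (w (plk 1 2) * v 1 + w (plk 1 3) * v 2 + w (plk 1 4) * v 3) * hu
  · linear_combination -s * hu + hs
  · linear_combination (-w (plk 2 3) * u) * hv + u * (v 0 * h1 + v 3 * h4) - u * w (plk 0 3) * hs -
      (-w (plk 2 3) * v 1 + w (plk 3 4) * v 3 - w (plk 1 3) * v 0) * hu
  · linear_combination (-w (plk 2 4) * u) * hv + u * (v 0 * h2 - v 2 * h4) - u * w (plk 0 4) * hs -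
      (-w (plk 2 4) * v 1 - w (plk 3 4) * v 2 - w (plk 1 4) * v 0) * hu

/-- The chart of the cone over the spinor variety where the thirteenth coordinate is invertible. -/
def spinorChart (c : R) (x : Fin 10 → R) : Fin 16 → R :=
  ![c * (x 5 * x 0 - x 1 * x 4 + x 2 * x 3), c * (x 7 * x 0 - x 8 * x 1 + x 9 * x 2), c * x 0, c * x 1,
    c * x 2, c * (x 6 * x 0 + x 8 * x 3 - x 9 * x 4), c * (x 6 * x 1 + x 7 * x 3 - x 5 * x 9),
    c * (x 6 * x 2 + x 7 * x 4 - x 5 * x 8), c * x 3, c * x 4, c * x 5, c * x 6, c, c * x 7, c * x 8,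
    c * x 9]

lemma satisfiesSpinorQuadrics_spinorChart (c : R) (x : Fin 10 → R) :
    SatisfiesSpinorQuadrics (spinorChart c x) := by
  simp only [SatisfiesSpinorQuadrics, spinorChart, Matrix.cons_val]
  refine ⟨?_, ?_, ?_, ?_, ?_, ?_, ?_, ?_, ?_, ?_⟩ <;> ring

/-- The chart of the cone over the spinor variety where the fourteenth coordinate is invertible. -/
def spinorChart' (c : R) (x : Fin 10 → R) : Fin 16 → R :=
  ![c * (x 0 * x 5 - x 1 * x 4 + x 2 * x 3), c * x 0, c * (x 0 * x 7 + x 8 * x 1 - x 9 * x 2), c * x 1,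
    c * x 2, c * (x 0 * x 6 + x 8 * x 3 - x 9 * x 4), c * x 3, c * x 4,
    c * (-x 6 * x 1 + x 7 * x 3 + x 5 * x 9), c * (-x 6 * x 2 + x 7 * x 4 + x 5 * x 8), c * x 5,
    c * x 6, c * x 7, c, c * x 8, c * x 9]

lemma satisfiesSpinorQuadrics_spinorChart' (c : R) (x : Fin 10 → R) :
    SatisfiesSpinorQuadrics (spinorChart' c x) := by
  simp only [SatisfiesSpinorQuadrics, spinorChart', Matrix.cons_val]
  refine ⟨?_, ?_, ?_, ?_, ?_, ?_, ?_, ?_, ?_, ?_⟩ <;> ring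

/-- Each quadric containing z₁₂ expresses the coordinate multiplied by z₁₂ through the others; these
five are the quadratic entries of the chart. -/
lemma spinorChart_eq {u : R} {z : Fin 16 → R} (hu : u * z 12 = 1) (hz : SatisfiesSpinorQuadrics z) :
    spinorChart (z 12) ![u * z 2, u * z 3, u * z 4, u * z 8, u * z 9, u * z 10, u * z 11, u * z 13, u * z 14, u * z 15] = z := by
  obtain ⟨h0, h1, h2, h3, h4, h5, h6, h7, h8, h9⟩ := hz
  apply spinor_ext <;> simp only [spinorChart, Matrix.cons_val]
  · linear_combination -u ^ 2 * z 12 * h1 + z 0 * (u * z 12 + 1) * hu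
  · linear_combination u ^ 2 * z 12 * h5 + z 1 * (u * z 12 + 1) * hu
  · linear_combination z 2 * hu
  · linear_combination z 3 * hu
  · linear_combination z 4 * hu
  · linear_combination -u ^ 2 * z 12 * h7 + z 5 * (u * z 12 + 1) * hu
  · linear_combination -u ^ 2 * z 12 * h8 + z 6 * (u * z 12 + 1) * hu
  · linear_combination -u ^ 2 * z 12 * h9 + z 7 * (u * z 12 + 1) * hu
  · linear_combination z 8 * hu
  · linear_combination z 9 * hu
  · linear_combination z 10 * hu
  · linear_combination z 11 * hu
  · linear_combination z 13 * hu
  · linear_combination z 14 * hu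
  · linear_combination z 15 * hu

lemma spinorChart'_eq {u : R} {z : Fin 16 → R} (hu : u * z 13 = 1) (hz : SatisfiesSpinorQuadrics z) :
    spinorChart' (z 13) ![u * z 1, u * z 3, u * z 4, u * z 6, u * z 7, u * z 10, u * z 11, u * z 12, u * z 14, u * z 15] = z := by
  obtain ⟨h0, h1, h2, h3, h4, h5, h6, h7, h8, h9⟩ := hz
  apply spinor_ext <;> simp only [spinorChart', Matrix.cons_val]
  · linear_combination -u ^ 2 * z 13 * h2 + z 0 * (u * z 13 + 1) * hu
  · linear_combination z 1 * hu
  · linear_combination -u ^ 2 * z 13 * h5 + z 2 * (u * z 13 + 1) * hu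
  · linear_combination z 3 * hu
  · linear_combination z 4 * hu
  · linear_combination -u ^ 2 * z 13 * h6 + z 5 * (u * z 13 + 1) * hu
  · linear_combination z 6 * hu
  · linear_combination z 7 * hu
  · linear_combination u ^ 2 * z 13 * h8 + z 8 * (u * z 13 + 1) * hu
  · linear_combination u ^ 2 * z 13 * h9 + z 9 * (u * z 13 + 1) * hu
  · linear_combination z 10 * hu
  · linear_combination z 11 * hu
  · linear_combination z 12 * hu
  · linear_combination z 14 * hu
  · linear_combination z 15 * hu


lemma map_spinorChart {S : Type*} [CommRing S] (g : R →+* S) (c : R) (x : Fin 10 → R) (i : Fin 16) :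
    g (spinorChart c x i) = spinorChart (g c) (fun k => g (x k)) i := by
  refine congrFun (spinor_ext (a := fun i => g (spinorChart c x i)) ?_ ?_ ?_ ?_ ?_ ?_ ?_ ?_
    ?_ ?_ ?_ ?_ ?_ ?_ ?_ ?_) i <;> simp [spinorChart]

lemma map_spinorChart' {S : Type*} [CommRing S] (g : R →+* S) (c : R) (x : Fin 10 → R)
    (i : Fin 16) : g (spinorChart' c x i) = spinorChart' (g c) (fun k => g (x k)) i := by
  refine congrFun (spinor_ext (a := fun i => g (spinorChart' c x i)) ?_ ?_ ?_ ?_ ?_ ?_ ?_ ?_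
    ?_ ?_ ?_ ?_ ?_ ?_ ?_ ?_) i <;> simp [spinorChart']

lemma coords_comp_symm (z : Fin 16 → ℂ) : coords (fun T => z (evenEquiv.symm T)) = z := by
  ext i
  rw [coords_apply, evenEquiv_symm_evenSet]

/-- Points with values in an algebra that satisfy the quadratic equations lie on the spinor variety,
if one of two coordinates is invertible. -/
lemma aeval_eq_zero_of_satisfiesSpinorQuadrics [Algebra ℂ R] {u : R} {z : Fin 16 → R}
    (hu : u * z 12 = 1 ∨ u * z 13 = 1) (hz : SatisfiesSpinorQuadrics z)
    {f : MvPolynomial EvenSubset ℂ} (hf : f ∈ vanishingIdeal ℂ spinorCone) :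
    aeval (fun T => z (evenEquiv.symm T)) f = 0 := by
  rcases hu with hu | hu
  -- A polynomial vanishing on the complex cone vanishes identically on the chart, hence at every
  -- R-point of the chart. No generators of the ideal of the cone are needed; `none` carries the
  -- scale of the chart.
  · have h := aeval_parametrisation_eq_zero (V := spinorCone) (τ := Option (Fin 10))
      (Φ := fun T => spinorChart (X none) (fun k => X (some k)) (evenEquiv.symm T))
      (fun c => by
        simp only [map_spinorChart, eval_X]
        rw [mem_spinorCone_iff, coords_comp_symm]
        exact satisfiesSpinorQuadrics_spinorChart _ _) hf
    set x : Fin 10 → R := ![u * z 2, u * z 3, u * z 4, u * z 8, u * z 9, u * z 10, u * z 11, u * z 13,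
      u * z 14, u * z 15]
    have h2 := congrArg (aeval (R := ℂ) fun o : Option (Fin 10) => o.elim (z 12) x) h
    rw [map_zero, comp_aeval_apply] at h2
    rw [← h2]
    congr 1
    congr 1
    ext T
    conv_lhs => rw [← spinorChart_eq hu hz]
    rw [← AlgHom.coe_toRingHom, map_spinorChart]
    simp [x]
  · have h := aeval_parametrisation_eq_zero (V := spinorCone) (τ := Option (Fin 10))
      (Φ := fun T => spinorChart' (X none) (fun k => X (some k)) (evenEquiv.symm T))
      (fun c => by
        simp only [map_spinorChart', eval_X]
        rw [mem_spinorCone_iff, coords_comp_symm]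
        exact satisfiesSpinorQuadrics_spinorChart' _ _) hf
    set x : Fin 10 → R := ![u * z 1, u * z 3, u * z 4, u * z 6, u * z 7, u * z 10, u * z 11, u * z 12,
      u * z 14, u * z 15]
    have h2 := congrArg (aeval (R := ℂ) fun o : Option (Fin 10) => o.elim (z 13) x) h
    rw [map_zero, comp_aeval_apply] at h2
    rw [← h2]
    congr 1
    congr 1
    ext T
    conv_lhs => rw [← spinorChart'_eq hu hz]
    rw [← AlgHom.coe_toRingHom, map_spinorChart']
    simp [x]

lemma satisfiesSpinorQuadrics_of_aeval [Algebra ℂ R] {ζ : EvenSubset → R}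
    (h : ∀ f ∈ vanishingIdeal ℂ spinorCone, aeval ζ f = 0) :
    SatisfiesSpinorQuadrics fun i => ζ (evenSet i) := by
  have key := fun k => h _ (spinorQuadric_mem k)
  have k0 := key 0
  have k1 := key 1
  have k2 := key 2
  have k3 := key 3
  have k4 := key 4
  have k5 := key 5
  have k6 := key 6
  have k7 := key 7
  have k8 := key 8
  have k9 := key 9
  simp only [spinorQuadric, Matrix.cons_val, map_add, map_sub, map_mul, map_neg, aeval_X] at k0 k1 k2 k3 k4 k5 k6 k7 k8 k9
  exact ⟨k0, k1, k2, k3, k4, k5, k6, k7, k8, k9⟩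

lemma map_toPlucker {S : Type*} [CommRing S] (g : R →+* S) (z : Fin 16 → R) (a : PluckerIndex) :
    g (toPlucker z a) = toPlucker (fun i => g (z i)) a := by
  induction a using pluckerIndex_forall <;> simp [toPlucker]

lemma map_fromPlucker {S : Type*} [CommRing S] (g : R →+* S) (x₀ : R) (v : Fin 4 → R)
    (w : PluckerIndex → R) (i : Fin 16) :
    g (fromPlucker x₀ v w i) = fromPlucker (g x₀) (fun k => g (v k)) (fun a => g (w a)) i := by
  refine congrFun (spinor_ext (a := fun i => g (fromPlucker x₀ v w i)) ?_ ?_ ?_ ?_ ?_ ?_ ?_ ?_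
    ?_ ?_ ?_ ?_ ?_ ?_ ?_ ?_) i <;> simp [fromPlucker]

lemma aeval_linearPullback_spinorToPlucker [Algebra ℂ R] (ζ : EvenSubset → R)
    (f : MvPolynomial PluckerIndex ℂ) :
    aeval ζ (linearPullback spinorToPlucker f) = aeval (toPlucker fun i => ζ (evenSet i)) f := by
  have : linearPullback spinorToPlucker = aeval (toPlucker fun i => X (R := ℂ) (evenSet i)) := by
    refine algHom_ext fun a => ?_
    refine MvPolynomial.funext fun x => ?_
    rw [eval_linearPullback, eval_X, aeval_X, map_toPlucker]
    simp only [eval_X]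
    rfl
  rw [this, comp_aeval_apply]
  congr 2
  ext a
  rw [← AlgHom.coe_toRingHom, map_toPlucker]
  simp

/-- The components of a linear map to `ℂ⁴` as polynomials. -/
noncomputable def graphForm (L : (PluckerIndex → ℂ) →ₗ[ℂ] (Fin 4 → ℂ)) (k : Fin 4) :
    MvPolynomial PluckerIndex ℂ := linearForm (LinearMap.proj k ∘ₗ L)

lemma eval_graphForm (L : (PluckerIndex → ℂ) →ₗ[ℂ] (Fin 4 → ℂ)) (k : Fin 4) (w : PluckerIndex → ℂ) :
    eval w (graphForm L k) = L w k := eval_linearForm _ _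

variable {Λ : Submodule ℂ HalfSpin} {L : (PluckerIndex → ℂ) →ₗ[ℂ] (Fin 4 → ℂ)}

/-- The equations Y₀ = 0 and x₀ₖ = Lₖ(w) belong to the ideal of Λ, so they hold at every R-point
killed by this ideal. -/
lemma eq_fromPlucker_of_aeval [Algebra ℂ R]
    (hL : ∀ x, x ∈ Λ ↔ ∃ x₀ w, coords x = fromPlucker x₀ (L w) w) {ζ : EvenSubset → R}
    (h : ∀ f ∈ vanishingIdeal ℂ (Λ : Set HalfSpin), aeval ζ f = 0) :
    (fun i => ζ (evenSet i)) = fromPlucker (ζ (evenSet 0))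
      (fun k => aeval (toPlucker fun i => ζ (evenSet i)) (graphForm L k))
      (toPlucker fun i => ζ (evenSet i)) := by
  have h11 : ζ (evenSet 11) = 0 := by
    have := h (X (evenSet 11)) fun x hx => by
      obtain ⟨x₀, w, hx⟩ := (hL x).1 hx
      rw [aeval_X, ← coords_apply x, hx]
      rfl
    simpa using this
  have hv : ∀ k : Fin 4, ζ (evenSet (Fin.castAdd 11 k.succ)) =
      aeval (toPlucker fun i => ζ (evenSet i)) (graphForm L k) := fun k => by
    have := h (X (evenSet (Fin.castAdd 11 k.succ)) - linearPullback spinorToPlucker (graphForm L k))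
      fun x hx => by
        obtain ⟨x₀, w, hx⟩ := (hL x).1 hx
        rw [map_sub, aeval_X, aeval_eq_eval, eval_linearPullback, eval_graphForm,
          spinorToPlucker_apply, ← coords_apply x, hx, toPlucker_fromPlucker, sub_eq_zero]
        fin_cases k <;> rfl
    rwa [map_sub, aeval_X, aeval_linearPullback_spinorToPlucker, sub_eq_zero] at this
  rw [← fromPlucker_toPlucker (z := fun i => ζ (evenSet i)) h11]
  rw [toPlucker_fromPlucker]
  congr 1
  ext k
  rw [← hv]
  fin_cases k <;> rfl

lemma aeval_eq_zero_of_eq_fromPlucker [Algebra ℂ R]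
    (hL : ∀ x, x ∈ Λ ↔ ∃ x₀ w, coords x = fromPlucker x₀ (L w) w) (x₀ : R) (w : PluckerIndex → R)
    {f : MvPolynomial EvenSubset ℂ} (hf : f ∈ vanishingIdeal ℂ (Λ : Set HalfSpin)) :
    aeval (fun T => fromPlucker x₀ (fun k => aeval w (graphForm L k)) w (evenEquiv.symm T)) f = 0 := by
  have h := aeval_parametrisation_eq_zero (V := (Λ : Set HalfSpin)) (τ := Option PluckerIndex)
    (Φ := fun T => fromPlucker (X none) (fun k => rename some (graphForm L k)) (fun a => X (some a))
      (evenEquiv.symm T)) (fun c => by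
        simp only [map_fromPlucker, eval_X, eval_rename]
        refine (hL _).2 ⟨c none, fun a => c (some a), ?_⟩
        rw [coords_comp_symm]
        congr 1
        ext k
        exact eval_graphForm L k _) hf
  have h2 := congrArg (aeval (R := ℂ) fun o : Option PluckerIndex => o.elim x₀ w) h
  rw [map_zero, comp_aeval_apply] at h2
  rw [← h2]
  congr 1
  congr 1
  ext T
  refine Eq.trans ?_ (map_fromPlucker (AlgHom.toRingHom (aeval (R := ℂ)
    fun o : Option PluckerIndex => o.elim x₀ w)) (X none) (fun k => rename some (graphForm L k))
    (fun a => X (some a)) (evenEquiv.symm T)).symm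
  simp [aeval_rename, Function.comp_def]

end QuadricSection

/-! ### The ideal of the projection -/

section ProjectedIdeal

/-- The quadric that cuts out the projection of the section from its node. -/
noncomputable def nodeQuadric (L : (PluckerIndex → ℂ) →ₗ[ℂ] (Fin 4 → ℂ)) :
    MvPolynomial PluckerIndex ℂ :=
  X (plk 0 1) * graphForm L 0 + X (plk 0 2) * graphForm L 1 + X (plk 0 3) * graphForm L 2 +
    X (plk 0 4) * graphForm L 3

lemma isHomogeneous_nodeQuadric (L : (PluckerIndex → ℂ) →ₗ[ℂ] (Fin 4 → ℂ)) :
    (nodeQuadric L).IsHomogeneous 2 := by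
  have h : ∀ k, (graphForm L k).IsHomogeneous 1 := fun k =>
    IsHomogeneous.sum _ _ _ fun a _ => by
      simpa using (isHomogeneous_C PluckerIndex _).mul (isHomogeneous_X ℂ a)
  exact ((((isHomogeneous_X ℂ _).mul (h 0)).add ((isHomogeneous_X ℂ _).mul (h 1))).add
    ((isHomogeneous_X ℂ _).mul (h 2))).add ((isHomogeneous_X ℂ _).mul (h 3))

lemma aeval_nodeQuadric {R : Type*} [CommRing R] [Algebra ℂ R]
    (L : (PluckerIndex → ℂ) →ₗ[ℂ] (Fin 4 → ℂ)) (w : PluckerIndex → R) :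
    aeval w (nodeQuadric L) = w (plk 0 1) * aeval w (graphForm L 0) +
      w (plk 0 2) * aeval w (graphForm L 1) + w (plk 0 3) * aeval w (graphForm L 2) +
      w (plk 0 4) * aeval w (graphForm L 3) := by
  simp [nodeQuadric]

lemma aeval_eq_zero_of_mem_sup {R σ : Type*} [CommRing R] [Algebra ℂ R] {I J : Ideal (MvPolynomial σ ℂ)}
    {ζ : σ → R} (hI : ∀ f ∈ I, aeval ζ f = 0) (hJ : ∀ f ∈ J, aeval ζ f = 0)
    {f : MvPolynomial σ ℂ} (hf : f ∈ I ⊔ J) : aeval ζ f = 0 := by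
  obtain ⟨u, hu, v, hv, rfl⟩ := Submodule.mem_sup.1 hf
  rw [map_add, hI u hu, hJ v hv, add_zero]

lemma aeval_quotient_mk {σ : Type*} (I : Ideal (MvPolynomial σ ℂ)) (f : MvPolynomial σ ℂ) :
    aeval (fun i => Ideal.Quotient.mkₐ ℂ I (X i)) f = Ideal.Quotient.mk I f := by
  rw [← comp_aeval_apply, aeval_X_left_apply]
  rfl

variable {Λ : Submodule ℂ HalfSpin} {L : (PluckerIndex → ℂ) →ₗ[ℂ] (Fin 4 → ℂ)}

lemma linearPullback_spinorToPlucker_mem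
    (hL : ∀ x, x ∈ Λ ↔ ∃ x₀ w, coords x = fromPlucker x₀ (L w) w) {f : MvPolynomial PluckerIndex ℂ}
    (hf : f ∈ pluckerIdeal ⊔ Ideal.span {nodeQuadric L}) :
    linearPullback spinorToPlucker f ∈ sectionIdeal Λ := by
  -- The tautological point of the section: identities at ζ are membership in the ideal.
  set ζ : EvenSubset → MvPolynomial EvenSubset ℂ ⧸ sectionIdeal Λ :=
    fun i => Ideal.Quotient.mkₐ ℂ (sectionIdeal Λ) (X i)
  have hζ : ∀ f ∈ sectionIdeal Λ, aeval ζ f = 0 := fun f hf => by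
    rw [aeval_quotient_mk]
    exact Ideal.Quotient.eq_zero_iff_mem.2 hf
  have hS := satisfiesSpinorQuadrics_of_aeval fun f hf => hζ f (Ideal.mem_sup_left hf)
  rw [eq_fromPlucker_of_aeval hL fun f hf => hζ f (Ideal.mem_sup_right hf),
    satisfiesSpinorQuadrics_fromPlucker_iff] at hS
  rw [← Ideal.Quotient.eq_zero_iff_mem, ← aeval_quotient_mk, aeval_linearPullback_spinorToPlucker]
  refine aeval_eq_zero_of_mem_sup ((satisfiesPluckerRelations_iff _).1 hS.1) (fun g hg => ?_) hf
  obtain ⟨r, rfl⟩ := Ideal.mem_span_singleton.1 hg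
  rw [map_mul, aeval_nodeQuadric, hS.2.1, zero_mul]

/-- An R-point w of the quadric section with w₀₁ or w₀₂ invertible lifts to an R-point of the linear
section, where the pullback of f vanishes. -/
lemma aeval_eq_zero_of_fromPlucker {R : Type*} [CommRing R] [Algebra ℂ R]
    (hL : ∀ x, x ∈ Λ ↔ ∃ x₀ w, coords x = fromPlucker x₀ (L w) w) {u : R} {w : PluckerIndex → R}
    (hu : u * w (plk 0 1) = 1 ∨ u * w (plk 0 2) = 1)
    (hw : ∀ f ∈ pluckerIdeal ⊔ Ideal.span {nodeQuadric L}, aeval w f = 0)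
    {f : MvPolynomial PluckerIndex ℂ} (hf : linearPullback spinorToPlucker f ∈ sectionIdeal Λ) :
    aeval w f = 0 := by
  have h1 := (satisfiesPluckerRelations_iff w).2 fun f hf => hw f (Ideal.mem_sup_left hf)
  have h2 := hw _ (Ideal.mem_sup_right (Ideal.mem_span_singleton_self _))
  rw [aeval_nodeQuadric] at h2
  obtain ⟨x₀, hx₀⟩ : ∃ x₀, SatisfiesSpinorQuadrics
      (fromPlucker x₀ (fun k => aeval w (graphForm L k)) w) := by
    rcases hu with hu | hu
    · exact ⟨_, satisfiesSpinorQuadrics_of_mul_eq_one hu h1 h2⟩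
    · exact ⟨_, satisfiesSpinorQuadrics_of_mul_eq_one' hu h1 h2⟩
  have key := aeval_eq_zero_of_mem_sup
    (ζ := fun T => fromPlucker x₀ (fun k => aeval w (graphForm L k)) w (evenEquiv.symm T))
    (fun f hf => by
      rcases hu with hu | hu
      · refine aeval_eq_zero_of_satisfiesSpinorQuadrics (u := -u) (Or.inl ?_) hx₀ hf
        simpa [fromPlucker] using hu
      · refine aeval_eq_zero_of_satisfiesSpinorQuadrics (u := u) (Or.inr ?_) hx₀ hf
        simpa [fromPlucker] using hu)
    (fun f hf => aeval_eq_zero_of_eq_fromPlucker hL x₀ w hf) hf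
  rw [aeval_linearPullback_spinorToPlucker] at key
  simpa only [evenEquiv_symm_evenSet, toPlucker_fromPlucker] using key

/-- Applies the lifting to the tautological point of the quadric section over its coordinate ring
localised at w₀₁ or w₀₂; vanishing there means vanishing after multiplication by a power. -/
lemma exists_pow_mul_mem (hL : ∀ x, x ∈ Λ ↔ ∃ x₀ w, coords x = fromPlucker x₀ (L w) w)
    {a : PluckerIndex} (ha : a = plk 0 1 ∨ a = plk 0 2) {f : MvPolynomial PluckerIndex ℂ}
    (hf : linearPullback spinorToPlucker f ∈ sectionIdeal Λ) :
    ∃ n, X a ^ n * f ∈ pluckerIdeal ⊔ Ideal.span {nodeQuadric L} := by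
  set K := pluckerIdeal ⊔ Ideal.span {nodeQuadric L}
  set S := Localization.Away (Ideal.Quotient.mk K (X a))
  set g : MvPolynomial PluckerIndex ℂ →ₐ[ℂ] S :=
    (IsScalarTower.toAlgHom ℂ (MvPolynomial PluckerIndex ℂ ⧸ K) S).comp (Ideal.Quotient.mkₐ ℂ K)
    with hg
  have hg1 : ∀ f, g f = algebraMap _ S (Ideal.Quotient.mk K f) := fun f => rfl
  have hg2 : ∀ f, aeval (fun i => g (X i)) f = g f := fun f => by
    rw [← comp_aeval_apply, aeval_X_left_apply]
  have hu : IsLocalization.Away.invSelf (Ideal.Quotient.mk K (X a)) * g (X a) = 1 := by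
    rw [hg1, mul_comm, IsLocalization.Away.mul_invSelf]
  have := aeval_eq_zero_of_fromPlucker hL (w := fun i => g (X i))
    (u := IsLocalization.Away.invSelf (Ideal.Quotient.mk K (X a)))
    (by rcases ha with rfl | rfl
        · exact Or.inl hu
        · exact Or.inr hu)
    (fun f hf => by rw [hg2, hg1, Ideal.Quotient.eq_zero_iff_mem.2 hf, map_zero]) hf
  rw [hg2, hg1, IsLocalization.map_eq_zero_iff (Submonoid.powers (Ideal.Quotient.mk K (X a)))] at this
  obtain ⟨⟨_, n, rfl⟩, hn⟩ := this
  refine ⟨n, ?_⟩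
  rw [← Ideal.Quotient.eq_zero_iff_mem, map_mul, map_pow]
  exact hn

lemma comap_linearPullback_spinorToPlucker
    (hL : ∀ x, x ∈ Λ ↔ ∃ x₀ w, coords x = fromPlucker x₀ (L w) w)
    (hq : nodeQuadric L ∉ pluckerIdeal) :
    (sectionIdeal Λ).comap (linearPullback spinorToPlucker) =
      pluckerIdeal ⊔ Ideal.span {nodeQuadric L} := by
  refine le_antisymm (fun f hf => ?_) fun f hf => linearPullback_spinorToPlucker_mem hL hf
  obtain ⟨n, hn⟩ := exists_pow_mul_mem hL (Or.inl rfl) hf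
  obtain ⟨m, hm⟩ := exists_pow_mul_mem hL (Or.inr rfl) hf
  exact mem_pluckerIdeal_sup_of_pow_mul_mem hq hn hm

end ProjectedIdeal

/-! ### The closed set of the projection -/

section Projection

variable {Λ : Submodule ℂ HalfSpin} {L : (PluckerIndex → ℂ) →ₗ[ℂ] (Fin 4 → ℂ)}

lemma satisfiesPluckerRelations_iff_mem {w : PluckerIndex → ℂ} :
    w ∈ grassmannCone ∩ {w | eval w (nodeQuadric L) = 0} ↔
      ∀ f ∈ pluckerIdeal ⊔ Ideal.span {nodeQuadric L}, eval w f = 0 := by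
  rw [Set.mem_inter_iff, mem_grassmannCone_iff_relations, satisfiesPluckerRelations_iff]
  constructor
  · rintro ⟨h1, h2⟩ f hf
    rw [← aeval_eq_eval]
    refine aeval_eq_zero_of_mem_sup h1 (fun g hg => ?_) hf
    obtain ⟨r, rfl⟩ := Ideal.mem_span_singleton.1 hg
    rw [map_mul, aeval_eq_eval, h2, zero_mul]
  · intro h
    refine ⟨fun f hf => ?_, h _ (Ideal.mem_sup_right (Ideal.mem_span_singleton_self _))⟩
    rw [aeval_eq_eval]
    exact h f (Ideal.mem_sup_left hf)

lemma spinorToPlucker_mem (hL : ∀ x, x ∈ Λ ↔ ∃ x₀ w, coords x = fromPlucker x₀ (L w) w)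
    {x : HalfSpin} (hx : x ∈ spinorCone ∩ (Λ : Set HalfSpin)) :
    spinorToPlucker x ∈ grassmannCone ∩ {w | eval w (nodeQuadric L) = 0} := by
  refine satisfiesPluckerRelations_iff_mem.2 fun f hf => ?_
  rw [← eval_linearPullback]
  exact eval_eq_zero_of_mem_sectionIdeal hx.1 hx.2 (linearPullback_spinorToPlucker_mem hL hf)

lemma exists_spinorToPlucker_eq (hL : ∀ x, x ∈ Λ ↔ ∃ x₀ w, coords x = fromPlucker x₀ (L w) w)
    {w : PluckerIndex → ℂ} (hw : w ∈ grassmannCone ∩ {w | eval w (nodeQuadric L) = 0})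
    (hw0 : w (plk 0 1) ≠ 0 ∨ w (plk 0 2) ≠ 0) :
    ∃ x ∈ (spinorCone ∩ (Λ : Set HalfSpin)) \ (Submodule.span ℂ {baseSpinor} : Set HalfSpin),
      spinorToPlucker x = w := by
  have h2 : w (plk 0 1) * L w 0 + w (plk 0 2) * L w 1 + w (plk 0 3) * L w 2 + w (plk 0 4) * L w 3 = 0 := by
    have := hw.2
    rw [Set.mem_ofPred_eq, ← aeval_eq_eval, aeval_nodeQuadric] at this
    simpa only [aeval_eq_eval, eval_graphForm] using this
  have h1 := (mem_grassmannCone_iff_relations w).1 hw.1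
  obtain ⟨x₀, hx₀⟩ : ∃ x₀, SatisfiesSpinorQuadrics (fromPlucker x₀ (L w) w) := by
    rcases hw0 with hu | hu
    · exact ⟨_, satisfiesSpinorQuadrics_of_mul_eq_one (inv_mul_cancel₀ hu) h1 h2⟩
    · exact ⟨_, satisfiesSpinorQuadrics_of_mul_eq_one' (inv_mul_cancel₀ hu) h1 h2⟩
  have hc : coords (coords.symm (fromPlucker x₀ (L w) w)) = fromPlucker x₀ (L w) w :=
    LinearEquiv.apply_symm_apply _ _
  refine ⟨coords.symm (fromPlucker x₀ (L w) w), ⟨⟨?_, ?_⟩, fun h => ?_⟩, ?_⟩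
  · rwa [mem_spinorCone_iff, hc]
  · exact (hL _).2 ⟨x₀, w, hc⟩
  · obtain ⟨c, hc'⟩ := Submodule.mem_span_singleton.1 h
    have h12 := congrFun (congrArg coords hc') 12
    have h13 := congrFun (congrArg coords hc') 13
    rw [hc, map_smul, coords_baseSpinor] at h12 h13
    simp [fromPlucker] at h12 h13
    rcases hw0 with hu | hu
    · exact hu h12
    · exact hu h13.symm
  · rw [spinorToPlucker_apply, hc, toPlucker_fromPlucker]

lemma zeroLocus_vanishingIdeal_spinorToPlucker
    (hL : ∀ x, x ∈ Λ ↔ ∃ x₀ w, coords x = fromPlucker x₀ (L w) w)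
    (hq : nodeQuadric L ∉ pluckerIdeal) :
    zeroLocus ℂ (vanishingIdeal ℂ (spinorToPlucker ''
      ((spinorCone ∩ (Λ : Set HalfSpin)) \ (Submodule.span ℂ {baseSpinor} : Set HalfSpin)))) =
      grassmannCone ∩ {w | eval w (nodeQuadric L) = 0} := by
  apply Set.Subset.antisymm
  · intro w hw
    refine satisfiesPluckerRelations_iff_mem.2 fun f hf => ?_
    rw [← aeval_eq_eval]
    refine hw f ?_
    rintro _ ⟨x, hx, rfl⟩
    rw [aeval_eq_eval]
    exact satisfiesPluckerRelations_iff_mem.1 (spinorToPlucker_mem hL hx.1) f hf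
  · intro w hw f hf
    -- Where the coordinate a is nonzero, points of the quadric section are images, so `X a * f`
    -- vanishes on all of it and the Nullstellensatz gives a power.
    have key : ∀ a, a = plk 0 1 ∨ a = plk 0 2 →
        ∃ n, (X a * f) ^ n ∈ pluckerIdeal ⊔ Ideal.span {nodeQuadric L} := by
      intro a ha
      change X a * f ∈ (pluckerIdeal ⊔ Ideal.span {nodeQuadric L}).radical
      rw [← vanishingIdeal_zeroLocus_eq_radical (K := ℂ)]
      intro y hy
      rw [map_mul, aeval_X]
      by_cases hy0 : y a = 0
      · rw [hy0, zero_mul]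
      · obtain ⟨x, hx, rfl⟩ := exists_spinorToPlucker_eq hL (w := y)
          (satisfiesPluckerRelations_iff_mem.2 fun g hg => by
            rw [← aeval_eq_eval]; exact hy g hg)
          (by rcases ha with rfl | rfl
              · exact Or.inl hy0
              · exact Or.inr hy0)
        rw [hf _ ⟨x, hx, rfl⟩, mul_zero]
    obtain ⟨n, hn⟩ := key _ (Or.inl rfl)
    obtain ⟨m, hm⟩ := key _ (Or.inr rfl)
    -- The common exponent n + m lets one power of f serve both localisations.
    have hfN : f ^ (n + m) ∈ pluckerIdeal ⊔ Ideal.span {nodeQuadric L} := by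
      refine mem_pluckerIdeal_sup_of_pow_mul_mem hq (n := n) (m := m) ?_ ?_
      · rw [pow_add, ← mul_assoc, ← mul_pow]
        exact Ideal.mul_mem_right _ _ hn
      · rw [pow_add, mul_left_comm, ← mul_pow]
        exact Ideal.mul_mem_left _ _ hm
    have := satisfiesPluckerRelations_iff_mem.1 hw _ hfN
    rw [map_pow] at this
    rw [aeval_eq_eval]
    exact eq_zero_of_pow_eq_zero this

end Projection

/-! ### The node quadric does not contain G(2,5) -/

section Dimension

/-- A chain of primes obtained by killing the variables one by one. -/
lemma le_ringKrullDim_of_parametrisation {σ : Type*} {I : Ideal (MvPolynomial σ ℂ)} {n : ℕ}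
    {Φ : σ → MvPolynomial (Fin n) ℂ} (hΦ : ∀ f ∈ I, aeval Φ f = 0) {d : MvPolynomial (Fin n) ℂ}
    (hd : ∀ i : Fin n, ∃ f : MvPolynomial σ ℂ, aeval Φ f = d * X i)
    (hd0 : ∀ k : ℕ, 0 < k → aeval (fun i : Fin n => if (i : ℕ) < k then X i else 0) d ≠
      (0 : MvPolynomial (Fin n) ℂ)) :
    (n : WithBot ℕ∞) ≤ ringKrullDim (MvPolynomial σ ℂ ⧸ I) := by
  set s : ℕ → MvPolynomial (Fin n) ℂ →ₐ[ℂ] MvPolynomial (Fin n) ℂ :=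
    fun k => aeval fun i : Fin n => if (i : ℕ) < k then X i else 0 with hs
  have hss : ∀ k f, s k (s (k + 1) f) = s k f := fun k f => by
    rw [← AlgHom.comp_apply]
    congr 1
    refine algHom_ext fun i => ?_
    simp only [hs, AlgHom.comp_apply, aeval_X]
    by_cases h : (i : ℕ) < k
    · rw [if_pos (Nat.lt_succ_of_lt h), if_pos h, aeval_X, if_pos h]
    · rw [if_neg h]
      split_ifs
      · rw [aeval_X, if_neg h]
      · rw [map_zero]
  set g : ℕ → (MvPolynomial σ ℂ ⧸ I) →+* MvPolynomial (Fin n) ℂ := fun k =>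
    Ideal.Quotient.lift I ((s k).comp (aeval Φ)).toRingHom fun f hf => by
      change s k (aeval Φ f) = 0
      rw [hΦ f hf, map_zero] with hg
  have hgk : ∀ k f, g k (Ideal.Quotient.mk I f) = s k (aeval Φ f) := fun k f => rfl
  let P : Fin (n + 1) → PrimeSpectrum (MvPolynomial σ ℂ ⧸ I) := fun k =>
    ⟨RingHom.ker (g (n - k)), RingHom.ker_isPrime _⟩
  have hP : ∀ k : Fin n, P k.castSucc < P k.succ := by
    intro k
    obtain ⟨m, hm⟩ : ∃ m : ℕ, n - (k : ℕ) = m + 1 := ⟨n - k - 1, by omega⟩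
    have hm' : n - ((k : ℕ) + 1) = m := by omega
    rw [← PrimeSpectrum.asIdeal_lt_asIdeal]
    change RingHom.ker (g (n - (k : ℕ))) < RingHom.ker (g (n - ((k : ℕ) + 1)))
    rw [hm, hm']
    -- A preimage of d·Xₘ dies once Xₘ is killed and not before, since d survives while at least one
    -- variable remains.
    refine lt_of_le_of_ne (fun x hx => ?_) fun h => ?_
    · obtain ⟨f, rfl⟩ := Ideal.Quotient.mk_surjective x
      rw [RingHom.mem_ker, hgk] at hx ⊢
      rw [← hss, hx, map_zero]
    · obtain ⟨f, hf⟩ := hd ⟨m, by omega⟩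
      have h1 : Ideal.Quotient.mk I f ∈ RingHom.ker (g m) := by
        rw [RingHom.mem_ker, hgk, hf, map_mul]
        simp [hs]
      rw [← h, RingHom.mem_ker, hgk, hf, map_mul] at h1
      rcases mul_eq_zero.1 h1 with h2 | h2
      · exact hd0 _ (Nat.succ_pos m) h2
      · simp [hs] at h2
  let c : LTSeries (PrimeSpectrum (MvPolynomial σ ℂ ⧸ I)) := ⟨n, P, hP⟩
  exact Order.LTSeries.length_le_krullDim c

/-- The Plücker coordinates of the bivectors `(y, w₁)`, scaled by `y₁`. -/
def pluckerChart {R : Type*} [CommRing R] (t : Fin 7 → R) : PluckerIndex → R := fun ij =>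
  (![![0, t 0 * t 0, t 0 * t 1, t 0 * t 2, t 0 * t 3], ![0, 0, t 0 * t 4, t 0 * t 5, t 0 * t 6],
    ![0, 0, 0, t 1 * t 5 - t 2 * t 4, t 1 * t 6 - t 3 * t 4],
    ![0, 0, 0, 0, t 2 * t 6 - t 3 * t 5], 0] : Fin 5 → Fin 5 → R) ij.1.1 ij.1.2

lemma satisfiesPluckerRelations_pluckerChart {R : Type*} [CommRing R] (t : Fin 7 → R) :
    SatisfiesPluckerRelations (pluckerChart t) := by
  simp only [SatisfiesPluckerRelations, pluckerChart, Matrix.cons_val]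
  refine ⟨?_, ?_, ?_, ?_, ?_⟩ <;> ring

variable {Λ : Submodule ℂ HalfSpin} {L : (PluckerIndex → ℂ) →ₗ[ℂ] (Fin 4 → ℂ)}

/-- Solving row 1 for x₀ leaves a denominator t₀; scaling the whole spinor by t₀ clears it. -/
lemma satisfiesSpinorQuadrics_pluckerChart {R : Type*} [CommRing R] [IsDomain R] (t : Fin 7 → R)
    (v : Fin 4 → R)
    (hv : t 0 * v 0 + t 1 * v 1 + t 2 * v 2 + t 3 * v 3 = 0) :
    SatisfiesSpinorQuadrics (fromPlucker (-(t 4 * v 1 + t 5 * v 2 + t 6 * v 3)) (fun k => t 0 * v k)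
      (fun a => t 0 * pluckerChart t a)) := by
  obtain ⟨h1, h2, h3, h4, h5⟩ := satisfiesPluckerRelations_pluckerChart t
  rw [satisfiesSpinorQuadrics_fromPlucker_iff]
  refine ⟨⟨?_, ?_, ?_, ?_, ?_⟩, ?_, ?_, ?_, ?_, ?_⟩
  · linear_combination t 0 ^ 2 * h1
  · linear_combination t 0 ^ 2 * h2
  · linear_combination t 0 ^ 2 * h3
  · linear_combination t 0 ^ 2 * h4
  · linear_combination t 0 ^ 2 * h5
  all_goals simp only [pluckerChart, Matrix.cons_val]
  · linear_combination t 0 ^ 3 * hv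
  · ring
  · linear_combination -t 0 ^ 2 * t 4 * hv
  · linear_combination -t 0 ^ 2 * t 5 * hv
  · linear_combination -t 0 ^ 2 * t 6 * hv

lemma map_pluckerChart {R S : Type*} [CommRing R] [CommRing S] (g : R →+* S) (t : Fin 7 → R)
    (a : PluckerIndex) : g (pluckerChart t a) = pluckerChart (fun i => g (t i)) a := by
  induction a using pluckerIndex_forall <;> simp [pluckerChart]

lemma nodeQuadric_not_mem_pluckerIdeal
    (hL : ∀ x, x ∈ Λ ↔ ∃ x₀ w, coords x = fromPlucker x₀ (L w) w)
    (hdim : ringKrullDim (MvPolynomial EvenSubset ℂ ⧸ sectionIdeal Λ) = 5 + 1) :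
    nodeQuadric L ∉ pluckerIdeal := by
  intro hq
  set v : (Fin 7 → ℂ) → Fin 4 → ℂ := fun t => L (pluckerChart t)
  have hv0 : ∀ t : Fin 7 → ℂ, t 0 * (t 0 * v t 0 + t 1 * v t 1 + t 2 * v t 2 + t 3 * v t 3) = 0 := by
    intro t
    have := (satisfiesPluckerRelations_iff _).1 (satisfiesPluckerRelations_pluckerChart t) _ hq
    rw [aeval_nodeQuadric] at this
    simp only [aeval_eq_eval, eval_graphForm] at this
    simp only [pluckerChart, Matrix.cons_val] at this
    linear_combination this
  set V : Fin 4 → MvPolynomial (Fin 7) ℂ := fun k => aeval (pluckerChart X) (graphForm L k) with hV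
  have hVe : ∀ (t : Fin 7 → ℂ) k, eval t (V k) = v t k := fun t k => by
    rw [← aeval_eq_eval, hV, comp_aeval_apply]
    simp only [← AlgHom.coe_toRingHom, map_pluckerChart]
    simp only [AlgHom.coe_toRingHom, aeval_X]
    rw [aeval_eq_eval, eval_graphForm]
  have hv : ∀ t : Fin 7 → ℂ, t 0 * v t 0 + t 1 * v t 1 + t 2 * v t 2 + t 3 * v t 3 = 0 := by
    -- The factor t₀ can only be cancelled between polynomials, as t₀ = 0 is allowed at points.
    have h : X 0 * V 0 + X 1 * V 1 + X 2 * V 2 + X 3 * V 3 = 0 := by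
      have h' : X 0 * (X 0 * V 0 + X 1 * V 1 + X 2 * V 2 + X 3 * V 3) = 0 :=
        MvPolynomial.funext fun t => by simpa [hVe] using hv0 t
      exact (mul_eq_zero.1 h').resolve_left (X_ne_zero 0)
    intro t
    have := congrArg (eval t) h
    simpa [hVe] using this
  have hchart : ∀ t : Fin 7 → ℂ, (fun T => eval t (fromPlucker (-(X 4 * V 1 + X 5 * V 2 + X 6 * V 3))
      (fun k => X 0 * V k) (fun a => X 0 * pluckerChart X a) (evenEquiv.symm T))) ∈
      spinorCone ∩ (Λ : Set HalfSpin) := by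
    intro t
    simp only [map_fromPlucker, map_neg, map_add, map_mul, eval_X, hVe, map_pluckerChart]
    constructor
    · rw [mem_spinorCone_iff, coords_comp_symm]
      exact satisfiesSpinorQuadrics_pluckerChart t (v t) (hv t)
    · refine (hL _).2 ⟨-(t 4 * v t 1 + t 5 * v t 2 + t 6 * v t 3),
        fun a => t 0 * pluckerChart t a, ?_⟩
      rw [coords_comp_symm]
      congr 1
      have := L.map_smul (t 0) (pluckerChart t)
      ext k
      exact (congrFun this k).symm
  -- The entries t₀tᵢ of the Plücker chart, scaled once more by t₀, give all t₀²tᵢ; hence d = t₀²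
  -- and the contradiction 7 ≤ 6.
  have h7 := le_ringKrullDim_of_parametrisation (I := sectionIdeal Λ) (n := 7)
    (Φ := fun T => fromPlucker (-(X 4 * V 1 + X 5 * V 2 + X 6 * V 3))
      (fun k => X 0 * V k) (fun a => X 0 * pluckerChart X a) (evenEquiv.symm T)) (d := X 0 ^ 2)
    (fun f hf => aeval_eq_zero_of_mem_sup
      (fun g hg => aeval_parametrisation_eq_zero (fun t => (hchart t).1) hg)
      (fun g hg => aeval_parametrisation_eq_zero (fun t => (hchart t).2) hg) hf)
    (fun i => by
      obtain ⟨a, ha⟩ : ∃ a, pluckerChart (X : Fin 7 → MvPolynomial (Fin 7) ℂ) a = X 0 * X i := by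
        fin_cases i
        · exact ⟨plk 0 1, rfl⟩
        · exact ⟨plk 0 2, rfl⟩
        · exact ⟨plk 0 3, rfl⟩
        · exact ⟨plk 0 4, rfl⟩
        · exact ⟨plk 1 2, rfl⟩
        · exact ⟨plk 1 3, rfl⟩
        · exact ⟨plk 1 4, rfl⟩
      refine ⟨linearPullback spinorToPlucker (X a), ?_⟩
      rw [aeval_linearPullback_spinorToPlucker]
      simp only [evenEquiv_symm_evenSet, toPlucker_fromPlucker, aeval_X, ha]
      ring)
    (fun k hk => by simp [hk])
  rw [hdim] at h7
  exact absurd h7 (by decide)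

end Dimension

/-! ### Arbitrary projections from the node -/

section Main

lemma exists_linearEquiv_of_ker_eq {V W₁ W₂ : Type*} [AddCommGroup V] [Module ℂ V] [AddCommGroup W₁]
    [Module ℂ W₁] [AddCommGroup W₂] [Module ℂ W₂] {f : V →ₗ[ℂ] W₁} {g : V →ₗ[ℂ] W₂}
    (hf : Function.Surjective f) (hg : Function.Surjective g)
    (h : LinearMap.ker f = LinearMap.ker g) : ∃ A : W₁ ≃ₗ[ℂ] W₂, ∀ x, A (f x) = g x := by
  refine ⟨(f.quotKerEquivOfSurjective hf).symm.trans ((Submodule.quotEquivOfEq _ _ h).trans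
    (g.quotKerEquivOfSurjective hg)), fun x => ?_⟩
  have : (f.quotKerEquivOfSurjective hf).symm (f x) = Submodule.Quotient.mk x := by
    rw [LinearEquiv.symm_apply_eq]
    rfl
  rw [LinearEquiv.trans_apply, this]
  rfl

lemma surjective_of_finrank_ker {V W : Type*} [AddCommGroup V] [Module ℂ V] [AddCommGroup W]
    [Module ℂ W] [FiniteDimensional ℂ V] [FiniteDimensional ℂ W] {f : V →ₗ[ℂ] W}
    (h : Module.finrank ℂ (LinearMap.ker f) + Module.finrank ℂ W = Module.finrank ℂ V) :
    Function.Surjective f := by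
  rw [← LinearMap.range_eq_top]
  apply Submodule.eq_top_of_finrank_eq
  have := LinearMap.finrank_range_add_finrank_ker f
  omega

lemma projectsToQuadricSection_of_graph {Λ : Submodule ℂ HalfSpin}
    {L : (PluckerIndex → ℂ) →ₗ[ℂ] (Fin 4 → ℂ)} (hs : IsNodalSection Λ baseSpinor)
    (hL : ∀ x, x ∈ Λ ↔ ∃ x₀ w, coords x = fromPlucker x₀ (L w) w)
    {π : HalfSpin →ₗ[ℂ] (Fin 10 → ℂ)}
    (hπ : Λ ⊓ LinearMap.ker π = Submodule.span ℂ {baseSpinor}) :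
    ProjectsToQuadricSection Λ baseSpinor π := by
  have hw : Λ ⊓ LinearMap.ker spinorToPlucker = Submodule.span ℂ {baseSpinor} := by
    ext x
    rw [Submodule.mem_inf, LinearMap.mem_ker, spinorToPlucker_apply, Submodule.mem_span_singleton]
    constructor
    · rintro ⟨h1, h2⟩
      obtain ⟨x₀, w, hx⟩ := (hL x).1 h1
      rw [hx, toPlucker_fromPlucker] at h2
      refine ⟨x₀, coords.injective ?_⟩
      rw [hx, map_smul, coords_baseSpinor, h2, map_zero]
      apply spinor_ext <;> simp [fromPlucker]
    · rintro ⟨c, rfl⟩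
      refine ⟨Λ.smul_mem c hs.mem, ?_⟩
      rw [map_smul, coords_baseSpinor]
      ext a
      induction a using pluckerIndex_forall <;> simp [toPlucker]
  have hker : ∀ {W : Type} [AddCommGroup W] [Module ℂ W] (f : HalfSpin →ₗ[ℂ] W),
      (LinearMap.ker (f.domRestrict Λ)).map Λ.subtype = Λ ⊓ LinearMap.ker f := by
    intro W _ _ f
    ext x
    simp [and_comm]
  have hfin : ∀ {W : Type} [AddCommGroup W] [Module ℂ W] (f : HalfSpin →ₗ[ℂ] W),
      Λ ⊓ LinearMap.ker f = Submodule.span ℂ {baseSpinor} →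
      Module.finrank ℂ (LinearMap.ker (f.domRestrict Λ)) = 1 := by
    intro W _ _ f hf
    rw [← finrank_span_singleton (K := ℂ) hs.isNode.1, ← hf, ← hker]
    exact LinearEquiv.finrank_eq (Submodule.equivMapOfInjective _ Λ.injective_subtype _)
  -- On Λ both maps have kernel ⟨p⟩ and are onto because 1 + 10 = 11, so they differ by an
  -- isomorphism of the targets.
  obtain ⟨A, hA⟩ := exists_linearEquiv_of_ker_eq (f := π.domRestrict Λ)
    (g := spinorToPlucker.domRestrict Λ)
    (surjective_of_finrank_ker (by rw [hfin π hπ, hs.finrank_eq, Module.finrank_fin_fun]))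
    (surjective_of_finrank_ker (by
      rw [hfin _ hw, hs.finrank_eq, Module.finrank_fintype_fun_eq_card, card_pluckerIndex]))
    (Submodule.map_injective_of_injective Λ.injective_subtype (by rw [hker, hker, hπ, hw]))
  have hA' : ∀ x ∈ Λ, A (π x) = spinorToPlucker x := fun x hx => hA ⟨x, hx⟩
  have hq := nodeQuadric_not_mem_pluckerIdeal hL hs.dim_eq
  refine ⟨A, nodeQuadric L, isHomogeneous_nodeQuadric L, ?_, ?_, ?_⟩
  · rwa [vanishingIdeal_grassmannCone]
  · rw [← zeroLocus_vanishingIdeal_spinorToPlucker hL hq, projectedCone]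
    have himg : A '' (π '' ((spinorCone ∩ (Λ : Set HalfSpin)) \
        (Submodule.span ℂ {baseSpinor} : Set HalfSpin))) = spinorToPlucker ''
        ((spinorCone ∩ (Λ : Set HalfSpin)) \ (Submodule.span ℂ {baseSpinor} : Set HalfSpin)) := by
      rw [Set.image_image]
      exact Set.image_congr fun x hx => hA' x hx.1.2
    rw [← himg]
    generalize π '' ((spinorCone ∩ (Λ : Set HalfSpin)) \
        (Submodule.span ℂ {baseSpinor} : Set HalfSpin)) = M
    have hv := vanishingIdeal_comap A.toLinearMap M
    have hv' := vanishingIdeal_comap A.symm.toLinearMap (A '' M)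
    have hM : A.symm.toLinearMap '' (A '' M) = M := by
      rw [Set.image_image]
      simp
    rw [hM] at hv'
    ext w
    constructor
    · rintro ⟨y, hy, rfl⟩ f hf
      have hf' : f ∈ (vanishingIdeal ℂ M).comap (linearPullback A.toLinearMap) := by rwa [hv]
      have := hy _ hf'
      rwa [aeval_eq_eval, eval_linearPullback, ← aeval_eq_eval] at this
    · intro hw
      refine ⟨A.symm w, fun f hf => ?_, A.apply_symm_apply w⟩
      rw [← hv'] at hf
      have := hw _ hf
      rwa [aeval_eq_eval, eval_linearPullback, ← aeval_eq_eval] at this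
  · rw [vanishingIdeal_grassmannCone, ← comap_linearPullback_spinorToPlucker hL hq]
    ext f
    rw [Ideal.mem_comap, projectedIdeal, Ideal.mem_comap, Ideal.mem_comap,
      linearPullback_linearPullback, ← sub_add_cancel
        (linearPullback (A.toLinearMap ∘ₗ π) f) (linearPullback spinorToPlucker f)]
    -- The maps A ∘ π and `spinorToPlucker` agree only on Λ; the pullbacks of f differ by an element
    -- of the ideal of Λ, which is part of the section ideal.
    refine (Ideal.add_mem_iff_right _ (Ideal.mem_sup_right fun x hx => ?_))
    rw [aeval_eq_eval, map_sub, eval_linearPullback, eval_linearPullback, sub_eq_zero]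
    exact congrArg (fun w => eval w f) (hA' x hx)

end Main

theorem mainTheorem2 (Λ : Submodule ℂ HalfSpin) (p : HalfSpin)
    (hΛ : Module.finrank ℂ Λ = 11)
    (hdim : ringKrullDim (MvPolynomial EvenSubset ℂ ⧸ sectionIdeal Λ) = 5 + 1)
    (hpS : p ∈ spinorCone) (hpΛ : p ∈ Λ)
    (hnode : IsNode 5 (sectionIdeal Λ) p)
    (π : HalfSpin →ₗ[ℂ] (Fin 10 → ℂ))
    (hπ : Λ ⊓ LinearMap.ker π = Submodule.span ℂ {p}) :
    ∃ (A : (Fin 10 → ℂ) ≃ₗ[ℂ] (PluckerIndex → ℂ)) (q : MvPolynomial PluckerIndex ℂ),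
      q.IsHomogeneous 2 ∧ q ∉ vanishingIdeal ℂ grassmannCone ∧
      A '' projectedCone Λ p π = grassmannCone ∩ {w | eval w q = 0} ∧
      (projectedIdeal Λ π).comap (linearPullback A.toLinearMap) =
        vanishingIdeal ℂ grassmannCone ⊔ Ideal.span {q} := by
  refine nodalProjectionProperty_of_baseSpinor (nodalProjectionProperty_of_normalForm
    fun Λ hΛ hs π hπ => ?_) Λ p ⟨hΛ, hdim, hpS, hpΛ, hnode⟩ π hπ
  obtain ⟨L, hL⟩ := hs.exists_graph hΛ
  exact projectsToQuadricSection_of_graph hs hL hπ
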